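/- **Conventions.** Composites of transversal maps are written in diagrammatic order with $;$. A *weak double category* over a category (its objects and strict arrows) consists of weak arrows $h : A \to B$ and double cells $\phi : h \to h'$, each with two strict faces $A\to A'$, $B\to B'$; strict composition and identities of cells, making cells and weak arrows a category with functorial faces; functorial weak identities; functorial weak composition of weak arrows and of cells with a common face; and natural invertible cells $\lambda$ (left unitor), $\rho$ (right unitor), $\kappa$ (associator) with identity faces, satisfying the pentagon and triangle axioms. An *intercategory* $\mathsf A$ consists of: objects and transversal arrows, forming a category; horizontal arrows and horizontal cells, forming a weak double category over it, with identities $\mathrm{id}_A$ and composite $h|h'$; vertical arrows and vertical cells, forming a weak double category over it, with identities $\mathrm{Id}_A$ and composite $\frac{v}{v'}$; basic cells $\alpha$, each bounded by horizontal arrows at the top and bottom and by vertical arrows at the left and right; and cubes $c:\alpha\to\beta$ between basic cells, with four lateral faces: horizontal cells at the top and bottom, vertical cells at the left and right, fitting together along their strict faces. Basic cells and cubes form two weak double categories: under horizontal composition $\alpha|\beta$ with identities $\mathrm{id}_v$ (over vertical arrows and cells) and under vertical composition $\frac{\alpha}{\bar\alpha}$ with identities $\mathrm{Id}_h$ (over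 horizontal arrows and cells). The top and bottom faces strictly preserve the horizontal structure and the left and right faces strictly preserve the vertical structure. Finally there are natural cubes with identity lateral faces, the *interchangers* $$\tau:\mathrm{Id}_{\mathrm{id}_A}\to \mathrm{id}_{\mathrm{Id}_A},\qquad \mu:\tfrac{\mathrm{id}_v}{\mathrm{id}_{\bar v}}\to \mathrm{id}_{\frac{v}{\bar v}},\qquad \delta:\mathrm{Id}_{h|k}\to \mathrm{Id}_h|\mathrm{Id}_k,\qquad \chi:\frac{\alpha|\beta}{\bar\alpha|\bar\beta}\to \frac{\alpha}{\bar\alpha}\Big|\frac{\beta}{\bar\beta},$$ subject to the twelve coherence conditions saying that, with respect to the vertical structure, horizontal identity (with laxity $\tau,\mu$) and horizontal composition (with laxity $\delta,\chi$) satisfy the associativity and two unit laws of a lax functor (six conditions), and the horizontal $\kappa,\lambda,\rho$ are compatible with these laxities, in nullary and binary form (six conditions). We assume that, for given domain and codomain, transversal arrows, horizontal cells, vertical cells and cubes form sets. A *lax-lax morphism* $F:\mathsf A\to\mathsf B$ of intercategories sends objects, transversal, horizontal and vertical arrows, horizontal and vertical cells, basic cells and cubes to the same kind of things, preserves boundaries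 and transversal composition and identities strictly, and has laxity cells $$F_h:\mathrm{id}_{FA}\to F(\mathrm{id}_A),\quad F_h:Fh|Fk\to F(h|k),\quad F_v:\mathrm{Id}_{FA}\to F(\mathrm{Id}_A),\quad F_v:\tfrac{Fv}{F\bar v}\to F(\tfrac{v}{\bar v})$$ with identity transversal faces, and laxity cubes $$F_h:\mathrm{id}_{Fv}\to F(\mathrm{id}_v),\quad F_h:F\alpha|F\beta\to F(\alpha|\beta),\quad F_v:\mathrm{Id}_{Fh}\to F(\mathrm{Id}_h),\quad F_v:\tfrac{F\alpha}{F\bar\alpha}\to F(\tfrac{\alpha}{\bar\alpha}).$$ The top and bottom faces of the cubes $F_h$ are the corresponding laxity cells $F_h$ and their left and right faces are identities; the left and right faces of the cubes $F_v$ are the corresponding laxity cells $F_v$ and their top and bottom faces are identities. All of these are natural with respect to the transversal structure, and they satisfy the unit and associativity conditions of a lax double functor: on horizontal arrows, on vertical arrows, on basic cells horizontally and on basic cells vertically. Moreover they are compatible with the four interchangers: $$\mathrm{Id}_{F_h}\,;\,F_v\,;\,F(\tau)=\tau\,;\,\mathrm{id}_{F_v}\,;\,F_h :\ \mathrm{Id}_{\mathrm{id}_{FA}}\to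 F(\mathrm{id}_{\mathrm{Id}_A}),$$ $$\tfrac{F_h}{F_h}\,;\,F_v\,;\,F(\mu)=\mu\,;\,\mathrm{id}_{F_v}\,;\,F_h :\ \tfrac{\mathrm{id}_{Fv}}{\mathrm{id}_{F\bar v}}\to F(\mathrm{id}_{\frac{v}{\bar v}}),$$ $$\mathrm{Id}_{F_h}\,;\,F_v\,;\,F(\delta)=\delta\,;\,(F_v|F_v)\,;\,F_h :\ \mathrm{Id}_{Fh|Fk}\to F(\mathrm{Id}_h|\mathrm{Id}_k),$$ $$\tfrac{F_h}{F_h}\,;\,F_v\,;\,F(\chi)=\chi\,;\,(F_v|F_v)\,;\,F_h :\ \tfrac{F\alpha|F\beta}{F\bar\alpha|F\bar\beta}\to F\big(\tfrac{\alpha}{\bar\alpha}\big|\tfrac{\beta}{\bar\beta}\big).$$ The intercategory $\mathsf{Set}=\mathsf{Span}(\mathsf{Span}(\mathbf{Set}))$ has sets as objects, functions as transversal arrows, spans as horizontal and as vertical arrows, morphisms of spans (with arbitrary functions at the two ends) as horizontal and vertical cells, spans of spans (a set with compatible projections to the apexes of four spans forming a square) as basic cells, and morphisms of these as cubes. Horizontal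 and vertical composition are by pullback, and the structural isomorphisms and interchangers are the canonical ones. **Theorem.** Let $\mathsf A$ be an intercategory and $X$ an object of $\mathsf A$. The following is a well-defined lax-lax morphism of intercategories $H=\mathsf A(X,-):\mathsf A\to\mathsf{Set}$. * $H(A)$ is the set of transversal arrows $X\to A$. * For a horizontal arrow $h:A\to B$, $H(h)$ is the span $H(A)\leftarrow H(h)\to H(B)$ of all horizontal cells $\phi:\mathrm{id}_X\to h$, projecting to their two transversal faces. For a vertical arrow $v$, $H(v)$ is likewise the span of all vertical cells $\psi:\mathrm{Id}_X\to v$. * For a basic cell $\alpha$ with top $h$, bottom $\bar h$, left $v$ and right $w$, $H(\alpha)$ is the span of spans of all cubes $c:\mathrm{Id}_{\mathrm{id}_X}\to\alpha$, projecting to the four lateral faces of $c$ in $H(h)$, $H(\bar h)$, $H(v)$, $H(w)$. * On transversal arrows, horizontal cells, vertical cells and cubes, $H$ acts by transversal composition. * The laxity of $H$ on horizontal and vertical arrows is: $f\mapsto \mathrm{id}_f$ and $(\phi,\phi')\mapsto \lambda^{-1};(\phi|\phi')$ horizontally, $f\mapsto\mathrm{Id}_f$ and $(\psi,\psi')\mapsto\lambda^{-1};\frac{\psi}{\psi'}$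 vertically. * The horizontal laxity on basic cells is $$H_h:\mathrm{id}_{H(v)}\to H(\mathrm{id}_v),\quad (\psi:\mathrm{Id}_X\to v)\longmapsto\big(\mathrm{Id}_{\mathrm{id}_X}\xrightarrow{\tau}\mathrm{id}_{\mathrm{Id}_X}\xrightarrow{\mathrm{id}_\psi}\mathrm{id}_v\big),$$ $$H_h:H(\alpha)|H(\beta)\to H(\alpha|\beta),\quad (c,d)\longmapsto\big(\mathrm{Id}_{\mathrm{id}_X}\xrightarrow{\mathrm{Id}_{\lambda^{-1}}}\mathrm{Id}_{\mathrm{id}_X|\mathrm{id}_X}\xrightarrow{\delta}\mathrm{Id}_{\mathrm{id}_X}|\mathrm{Id}_{\mathrm{id}_X}\xrightarrow{c|d}\alpha|\beta\big).$$ * The vertical laxity on basic cells is $$H_v:\mathrm{Id}_{H(h)}\to H(\mathrm{Id}_h),\quad (\phi:\mathrm{id}_X\to h)\longmapsto\big(\mathrm{Id}_{\mathrm{id}_X}\xrightarrow{\mathrm{Id}_\phi}\mathrm{Id}_h\big),$$ $$H_v:\frac{H(\alpha)}{H(\bar\alpha)}\to H\Big(\frac{\alpha}{\bar\alpha}\Big),\quad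 (c,\bar c)\longmapsto\Big(\mathrm{Id}_{\mathrm{id}_X}\xrightarrow{\lambda^{-1}}\frac{\mathrm{Id}_{\mathrm{id}_X}}{\mathrm{Id}_{\mathrm{id}_X}}\xrightarrow{\frac{c}{\bar c}}\frac{\alpha}{\bar\alpha}\Big).$$ -/

import Mathlib

open CategoryTheory

universe v w w₁ w₂ w₃ w' w₁' w₂' w₃' u u'

/-! ## Weak double categories (pseudocategories in the 2-category of categories) -/

/-- The data of a weak double category over the objects and strict arrows of `O`: weak arrows `Arr`,
double cells with their strict composition (`one`, `comp`), weak identities and weak composition,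
and the structural cells. A cell `φ : Cell h k` carries its two strict faces `src φ` and `tgt φ`,
so that the weak composite of two cells asks for a proof that the common face agrees. -/
structure DoubleData (O : Type u) [CategoryStruct.{v} O] where
  Arr : O → O → Type w
  Cell : ∀ {A B A' B' : O}, Arr A B → Arr A' B' → Type v
  src : ∀ {A B A' B' : O} {h : Arr A B} {k : Arr A' B'}, Cell h k → (A ⟶ A')
  tgt : ∀ {A B A' B' : O} {h : Arr A B} {k : Arr A' B'}, Cell h k → (B ⟶ B')
  one : ∀ {A B : O} (h : Arr A B), Cell h h
  comp : ∀ {A B A' B' A'' B'' : O} {h : Arr A B} {k : Arr A' B'} {l : Arr A'' B''},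
    Cell h k → Cell k l → Cell h l
  unit : ∀ A : O, Arr A A
  unitCell : ∀ {A A' : O} (_ : A ⟶ A'), Cell (unit A) (unit A')
  cmp : ∀ {A B C : O}, Arr A B → Arr B C → Arr A C
  cmpCell : ∀ {A B C A' B' C' : O} {h : Arr A B} {h' : Arr B C} {k : Arr A' B'} {k' : Arr B' C'}
    (φ : Cell h k) (ψ : Cell h' k'), tgt φ = src ψ → Cell (cmp h h') (cmp k k')
  lam : ∀ {A B : O} (h : Arr A B), Cell (cmp (unit A) h) h
  lamInv : ∀ {A B : O} (h : Arr A B), Cell h (cmp (unit A) h)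
  rho : ∀ {A B : O} (h : Arr A B), Cell (cmp h (unit B)) h
  rhoInv : ∀ {A B : O} (h : Arr A B), Cell h (cmp h (unit B))
  assoc : ∀ {A B C D : O} (h : Arr A B) (k : Arr B C) (l : Arr C D),
    Cell (cmp (cmp h k) l) (cmp h (cmp k l))
  assocInv : ∀ {A B C D : O} (h : Arr A B) (k : Arr B C) (l : Arr C D),
    Cell (cmp h (cmp k l)) (cmp (cmp h k) l)

/-- Strict (transversal) composition of double cells. -/
infixr:80 " ⋄ " => DoubleData.comp _

/-- The laws of a weak double category. Here and below, the hypotheses `e`, `e₁`, … are the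
matching conditions that make the weak composites defined. -/
structure DoubleData.IsWeak {O : Type u} [CategoryStruct.{v} O] (D : DoubleData.{v, w} O) :
    Prop where
  one_comp : ∀ {A B A' B' : O} {h : D.Arr A B} {k : D.Arr A' B'} (φ : D.Cell h k),
    D.one h ⋄ φ = φ
  comp_one : ∀ {A B A' B' : O} {h : D.Arr A B} {k : D.Arr A' B'} (φ : D.Cell h k),
    φ ⋄ D.one k = φ
  comp_assoc : ∀ {A B A' B' A'' B'' A₃ B₃ : O} {h : D.Arr A B} {k : D.Arr A' B'}
    {l : D.Arr A'' B''} {m : D.Arr A₃ B₃} (φ : D.Cell h k) (ψ : D.Cell k l) (θ : D.Cell l m),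
    (φ ⋄ ψ) ⋄ θ = φ ⋄ (ψ ⋄ θ)
  -- the faces and the weak identities are functors
  src_one : ∀ {A B : O} (h : D.Arr A B), D.src (D.one h) = 𝟙 A
  tgt_one : ∀ {A B : O} (h : D.Arr A B), D.tgt (D.one h) = 𝟙 B
  src_comp : ∀ {A B A' B' A'' B'' : O} {h : D.Arr A B} {k : D.Arr A' B'} {l : D.Arr A'' B''}
    (φ : D.Cell h k) (ψ : D.Cell k l), D.src (φ ⋄ ψ) = D.src φ ≫ D.src ψ
  tgt_comp : ∀ {A B A' B' A'' B'' : O} {h : D.Arr A B} {k : D.Arr A' B'} {l : D.Arr A'' B''}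
    (φ : D.Cell h k) (ψ : D.Cell k l), D.tgt (φ ⋄ ψ) = D.tgt φ ≫ D.tgt ψ
  src_unitCell : ∀ {A A' : O} (f : A ⟶ A'), D.src (D.unitCell f) = f
  tgt_unitCell : ∀ {A A' : O} (f : A ⟶ A'), D.tgt (D.unitCell f) = f
  unitCell_id : ∀ A : O, D.unitCell (𝟙 A) = D.one (D.unit A)
  unitCell_comp : ∀ {A A' A'' : O} (f : A ⟶ A') (g : A' ⟶ A''),
    D.unitCell (f ≫ g) = D.unitCell f ⋄ D.unitCell g
  -- weak composition is a functor
  src_cmpCell : ∀ {A B C A' B' C' : O} {h : D.Arr A B} {h' : D.Arr B C} {k : D.Arr A' B'}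
    {k' : D.Arr B' C'} (φ : D.Cell h k) (ψ : D.Cell h' k') (e : D.tgt φ = D.src ψ),
    D.src (D.cmpCell φ ψ e) = D.src φ
  tgt_cmpCell : ∀ {A B C A' B' C' : O} {h : D.Arr A B} {h' : D.Arr B C} {k : D.Arr A' B'}
    {k' : D.Arr B' C'} (φ : D.Cell h k) (ψ : D.Cell h' k') (e : D.tgt φ = D.src ψ),
    D.tgt (D.cmpCell φ ψ e) = D.tgt ψ
  cmpCell_one : ∀ {A B C : O} (h : D.Arr A B) (k : D.Arr B C) (e : _),
    D.cmpCell (D.one h) (D.one k) e = D.one (D.cmp h k)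
  cmpCell_comp : ∀ {A B C A' B' C' A'' B'' C'' : O} {h : D.Arr A B} {h' : D.Arr B C}
    {k : D.Arr A' B'} {k' : D.Arr B' C'} {l : D.Arr A'' B''} {l' : D.Arr B'' C''}
    (φ : D.Cell h k) (ψ : D.Cell k l) (φ' : D.Cell h' k') (ψ' : D.Cell k' l')
    (e₁ : D.tgt φ = D.src φ') (e₂ : D.tgt ψ = D.src ψ') (e : _),
    D.cmpCell (φ ⋄ ψ) (φ' ⋄ ψ') e = D.cmpCell φ φ' e₁ ⋄ D.cmpCell ψ ψ' e₂
  -- left unitor: a natural special isomorphism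
  src_lam : ∀ {A B : O} (h : D.Arr A B), D.src (D.lam h) = 𝟙 A
  tgt_lam : ∀ {A B : O} (h : D.Arr A B), D.tgt (D.lam h) = 𝟙 B
  lam_lamInv : ∀ {A B : O} (h : D.Arr A B), D.lam h ⋄ D.lamInv h = D.one _
  lamInv_lam : ∀ {A B : O} (h : D.Arr A B), D.lamInv h ⋄ D.lam h = D.one _
  lam_nat : ∀ {A B A' B' : O} {h : D.Arr A B} {k : D.Arr A' B'} (φ : D.Cell h k) (e : _),
    D.cmpCell (D.unitCell (D.src φ)) φ e ⋄ D.lam k = D.lam h ⋄ φ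
  -- right unitor
  src_rho : ∀ {A B : O} (h : D.Arr A B), D.src (D.rho h) = 𝟙 A
  tgt_rho : ∀ {A B : O} (h : D.Arr A B), D.tgt (D.rho h) = 𝟙 B
  rho_rhoInv : ∀ {A B : O} (h : D.Arr A B), D.rho h ⋄ D.rhoInv h = D.one _
  rhoInv_rho : ∀ {A B : O} (h : D.Arr A B), D.rhoInv h ⋄ D.rho h = D.one _
  rho_nat : ∀ {A B A' B' : O} {h : D.Arr A B} {k : D.Arr A' B'} (φ : D.Cell h k) (e : _),
    D.cmpCell φ (D.unitCell (D.tgt φ)) e ⋄ D.rho k = D.rho h ⋄ φ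
  -- associator
  src_assoc : ∀ {A B C E : O} (h : D.Arr A B) (k : D.Arr B C) (l : D.Arr C E),
    D.src (D.assoc h k l) = 𝟙 A
  tgt_assoc : ∀ {A B C E : O} (h : D.Arr A B) (k : D.Arr B C) (l : D.Arr C E),
    D.tgt (D.assoc h k l) = 𝟙 E
  assoc_assocInv : ∀ {A B C E : O} (h : D.Arr A B) (k : D.Arr B C) (l : D.Arr C E),
    D.assoc h k l ⋄ D.assocInv h k l = D.one _
  assocInv_assoc : ∀ {A B C E : O} (h : D.Arr A B) (k : D.Arr B C) (l : D.Arr C E),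
    D.assocInv h k l ⋄ D.assoc h k l = D.one _
  assoc_nat : ∀ {A B C E A' B' C' E' : O} {h : D.Arr A B} {k : D.Arr B C} {l : D.Arr C E}
    {h' : D.Arr A' B'} {k' : D.Arr B' C'} {l' : D.Arr C' E'}
    (φ : D.Cell h h') (ψ : D.Cell k k') (θ : D.Cell l l')
    (e₁ : D.tgt φ = D.src ψ) (e₂ : D.tgt ψ = D.src θ) (e₃ e₄ : _),
    D.cmpCell (D.cmpCell φ ψ e₁) θ e₃ ⋄ D.assoc h' k' l' =
      D.assoc h k l ⋄ D.cmpCell φ (D.cmpCell ψ θ e₂) e₄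
  -- coherence
  pentagon : ∀ {A B C E F : O} (h : D.Arr A B) (k : D.Arr B C) (l : D.Arr C E) (m : D.Arr E F)
    (e₁ e₂ : _),
    D.cmpCell (D.assoc h k l) (D.one m) e₁ ⋄ D.assoc h (D.cmp k l) m ⋄
        D.cmpCell (D.one h) (D.assoc k l m) e₂ =
      D.assoc (D.cmp h k) l m ⋄ D.assoc h k (D.cmp l m)
  triangle : ∀ {A B C : O} (h : D.Arr A B) (k : D.Arr B C) (e₁ e₂ : _),
    D.assoc h (D.unit B) k ⋄ D.cmpCell (D.one h) (D.lam k) e₁ =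
      D.cmpCell (D.rho h) (D.one k) e₂

/-- All weak arrows of a double category, with their end points. -/
structure DoubleData.Tot {O : Type u} [CategoryStruct.{v} O] (D : DoubleData.{v, w} O) where
  dom : O
  cod : O
  arr : D.Arr dom cod

/-- Weak arrows and double cells under strict composition. -/
instance DoubleData.totCat {O : Type u} [CategoryStruct.{v} O] (D : DoubleData.{v, w} O) :
    CategoryStruct.{v} D.Tot where
  Hom h k := D.Cell h.arr k.arr
  id h := D.one h.arr
  comp φ ψ := D.comp φ ψ

/-! ## Lax double functors -/

/-- The data of a lax double functor, whose action on objects and strict arrows is `F`. -/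
structure LaxData {O : Type u} [CategoryStruct.{v} O] {P : Type u'} [CategoryStruct.{v} P]
    (D : DoubleData.{v, w} O) (E : DoubleData.{v, w'} P) (F : O ⥤q P) where
  arr : ∀ {A B : O}, D.Arr A B → E.Arr (F.obj A) (F.obj B)
  cell : ∀ {A B A' B' : O} {h : D.Arr A B} {k : D.Arr A' B'}, D.Cell h k → E.Cell (arr h) (arr k)
  unitLax : ∀ A : O, E.Cell (E.unit (F.obj A)) (arr (D.unit A))
  cmpLax : ∀ {A B C : O} (h : D.Arr A B) (k : D.Arr B C),
    E.Cell (E.cmp (arr h) (arr k)) (arr (D.cmp h k))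

/-- The action of a lax double functor on weak arrows and cells. -/
def LaxData.tot {O : Type u} [CategoryStruct.{v} O] {P : Type u'} [CategoryStruct.{v} P]
    {D : DoubleData.{v, w} O} {E : DoubleData.{v, w'} P} {F : O ⥤q P} (L : LaxData D E F) :
    D.Tot ⥤q E.Tot where
  obj h := ⟨F.obj h.dom, F.obj h.cod, L.arr h.arr⟩
  map φ := L.cell φ

/-- The laws of a lax double functor. -/
structure LaxData.IsLax {O : Type u} [CategoryStruct.{v} O] {P : Type u'} [CategoryStruct.{v} P]
    {D : DoubleData.{v, w} O} {E : DoubleData.{v, w'} P} {F : O ⥤q P} (L : LaxData D E F) :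
    Prop where
  src_cell : ∀ {A B A' B' : O} {h : D.Arr A B} {k : D.Arr A' B'} (φ : D.Cell h k),
    E.src (L.cell φ) = F.map (D.src φ)
  tgt_cell : ∀ {A B A' B' : O} {h : D.Arr A B} {k : D.Arr A' B'} (φ : D.Cell h k),
    E.tgt (L.cell φ) = F.map (D.tgt φ)
  cell_one : ∀ {A B : O} (h : D.Arr A B), L.cell (D.one h) = E.one (L.arr h)
  cell_comp : ∀ {A B A' B' A'' B'' : O} {h : D.Arr A B} {k : D.Arr A' B'} {l : D.Arr A'' B''}
    (φ : D.Cell h k) (ψ : D.Cell k l), L.cell (φ ⋄ ψ) = L.cell φ ⋄ L.cell ψ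
  -- the laxity cells are special and natural
  src_unitLax : ∀ A : O, E.src (L.unitLax A) = 𝟙 (F.obj A)
  tgt_unitLax : ∀ A : O, E.tgt (L.unitLax A) = 𝟙 (F.obj A)
  src_cmpLax : ∀ {A B C : O} (h : D.Arr A B) (k : D.Arr B C),
    E.src (L.cmpLax h k) = 𝟙 (F.obj A)
  tgt_cmpLax : ∀ {A B C : O} (h : D.Arr A B) (k : D.Arr B C),
    E.tgt (L.cmpLax h k) = 𝟙 (F.obj C)
  unitLax_nat : ∀ {A A' : O} (f : A ⟶ A'),
    E.unitCell (F.map f) ⋄ L.unitLax A' = L.unitLax A ⋄ L.cell (D.unitCell f)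
  cmpLax_nat : ∀ {A B C A' B' C' : O} {h : D.Arr A B} {h' : D.Arr B C} {k : D.Arr A' B'}
    {k' : D.Arr B' C'} (φ : D.Cell h k) (ψ : D.Cell h' k') (e : D.tgt φ = D.src ψ) (e' : _),
    E.cmpCell (L.cell φ) (L.cell ψ) e' ⋄ L.cmpLax k k' =
      L.cmpLax h h' ⋄ L.cell (D.cmpCell φ ψ e)
  -- coherence with the two unitors and the associator
  lax_lam : ∀ {A B : O} (h : D.Arr A B) (e : _),
    E.cmpCell (L.unitLax A) (E.one (L.arr h)) e ⋄ L.cmpLax (D.unit A) h ⋄ L.cell (D.lam h) =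
      E.lam (L.arr h)
  lax_rho : ∀ {A B : O} (h : D.Arr A B) (e : _),
    E.cmpCell (E.one (L.arr h)) (L.unitLax B) e ⋄ L.cmpLax h (D.unit B) ⋄ L.cell (D.rho h) =
      E.rho (L.arr h)
  lax_assoc : ∀ {A B C G : O} (h : D.Arr A B) (k : D.Arr B C) (l : D.Arr C G) (e₁ e₂ : _),
    E.cmpCell (L.cmpLax h k) (E.one (L.arr l)) e₁ ⋄ L.cmpLax (D.cmp h k) l ⋄
        L.cell (D.assoc h k l) =
      E.assoc (L.arr h) (L.arr k) (L.arr l) ⋄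
        E.cmpCell (E.one (L.arr h)) (L.cmpLax k l) e₂ ⋄ L.cmpLax h (D.cmp k l)

/-! ## Intercategories -/

/-- The data of an intercategory over the category of objects and transversal arrows.
`hor` consists of the horizontal arrows and horizontal cells, `ver` of the vertical arrows and
vertical cells. `Basic h v w k` is the type of basic cells with top `h`, left side `v`, right side
`w` and bottom `k`; a cube `c : Cube α β` goes from its back face `α` to its front face `β`.
`ccomp` is transversal, `hcmp` horizontal and `vcmp` vertical composition. -/
structure IntercatData (Obj : Type u) [Category.{v} Obj] where
  hor : DoubleData.{v, w₁} Obj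
  ver : DoubleData.{v, w₂} Obj
  Basic : ∀ {A B C D : Obj}, hor.Arr A B → ver.Arr A C → ver.Arr B D → hor.Arr C D → Type w₃
  Cube : ∀ {A B C D A' B' C' D' : Obj} {h : hor.Arr A B} {v : ver.Arr A C} {w : ver.Arr B D}
    {k : hor.Arr C D} {h' : hor.Arr A' B'} {v' : ver.Arr A' C'} {w' : ver.Arr B' D'}
    {k' : hor.Arr C' D'}, Basic h v w k → Basic h' v' w' k' → Type v
  top : ∀ {A B C D A' B' C' D' : Obj} {h : hor.Arr A B} {v : ver.Arr A C} {w : ver.Arr B D}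
    {k : hor.Arr C D} {h' : hor.Arr A' B'} {v' : ver.Arr A' C'} {w' : ver.Arr B' D'}
    {k' : hor.Arr C' D'} {α : Basic h v w k} {β : Basic h' v' w' k'}, Cube α β → hor.Cell h h'
  left : ∀ {A B C D A' B' C' D' : Obj} {h : hor.Arr A B} {v : ver.Arr A C} {w : ver.Arr B D}
    {k : hor.Arr C D} {h' : hor.Arr A' B'} {v' : ver.Arr A' C'} {w' : ver.Arr B' D'}
    {k' : hor.Arr C' D'} {α : Basic h v w k} {β : Basic h' v' w' k'}, Cube α β → ver.Cell v v'
  right : ∀ {A B C D A' B' C' D' : Obj} {h : hor.Arr A B} {v : ver.Arr A C} {w : ver.Arr B D}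
    {k : hor.Arr C D} {h' : hor.Arr A' B'} {v' : ver.Arr A' C'} {w' : ver.Arr B' D'}
    {k' : hor.Arr C' D'} {α : Basic h v w k} {β : Basic h' v' w' k'}, Cube α β → ver.Cell w w'
  bot : ∀ {A B C D A' B' C' D' : Obj} {h : hor.Arr A B} {v : ver.Arr A C} {w : ver.Arr B D}
    {k : hor.Arr C D} {h' : hor.Arr A' B'} {v' : ver.Arr A' C'} {w' : ver.Arr B' D'}
    {k' : hor.Arr C' D'} {α : Basic h v w k} {β : Basic h' v' w' k'}, Cube α β → hor.Cell k k'
  cone : ∀ {A B C D : Obj} {h : hor.Arr A B} {v : ver.Arr A C} {w : ver.Arr B D}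
    {k : hor.Arr C D} (α : Basic h v w k), Cube α α
  ccomp : ∀ {A B C D A' B' C' D' A'' B'' C'' D'' : Obj}
    {h : hor.Arr A B} {v : ver.Arr A C} {w : ver.Arr B D} {k : hor.Arr C D}
    {h' : hor.Arr A' B'} {v' : ver.Arr A' C'} {w' : ver.Arr B' D'} {k' : hor.Arr C' D'}
    {h'' : hor.Arr A'' B''} {v'' : ver.Arr A'' C''} {w'' : ver.Arr B'' D''}
    {k'' : hor.Arr C'' D''} {α : Basic h v w k} {β : Basic h' v' w' k'}
    {γ : Basic h'' v'' w'' k''}, Cube α β → Cube β γ → Cube α γ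
  -- horizontal identities, composition and structural cubes
  hunit : ∀ {A C : Obj} (v : ver.Arr A C), Basic (hor.unit A) v v (hor.unit C)
  hunitCell : ∀ {A C A' C' : Obj} {v : ver.Arr A C} {v' : ver.Arr A' C'} (_ : ver.Cell v v'),
    Cube (hunit v) (hunit v')
  hcmp : ∀ {A B C A' B' C' : Obj} {h : hor.Arr A B} {h' : hor.Arr B C} {v : ver.Arr A A'}
    {w : ver.Arr B B'} {x : ver.Arr C C'} {k : hor.Arr A' B'} {k' : hor.Arr B' C'},
    Basic h v w k → Basic h' w x k' → Basic (hor.cmp h h') v x (hor.cmp k k')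
  hcmpCell : ∀ {A B C A' B' C' : Obj} {h : hor.Arr A B} {h' : hor.Arr B C} {v : ver.Arr A A'}
    {w : ver.Arr B B'} {x : ver.Arr C C'} {k : hor.Arr A' B'} {k' : hor.Arr B' C'}
    {α : Basic h v w k} {β : Basic h' w x k'}
    {P Q R P' Q' R' : Obj} {i : hor.Arr P Q} {i' : hor.Arr Q R} {p : ver.Arr P P'}
    {q : ver.Arr Q Q'} {r : ver.Arr R R'} {j : hor.Arr P' Q'} {j' : hor.Arr Q' R'}
    {α' : Basic i p q j} {β' : Basic i' q r j'} (c : Cube α α') (d : Cube β β'),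
    right c = left d → Cube (hcmp α β) (hcmp α' β')
  hlam : ∀ {A B C D : Obj} {h : hor.Arr A B} {v : ver.Arr A C} {w : ver.Arr B D}
    {k : hor.Arr C D} (α : Basic h v w k), Cube (hcmp (hunit v) α) α
  hlamInv : ∀ {A B C D : Obj} {h : hor.Arr A B} {v : ver.Arr A C} {w : ver.Arr B D}
    {k : hor.Arr C D} (α : Basic h v w k), Cube α (hcmp (hunit v) α)
  hrho : ∀ {A B C D : Obj} {h : hor.Arr A B} {v : ver.Arr A C} {w : ver.Arr B D}
    {k : hor.Arr C D} (α : Basic h v w k), Cube (hcmp α (hunit w)) α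
  hrhoInv : ∀ {A B C D : Obj} {h : hor.Arr A B} {v : ver.Arr A C} {w : ver.Arr B D}
    {k : hor.Arr C D} (α : Basic h v w k), Cube α (hcmp α (hunit w))
  hassoc : ∀ {A B C D A' B' C' D' : Obj} {h : hor.Arr A B} {h' : hor.Arr B C} {h'' : hor.Arr C D}
    {v : ver.Arr A A'} {w : ver.Arr B B'} {x : ver.Arr C C'} {y : ver.Arr D D'}
    {k : hor.Arr A' B'} {k' : hor.Arr B' C'} {k'' : hor.Arr C' D'}
    (α : Basic h v w k) (β : Basic h' w x k') (γ : Basic h'' x y k''),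
    Cube (hcmp (hcmp α β) γ) (hcmp α (hcmp β γ))
  hassocInv : ∀ {A B C D A' B' C' D' : Obj} {h : hor.Arr A B} {h' : hor.Arr B C}
    {h'' : hor.Arr C D} {v : ver.Arr A A'} {w : ver.Arr B B'} {x : ver.Arr C C'} {y : ver.Arr D D'}
    {k : hor.Arr A' B'} {k' : hor.Arr B' C'} {k'' : hor.Arr C' D'}
    (α : Basic h v w k) (β : Basic h' w x k') (γ : Basic h'' x y k''),
    Cube (hcmp α (hcmp β γ)) (hcmp (hcmp α β) γ)
  -- vertical identities, composition and structural cubes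
  vunit : ∀ {A B : Obj} (h : hor.Arr A B), Basic h (ver.unit A) (ver.unit B) h
  vunitCell : ∀ {A B A' B' : Obj} {h : hor.Arr A B} {h' : hor.Arr A' B'} (_ : hor.Cell h h'),
    Cube (vunit h) (vunit h')
  vcmp : ∀ {A B C A' B' C' : Obj} {v : ver.Arr A B} {v' : ver.Arr B C} {h : hor.Arr A A'}
    {k : hor.Arr B B'} {l : hor.Arr C C'} {w : ver.Arr A' B'} {w' : ver.Arr B' C'},
    Basic h v w k → Basic k v' w' l → Basic h (ver.cmp v v') (ver.cmp w w') l
  vcmpCell : ∀ {A B C A' B' C' : Obj} {v : ver.Arr A B} {v' : ver.Arr B C} {h : hor.Arr A A'}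
    {k : hor.Arr B B'} {l : hor.Arr C C'} {w : ver.Arr A' B'} {w' : ver.Arr B' C'}
    {α : Basic h v w k} {β : Basic k v' w' l}
    {P Q R P' Q' R' : Obj} {p : ver.Arr P Q} {p' : ver.Arr Q R} {i : hor.Arr P P'}
    {j : hor.Arr Q Q'} {m : hor.Arr R R'} {q : ver.Arr P' Q'} {q' : ver.Arr Q' R'}
    {α' : Basic i p q j} {β' : Basic j p' q' m} (c : Cube α α') (d : Cube β β'),
    bot c = top d → Cube (vcmp α β) (vcmp α' β')
  vlam : ∀ {A B C D : Obj} {h : hor.Arr A B} {v : ver.Arr A C} {w : ver.Arr B D}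
    {k : hor.Arr C D} (α : Basic h v w k), Cube (vcmp (vunit h) α) α
  vlamInv : ∀ {A B C D : Obj} {h : hor.Arr A B} {v : ver.Arr A C} {w : ver.Arr B D}
    {k : hor.Arr C D} (α : Basic h v w k), Cube α (vcmp (vunit h) α)
  vrho : ∀ {A B C D : Obj} {h : hor.Arr A B} {v : ver.Arr A C} {w : ver.Arr B D}
    {k : hor.Arr C D} (α : Basic h v w k), Cube (vcmp α (vunit k)) α
  vrhoInv : ∀ {A B C D : Obj} {h : hor.Arr A B} {v : ver.Arr A C} {w : ver.Arr B D}
    {k : hor.Arr C D} (α : Basic h v w k), Cube α (vcmp α (vunit k))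
  vassoc : ∀ {A B C D A' B' C' D' : Obj} {v : ver.Arr A B} {v' : ver.Arr B C} {v'' : ver.Arr C D}
    {h : hor.Arr A A'} {k : hor.Arr B B'} {l : hor.Arr C C'} {m : hor.Arr D D'}
    {w : ver.Arr A' B'} {w' : ver.Arr B' C'} {w'' : ver.Arr C' D'}
    (α : Basic h v w k) (β : Basic k v' w' l) (γ : Basic l v'' w'' m),
    Cube (vcmp (vcmp α β) γ) (vcmp α (vcmp β γ))
  vassocInv : ∀ {A B C D A' B' C' D' : Obj} {v : ver.Arr A B} {v' : ver.Arr B C}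
    {v'' : ver.Arr C D} {h : hor.Arr A A'} {k : hor.Arr B B'} {l : hor.Arr C C'} {m : hor.Arr D D'}
    {w : ver.Arr A' B'} {w' : ver.Arr B' C'} {w'' : ver.Arr C' D'}
    (α : Basic h v w k) (β : Basic k v' w' l) (γ : Basic l v'' w'' m),
    Cube (vcmp α (vcmp β γ)) (vcmp (vcmp α β) γ)
  -- the interchangers
  tau : ∀ A : Obj, Cube (vunit (hor.unit A)) (hunit (ver.unit A))
  mu : ∀ {A B C : Obj} (v : ver.Arr A B) (v' : ver.Arr B C),
    Cube (vcmp (hunit v) (hunit v')) (hunit (ver.cmp v v'))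
  delta : ∀ {A B C : Obj} (h : hor.Arr A B) (h' : hor.Arr B C),
    Cube (vunit (hor.cmp h h')) (hcmp (vunit h) (vunit h'))
  chi : ∀ {A₀ A₁ A₂ B₀ B₁ B₂ C₀ C₁ C₂ : Obj}
    {h : hor.Arr A₀ A₁} {h' : hor.Arr A₁ A₂} {k : hor.Arr B₀ B₁} {k' : hor.Arr B₁ B₂}
    {l : hor.Arr C₀ C₁} {l' : hor.Arr C₁ C₂} {v₀ : ver.Arr A₀ B₀} {v₁ : ver.Arr A₁ B₁}
    {v₂ : ver.Arr A₂ B₂} {w₀ : ver.Arr B₀ C₀} {w₁ : ver.Arr B₁ C₁} {w₂ : ver.Arr B₂ C₂}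
    (α : Basic h v₀ v₁ k) (β : Basic h' v₁ v₂ k') (γ : Basic k w₀ w₁ l) (ε : Basic k' w₁ w₂ l'),
    Cube (vcmp (hcmp α β) (hcmp γ ε)) (hcmp (vcmp α γ) (vcmp β ε))

/-- Transversal composition of cubes. -/
infixr:80 " ⬦ " => IntercatData.ccomp _

namespace IntercatData

variable {Obj : Type u} [Category.{v} Obj]

/-- A basic cell with its horizontal sides, as a horizontal arrow between vertical arrows. -/
structure RowArr (I : IntercatData.{v, w₁, w₂, w₃} Obj) (v w : I.ver.Tot) where
  top : I.hor.Arr v.dom w.dom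
  bot : I.hor.Arr v.cod w.cod
  cell : I.Basic top v.arr w.arr bot

/-- A basic cell with its vertical sides, as a vertical arrow between horizontal arrows. -/
structure ColArr (I : IntercatData.{v, w₁, w₂, w₃} Obj) (h k : I.hor.Tot) where
  left : I.ver.Arr h.dom k.dom
  right : I.ver.Arr h.cod k.cod
  cell : I.Basic h.arr left right k.arr

/-- The double category of vertical arrows, vertical cells, basic cells and cubes under
transversal and horizontal composition. -/
def row (I : IntercatData.{v, w₁, w₂, w₃} Obj) : DoubleData.{v, max w₁ w₃} I.ver.Tot where
  Arr := I.RowArr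
  Cell α β := I.Cube α.cell β.cell
  src c := I.left c
  tgt c := I.right c
  one α := I.cone α.cell
  comp c d := c ⬦ d
  unit v := ⟨I.hor.unit v.dom, I.hor.unit v.cod, I.hunit v.arr⟩
  unitCell ψ := I.hunitCell ψ
  cmp α β := ⟨I.hor.cmp α.top β.top, I.hor.cmp α.bot β.bot, I.hcmp α.cell β.cell⟩
  cmpCell c d e := I.hcmpCell c d e
  lam α := I.hlam α.cell
  lamInv α := I.hlamInv α.cell
  rho α := I.hrho α.cell
  rhoInv α := I.hrhoInv α.cell
  assoc α β γ := I.hassoc α.cell β.cell γ.cell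
  assocInv α β γ := I.hassocInv α.cell β.cell γ.cell

/-- The double category of horizontal arrows, horizontal cells, basic cells and cubes under
transversal and vertical composition. -/
def col (I : IntercatData.{v, w₁, w₂, w₃} Obj) : DoubleData.{v, max w₂ w₃} I.hor.Tot where
  Arr := I.ColArr
  Cell α β := I.Cube α.cell β.cell
  src c := I.top c
  tgt c := I.bot c
  one α := I.cone α.cell
  comp c d := c ⬦ d
  unit h := ⟨I.ver.unit h.dom, I.ver.unit h.cod, I.vunit h.arr⟩
  unitCell φ := I.vunitCell φ
  cmp α β := ⟨I.ver.cmp α.left β.left, I.ver.cmp α.right β.right, I.vcmp α.cell β.cell⟩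
  cmpCell c d e := I.vcmpCell c d e
  lam α := I.vlam α.cell
  lamInv α := I.vlamInv α.cell
  rho α := I.vrho α.cell
  rhoInv α := I.vrhoInv α.cell
  assoc α β γ := I.vassoc α.cell β.cell γ.cell
  assocInv α β γ := I.vassocInv α.cell β.cell γ.cell

/-- The faces of cubes fit together, and taking them is strictly compatible with all
compositions, identities and structural isomorphisms. (The left and right faces of the horizontal
structure and the top and bottom faces of the vertical one belong to the weak double categories
`row` and `col`.) -/
structure HasFaces (I : IntercatData.{v, w₁, w₂, w₃} Obj) : Prop where
  src_top : ∀ {A B C D A' B' C' D' : Obj} {h : I.hor.Arr A B} {v : I.ver.Arr A C}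
    {w : I.ver.Arr B D} {k : I.hor.Arr C D} {h' : I.hor.Arr A' B'} {v' : I.ver.Arr A' C'}
    {w' : I.ver.Arr B' D'} {k' : I.hor.Arr C' D'} {α : I.Basic h v w k} {β : I.Basic h' v' w' k'}
    (c : I.Cube α β), I.hor.src (I.top c) = I.ver.src (I.left c)
  tgt_top : ∀ {A B C D A' B' C' D' : Obj} {h : I.hor.Arr A B} {v : I.ver.Arr A C}
    {w : I.ver.Arr B D} {k : I.hor.Arr C D} {h' : I.hor.Arr A' B'} {v' : I.ver.Arr A' C'}
    {w' : I.ver.Arr B' D'} {k' : I.hor.Arr C' D'} {α : I.Basic h v w k} {β : I.Basic h' v' w' k'}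
    (c : I.Cube α β), I.hor.tgt (I.top c) = I.ver.src (I.right c)
  src_bot : ∀ {A B C D A' B' C' D' : Obj} {h : I.hor.Arr A B} {v : I.ver.Arr A C}
    {w : I.ver.Arr B D} {k : I.hor.Arr C D} {h' : I.hor.Arr A' B'} {v' : I.ver.Arr A' C'}
    {w' : I.ver.Arr B' D'} {k' : I.hor.Arr C' D'} {α : I.Basic h v w k} {β : I.Basic h' v' w' k'}
    (c : I.Cube α β), I.hor.src (I.bot c) = I.ver.tgt (I.left c)
  tgt_bot : ∀ {A B C D A' B' C' D' : Obj} {h : I.hor.Arr A B} {v : I.ver.Arr A C}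
    {w : I.ver.Arr B D} {k : I.hor.Arr C D} {h' : I.hor.Arr A' B'} {v' : I.ver.Arr A' C'}
    {w' : I.ver.Arr B' D'} {k' : I.hor.Arr C' D'} {α : I.Basic h v w k} {β : I.Basic h' v' w' k'}
    (c : I.Cube α β), I.hor.tgt (I.bot c) = I.ver.tgt (I.right c)
  -- top and bottom faces of the horizontal structure
  top_hunitCell : ∀ {A C A' C' : Obj} {v : I.ver.Arr A C} {v' : I.ver.Arr A' C'}
    (ψ : I.ver.Cell v v'), I.top (I.hunitCell ψ) = I.hor.unitCell (I.ver.src ψ)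
  bot_hunitCell : ∀ {A C A' C' : Obj} {v : I.ver.Arr A C} {v' : I.ver.Arr A' C'}
    (ψ : I.ver.Cell v v'), I.bot (I.hunitCell ψ) = I.hor.unitCell (I.ver.tgt ψ)
  top_hcmpCell : ∀ {A B C A' B' C' : Obj} {h : I.hor.Arr A B} {h' : I.hor.Arr B C}
    {v : I.ver.Arr A A'} {w : I.ver.Arr B B'} {x : I.ver.Arr C C'} {k : I.hor.Arr A' B'}
    {k' : I.hor.Arr B' C'} {α : I.Basic h v w k} {β : I.Basic h' w x k'}
    {P Q R P' Q' R' : Obj} {i : I.hor.Arr P Q} {i' : I.hor.Arr Q R} {p : I.ver.Arr P P'}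
    {q : I.ver.Arr Q Q'} {r : I.ver.Arr R R'} {j : I.hor.Arr P' Q'} {j' : I.hor.Arr Q' R'}
    {α' : I.Basic i p q j} {β' : I.Basic i' q r j'} (c : I.Cube α α') (d : I.Cube β β')
    (e : I.right c = I.left d) (e' : _),
    I.top (I.hcmpCell c d e) = I.hor.cmpCell (I.top c) (I.top d) e'
  bot_hcmpCell : ∀ {A B C A' B' C' : Obj} {h : I.hor.Arr A B} {h' : I.hor.Arr B C}
    {v : I.ver.Arr A A'} {w : I.ver.Arr B B'} {x : I.ver.Arr C C'} {k : I.hor.Arr A' B'}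
    {k' : I.hor.Arr B' C'} {α : I.Basic h v w k} {β : I.Basic h' w x k'}
    {P Q R P' Q' R' : Obj} {i : I.hor.Arr P Q} {i' : I.hor.Arr Q R} {p : I.ver.Arr P P'}
    {q : I.ver.Arr Q Q'} {r : I.ver.Arr R R'} {j : I.hor.Arr P' Q'} {j' : I.hor.Arr Q' R'}
    {α' : I.Basic i p q j} {β' : I.Basic i' q r j'} (c : I.Cube α α') (d : I.Cube β β')
    (e : I.right c = I.left d) (e' : _),
    I.bot (I.hcmpCell c d e) = I.hor.cmpCell (I.bot c) (I.bot d) e'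
  top_hlam : ∀ {A B C D : Obj} {h : I.hor.Arr A B} {v : I.ver.Arr A C} {w : I.ver.Arr B D}
    {k : I.hor.Arr C D} (α : I.Basic h v w k), I.top (I.hlam α) = I.hor.lam h
  bot_hlam : ∀ {A B C D : Obj} {h : I.hor.Arr A B} {v : I.ver.Arr A C} {w : I.ver.Arr B D}
    {k : I.hor.Arr C D} (α : I.Basic h v w k), I.bot (I.hlam α) = I.hor.lam k
  top_hrho : ∀ {A B C D : Obj} {h : I.hor.Arr A B} {v : I.ver.Arr A C} {w : I.ver.Arr B D}
    {k : I.hor.Arr C D} (α : I.Basic h v w k), I.top (I.hrho α) = I.hor.rho h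
  bot_hrho : ∀ {A B C D : Obj} {h : I.hor.Arr A B} {v : I.ver.Arr A C} {w : I.ver.Arr B D}
    {k : I.hor.Arr C D} (α : I.Basic h v w k), I.bot (I.hrho α) = I.hor.rho k
  top_hassoc : ∀ {A B C D A' B' C' D' : Obj} {h : I.hor.Arr A B} {h' : I.hor.Arr B C}
    {h'' : I.hor.Arr C D} {v : I.ver.Arr A A'} {w : I.ver.Arr B B'} {x : I.ver.Arr C C'}
    {y : I.ver.Arr D D'} {k : I.hor.Arr A' B'} {k' : I.hor.Arr B' C'} {k'' : I.hor.Arr C' D'}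
    (α : I.Basic h v w k) (β : I.Basic h' w x k') (γ : I.Basic h'' x y k''),
    I.top (I.hassoc α β γ) = I.hor.assoc h h' h''
  bot_hassoc : ∀ {A B C D A' B' C' D' : Obj} {h : I.hor.Arr A B} {h' : I.hor.Arr B C}
    {h'' : I.hor.Arr C D} {v : I.ver.Arr A A'} {w : I.ver.Arr B B'} {x : I.ver.Arr C C'}
    {y : I.ver.Arr D D'} {k : I.hor.Arr A' B'} {k' : I.hor.Arr B' C'} {k'' : I.hor.Arr C' D'}
    (α : I.Basic h v w k) (β : I.Basic h' w x k') (γ : I.Basic h'' x y k''),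
    I.bot (I.hassoc α β γ) = I.hor.assoc k k' k''
  -- left and right faces of the vertical structure
  left_vunitCell : ∀ {A B A' B' : Obj} {h : I.hor.Arr A B} {h' : I.hor.Arr A' B'}
    (φ : I.hor.Cell h h'), I.left (I.vunitCell φ) = I.ver.unitCell (I.hor.src φ)
  right_vunitCell : ∀ {A B A' B' : Obj} {h : I.hor.Arr A B} {h' : I.hor.Arr A' B'}
    (φ : I.hor.Cell h h'), I.right (I.vunitCell φ) = I.ver.unitCell (I.hor.tgt φ)
  left_vcmpCell : ∀ {A B C A' B' C' : Obj} {v : I.ver.Arr A B} {v' : I.ver.Arr B C}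
    {h : I.hor.Arr A A'} {k : I.hor.Arr B B'} {l : I.hor.Arr C C'} {w : I.ver.Arr A' B'}
    {w' : I.ver.Arr B' C'} {α : I.Basic h v w k} {β : I.Basic k v' w' l}
    {P Q R P' Q' R' : Obj} {p : I.ver.Arr P Q} {p' : I.ver.Arr Q R} {i : I.hor.Arr P P'}
    {j : I.hor.Arr Q Q'} {m : I.hor.Arr R R'} {q : I.ver.Arr P' Q'} {q' : I.ver.Arr Q' R'}
    {α' : I.Basic i p q j} {β' : I.Basic j p' q' m} (c : I.Cube α α') (d : I.Cube β β')
    (e : I.bot c = I.top d) (e' : _),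
    I.left (I.vcmpCell c d e) = I.ver.cmpCell (I.left c) (I.left d) e'
  right_vcmpCell : ∀ {A B C A' B' C' : Obj} {v : I.ver.Arr A B} {v' : I.ver.Arr B C}
    {h : I.hor.Arr A A'} {k : I.hor.Arr B B'} {l : I.hor.Arr C C'} {w : I.ver.Arr A' B'}
    {w' : I.ver.Arr B' C'} {α : I.Basic h v w k} {β : I.Basic k v' w' l}
    {P Q R P' Q' R' : Obj} {p : I.ver.Arr P Q} {p' : I.ver.Arr Q R} {i : I.hor.Arr P P'}
    {j : I.hor.Arr Q Q'} {m : I.hor.Arr R R'} {q : I.ver.Arr P' Q'} {q' : I.ver.Arr Q' R'}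
    {α' : I.Basic i p q j} {β' : I.Basic j p' q' m} (c : I.Cube α α') (d : I.Cube β β')
    (e : I.bot c = I.top d) (e' : _),
    I.right (I.vcmpCell c d e) = I.ver.cmpCell (I.right c) (I.right d) e'
  left_vlam : ∀ {A B C D : Obj} {h : I.hor.Arr A B} {v : I.ver.Arr A C} {w : I.ver.Arr B D}
    {k : I.hor.Arr C D} (α : I.Basic h v w k), I.left (I.vlam α) = I.ver.lam v
  right_vlam : ∀ {A B C D : Obj} {h : I.hor.Arr A B} {v : I.ver.Arr A C} {w : I.ver.Arr B D}
    {k : I.hor.Arr C D} (α : I.Basic h v w k), I.right (I.vlam α) = I.ver.lam w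
  left_vrho : ∀ {A B C D : Obj} {h : I.hor.Arr A B} {v : I.ver.Arr A C} {w : I.ver.Arr B D}
    {k : I.hor.Arr C D} (α : I.Basic h v w k), I.left (I.vrho α) = I.ver.rho v
  right_vrho : ∀ {A B C D : Obj} {h : I.hor.Arr A B} {v : I.ver.Arr A C} {w : I.ver.Arr B D}
    {k : I.hor.Arr C D} (α : I.Basic h v w k), I.right (I.vrho α) = I.ver.rho w
  left_vassoc : ∀ {A B C D A' B' C' D' : Obj} {v : I.ver.Arr A B} {v' : I.ver.Arr B C}
    {v'' : I.ver.Arr C D} {h : I.hor.Arr A A'} {k : I.hor.Arr B B'} {l : I.hor.Arr C C'}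
    {m : I.hor.Arr D D'} {w : I.ver.Arr A' B'} {w' : I.ver.Arr B' C'} {w'' : I.ver.Arr C' D'}
    (α : I.Basic h v w k) (β : I.Basic k v' w' l) (γ : I.Basic l v'' w'' m),
    I.left (I.vassoc α β γ) = I.ver.assoc v v' v''
  right_vassoc : ∀ {A B C D A' B' C' D' : Obj} {v : I.ver.Arr A B} {v' : I.ver.Arr B C}
    {v'' : I.ver.Arr C D} {h : I.hor.Arr A A'} {k : I.hor.Arr B B'} {l : I.hor.Arr C C'}
    {m : I.hor.Arr D D'} {w : I.ver.Arr A' B'} {w' : I.ver.Arr B' C'} {w'' : I.ver.Arr C' D'}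
    (α : I.Basic h v w k) (β : I.Basic k v' w' l) (γ : I.Basic l v'' w'' m),
    I.right (I.vassoc α β γ) = I.ver.assoc w w' w''

/-- A special cube: all its lateral faces are transversal identities. -/
structure IsSpecial (I : IntercatData.{v, w₁, w₂, w₃} Obj) {A B C D : Obj} {h : I.hor.Arr A B}
    {v : I.ver.Arr A C} {w : I.ver.Arr B D} {k : I.hor.Arr C D} {α β : I.Basic h v w k}
    (c : I.Cube α β) : Prop where
  top : I.top c = I.hor.one h
  left : I.left c = I.ver.one v
  right : I.right c = I.ver.one w
  bot : I.bot c = I.hor.one k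

/-- The interchangers are special, natural and coherent. -/
structure HasInterchange (I : IntercatData.{v, w₁, w₂, w₃} Obj) : Prop where
  tau_special : ∀ A : Obj, I.IsSpecial (I.tau A)
  mu_special : ∀ {A B C : Obj} (v : I.ver.Arr A B) (v' : I.ver.Arr B C), I.IsSpecial (I.mu v v')
  delta_special : ∀ {A B C : Obj} (h : I.hor.Arr A B) (h' : I.hor.Arr B C),
    I.IsSpecial (I.delta h h')
  chi_special : ∀ {A₀ A₁ A₂ B₀ B₁ B₂ C₀ C₁ C₂ : Obj}
    {h : I.hor.Arr A₀ A₁} {h' : I.hor.Arr A₁ A₂} {k : I.hor.Arr B₀ B₁} {k' : I.hor.Arr B₁ B₂}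
    {l : I.hor.Arr C₀ C₁} {l' : I.hor.Arr C₁ C₂} {v₀ : I.ver.Arr A₀ B₀} {v₁ : I.ver.Arr A₁ B₁}
    {v₂ : I.ver.Arr A₂ B₂} {w₀ : I.ver.Arr B₀ C₀} {w₁ : I.ver.Arr B₁ C₁} {w₂ : I.ver.Arr B₂ C₂}
    (α : I.Basic h v₀ v₁ k) (β : I.Basic h' v₁ v₂ k') (γ : I.Basic k w₀ w₁ l)
    (ε : I.Basic k' w₁ w₂ l'), I.IsSpecial (I.chi α β γ ε)
  tau_nat : ∀ {A A' : Obj} (f : A ⟶ A'),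
    I.vunitCell (I.hor.unitCell f) ⬦ I.tau A' = I.tau A ⬦ I.hunitCell (I.ver.unitCell f)
  mu_nat : ∀ {A B C A' B' C' : Obj} {v : I.ver.Arr A B} {w : I.ver.Arr B C} {v' : I.ver.Arr A' B'}
    {w' : I.ver.Arr B' C'} (ψ : I.ver.Cell v v') (θ : I.ver.Cell w w')
    (e : I.ver.tgt ψ = I.ver.src θ) (e' : _),
    I.vcmpCell (I.hunitCell ψ) (I.hunitCell θ) e' ⬦ I.mu v' w' =
      I.mu v w ⬦ I.hunitCell (I.ver.cmpCell ψ θ e)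
  delta_nat : ∀ {A B C A' B' C' : Obj} {h : I.hor.Arr A B} {k : I.hor.Arr B C}
    {h' : I.hor.Arr A' B'} {k' : I.hor.Arr B' C'} (φ : I.hor.Cell h h') (θ : I.hor.Cell k k')
    (e : I.hor.tgt φ = I.hor.src θ) (e' : _),
    I.vunitCell (I.hor.cmpCell φ θ e) ⬦ I.delta h' k' =
      I.delta h k ⬦ I.hcmpCell (I.vunitCell φ) (I.vunitCell θ) e'
  chi_nat : ∀ {A₀ A₁ A₂ B₀ B₁ B₂ C₀ C₁ C₂ : Obj}
    {h : I.hor.Arr A₀ A₁} {h' : I.hor.Arr A₁ A₂} {k : I.hor.Arr B₀ B₁} {k' : I.hor.Arr B₁ B₂}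
    {l : I.hor.Arr C₀ C₁} {l' : I.hor.Arr C₁ C₂} {v₀ : I.ver.Arr A₀ B₀} {v₁ : I.ver.Arr A₁ B₁}
    {v₂ : I.ver.Arr A₂ B₂} {w₀ : I.ver.Arr B₀ C₀} {w₁ : I.ver.Arr B₁ C₁} {w₂ : I.ver.Arr B₂ C₂}
    {α : I.Basic h v₀ v₁ k} {β : I.Basic h' v₁ v₂ k'} {γ : I.Basic k w₀ w₁ l}
    {ε : I.Basic k' w₁ w₂ l'} {P₀ P₁ P₂ Q₀ Q₁ Q₂ R₀ R₁ R₂ : Obj}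
    {p : I.hor.Arr P₀ P₁} {p' : I.hor.Arr P₁ P₂} {q : I.hor.Arr Q₀ Q₁} {q' : I.hor.Arr Q₁ Q₂}
    {r : I.hor.Arr R₀ R₁} {r' : I.hor.Arr R₁ R₂} {x₀ : I.ver.Arr P₀ Q₀} {x₁ : I.ver.Arr P₁ Q₁}
    {x₂ : I.ver.Arr P₂ Q₂} {y₀ : I.ver.Arr Q₀ R₀} {y₁ : I.ver.Arr Q₁ R₁} {y₂ : I.ver.Arr Q₂ R₂}
    {α' : I.Basic p x₀ x₁ q} {β' : I.Basic p' x₁ x₂ q'} {γ' : I.Basic q y₀ y₁ r}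
    {ε' : I.Basic q' y₁ y₂ r'} (a : I.Cube α α') (b : I.Cube β β') (c : I.Cube γ γ')
    (d : I.Cube ε ε') (e₁ : I.right a = I.left b) (e₂ : I.right c = I.left d)
    (e₃ : I.bot a = I.top c) (e₄ : I.bot b = I.top d) (e₅ e₆ : _),
    I.vcmpCell (I.hcmpCell a b e₁) (I.hcmpCell c d e₂) e₅ ⬦ I.chi α' β' γ' ε' =
      I.chi α β γ ε ⬦ I.hcmpCell (I.vcmpCell a c e₃) (I.vcmpCell b d e₄) e₆
  -- horizontal identity is lax for the vertical structure
  mu_assoc : ∀ {A B C D : Obj} (u : I.ver.Arr A B) (v : I.ver.Arr B C) (w : I.ver.Arr C D)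
    (e₁ e₂ : _),
    I.vcmpCell (I.mu u v) (I.cone (I.hunit w)) e₁ ⬦ I.mu (I.ver.cmp u v) w ⬦
        I.hunitCell (I.ver.assoc u v w) =
      I.vassoc (I.hunit u) (I.hunit v) (I.hunit w) ⬦
        I.vcmpCell (I.cone (I.hunit u)) (I.mu v w) e₂ ⬦ I.mu u (I.ver.cmp v w)
  mu_lam : ∀ {A B : Obj} (v : I.ver.Arr A B) (e : _),
    I.vcmpCell (I.tau A) (I.cone (I.hunit v)) e ⬦ I.mu (I.ver.unit A) v ⬦
        I.hunitCell (I.ver.lam v) = I.vlam (I.hunit v)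
  mu_rho : ∀ {A B : Obj} (v : I.ver.Arr A B) (e : _),
    I.vcmpCell (I.cone (I.hunit v)) (I.tau B) e ⬦ I.mu v (I.ver.unit B) ⬦
        I.hunitCell (I.ver.rho v) = I.vrho (I.hunit v)
  -- horizontal composition is lax for the vertical structure
  chi_vassoc : ∀ {A₀ A₁ A₂ B₀ B₁ B₂ C₀ C₁ C₂ D₀ D₁ D₂ : Obj}
    {h : I.hor.Arr A₀ A₁} {h' : I.hor.Arr A₁ A₂} {k : I.hor.Arr B₀ B₁} {k' : I.hor.Arr B₁ B₂}
    {l : I.hor.Arr C₀ C₁} {l' : I.hor.Arr C₁ C₂} {m : I.hor.Arr D₀ D₁} {m' : I.hor.Arr D₁ D₂}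
    {v₀ : I.ver.Arr A₀ B₀} {v₁ : I.ver.Arr A₁ B₁} {v₂ : I.ver.Arr A₂ B₂}
    {w₀ : I.ver.Arr B₀ C₀} {w₁ : I.ver.Arr B₁ C₁} {w₂ : I.ver.Arr B₂ C₂}
    {x₀ : I.ver.Arr C₀ D₀} {x₁ : I.ver.Arr C₁ D₁} {x₂ : I.ver.Arr C₂ D₂}
    (α : I.Basic h v₀ v₁ k) (α' : I.Basic h' v₁ v₂ k') (β : I.Basic k w₀ w₁ l)
    (β' : I.Basic k' w₁ w₂ l') (γ : I.Basic l x₀ x₁ m) (γ' : I.Basic l' x₁ x₂ m') (e₁ e₂ e₃ : _),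
    I.vcmpCell (I.chi α α' β β') (I.cone (I.hcmp γ γ')) e₁ ⬦
        I.chi (I.vcmp α β) (I.vcmp α' β') γ γ' ⬦
        I.hcmpCell (I.vassoc α β γ) (I.vassoc α' β' γ') e₂ =
      I.vassoc (I.hcmp α α') (I.hcmp β β') (I.hcmp γ γ') ⬦
        I.vcmpCell (I.cone (I.hcmp α α')) (I.chi β β' γ γ') e₃ ⬦
        I.chi α α' (I.vcmp β γ) (I.vcmp β' γ')
  chi_vlam : ∀ {A B C A' B' C' : Obj} {h : I.hor.Arr A B} {h' : I.hor.Arr B C}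
    {v : I.ver.Arr A A'} {w : I.ver.Arr B B'} {x : I.ver.Arr C C'} {k : I.hor.Arr A' B'}
    {k' : I.hor.Arr B' C'} (α : I.Basic h v w k) (β : I.Basic h' w x k') (e₁ e₂ : _),
    I.vcmpCell (I.delta h h') (I.cone (I.hcmp α β)) e₁ ⬦ I.chi (I.vunit h) (I.vunit h') α β ⬦
        I.hcmpCell (I.vlam α) (I.vlam β) e₂ = I.vlam (I.hcmp α β)
  chi_vrho : ∀ {A B C A' B' C' : Obj} {h : I.hor.Arr A B} {h' : I.hor.Arr B C}
    {v : I.ver.Arr A A'} {w : I.ver.Arr B B'} {x : I.ver.Arr C C'} {k : I.hor.Arr A' B'}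
    {k' : I.hor.Arr B' C'} (α : I.Basic h v w k) (β : I.Basic h' w x k') (e₁ e₂ : _),
    I.vcmpCell (I.cone (I.hcmp α β)) (I.delta k k') e₁ ⬦ I.chi α β (I.vunit k) (I.vunit k') ⬦
        I.hcmpCell (I.vrho α) (I.vrho β) e₂ = I.vrho (I.hcmp α β)
  -- the horizontal associator is a transformation for the vertical structure
  chi_hassoc : ∀ {A₀ A₁ A₂ A₃ B₀ B₁ B₂ B₃ C₀ C₁ C₂ C₃ : Obj}
    {h : I.hor.Arr A₀ A₁} {h' : I.hor.Arr A₁ A₂} {h'' : I.hor.Arr A₂ A₃}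
    {k : I.hor.Arr B₀ B₁} {k' : I.hor.Arr B₁ B₂} {k'' : I.hor.Arr B₂ B₃}
    {l : I.hor.Arr C₀ C₁} {l' : I.hor.Arr C₁ C₂} {l'' : I.hor.Arr C₂ C₃}
    {v₀ : I.ver.Arr A₀ B₀} {v₁ : I.ver.Arr A₁ B₁} {v₂ : I.ver.Arr A₂ B₂} {v₃ : I.ver.Arr A₃ B₃}
    {w₀ : I.ver.Arr B₀ C₀} {w₁ : I.ver.Arr B₁ C₁} {w₂ : I.ver.Arr B₂ C₂} {w₃ : I.ver.Arr B₃ C₃}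
    (α : I.Basic h v₀ v₁ k) (β : I.Basic h' v₁ v₂ k') (γ : I.Basic h'' v₂ v₃ k'')
    (α' : I.Basic k w₀ w₁ l) (β' : I.Basic k' w₁ w₂ l') (γ' : I.Basic k'' w₂ w₃ l'')
    (e₁ e₂ e₃ : _),
    I.chi (I.hcmp α β) γ (I.hcmp α' β') γ' ⬦
        I.hcmpCell (I.chi α β α' β') (I.cone (I.vcmp γ γ')) e₁ ⬦
        I.hassoc (I.vcmp α α') (I.vcmp β β') (I.vcmp γ γ') =
      I.vcmpCell (I.hassoc α β γ) (I.hassoc α' β' γ') e₂ ⬦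
        I.chi α (I.hcmp β γ) α' (I.hcmp β' γ') ⬦
        I.hcmpCell (I.cone (I.vcmp α α')) (I.chi β γ β' γ') e₃
  delta_hassoc : ∀ {A B C D : Obj} (h : I.hor.Arr A B) (k : I.hor.Arr B C) (l : I.hor.Arr C D)
    (e₁ e₂ : _),
    I.delta (I.hor.cmp h k) l ⬦ I.hcmpCell (I.delta h k) (I.cone (I.vunit l)) e₁ ⬦
        I.hassoc (I.vunit h) (I.vunit k) (I.vunit l) =
      I.vunitCell (I.hor.assoc h k l) ⬦ I.delta h (I.hor.cmp k l) ⬦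
        I.hcmpCell (I.cone (I.vunit h)) (I.delta k l) e₂
  -- the horizontal unitors are transformations for the vertical structure
  chi_hlam : ∀ {A B C A' B' C' : Obj} {v : I.ver.Arr A B} {v' : I.ver.Arr B C}
    {h : I.hor.Arr A A'} {k : I.hor.Arr B B'} {l : I.hor.Arr C C'} {w : I.ver.Arr A' B'}
    {w' : I.ver.Arr B' C'} (α : I.Basic h v w k) (β : I.Basic k v' w' l) (e₁ e₂ : _),
    I.chi (I.hunit v) α (I.hunit v') β ⬦ I.hcmpCell (I.mu v v') (I.cone (I.vcmp α β)) e₁ ⬦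
        I.hlam (I.vcmp α β) = I.vcmpCell (I.hlam α) (I.hlam β) e₂
  delta_hlam : ∀ {A B : Obj} (h : I.hor.Arr A B) (e : _),
    I.delta (I.hor.unit A) h ⬦ I.hcmpCell (I.tau A) (I.cone (I.vunit h)) e ⬦
        I.hlam (I.vunit h) = I.vunitCell (I.hor.lam h)
  chi_hrho : ∀ {A B C A' B' C' : Obj} {v : I.ver.Arr A B} {v' : I.ver.Arr B C}
    {h : I.hor.Arr A A'} {k : I.hor.Arr B B'} {l : I.hor.Arr C C'} {w : I.ver.Arr A' B'}
    {w' : I.ver.Arr B' C'} (α : I.Basic h v w k) (β : I.Basic k v' w' l) (e₁ e₂ : _),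
    I.chi α (I.hunit w) β (I.hunit w') ⬦ I.hcmpCell (I.cone (I.vcmp α β)) (I.mu w w') e₁ ⬦
        I.hrho (I.vcmp α β) = I.vcmpCell (I.hrho α) (I.hrho β) e₂
  delta_hrho : ∀ {A B : Obj} (h : I.hor.Arr A B) (e : _),
    I.delta h (I.hor.unit B) ⬦ I.hcmpCell (I.cone (I.vunit h)) (I.tau B) e ⬦
        I.hrho (I.vunit h) = I.vunitCell (I.hor.rho h)

end IntercatData

/-- Intercategories: two weak double categories on the same objects and transversal arrows, two
weak double categories of basic cells and cubes over them, and coherent interchangers. -/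
structure Intercategory (Obj : Type u) [Category.{v} Obj] extends
    IntercatData.{v, w₁, w₂, w₃} Obj where
  hor_isWeak : hor.IsWeak
  ver_isWeak : ver.IsWeak
  row_isWeak : toIntercatData.row.IsWeak
  col_isWeak : toIntercatData.col.IsWeak
  faces : toIntercatData.HasFaces
  interchange : toIntercatData.HasInterchange

/-! ## Lax-lax morphisms of intercategories -/

/-- The data of a lax-lax morphism: a functor on objects and transversal arrows, actions on the
other arrows, cells and cubes, and laxity cells and cubes in the horizontal and vertical directions
(`hunitLax`, `hcmpLax` and `vunitLax`, `vcmpLax` on basic cells). -/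
structure LaxLaxData {Obj : Type u} [Category.{v} Obj] {Obj' : Type u'} [Category.{v} Obj']
    (I : IntercatData.{v, w₁, w₂, w₃} Obj) (J : IntercatData.{v, w₁', w₂', w₃'} Obj') where
  base : Obj ⥤ Obj'
  hor : LaxData I.hor J.hor base.toPrefunctor
  ver : LaxData I.ver J.ver base.toPrefunctor
  basic : ∀ {A B C D : Obj} {h : I.hor.Arr A B} {v : I.ver.Arr A C} {w : I.ver.Arr B D}
    {k : I.hor.Arr C D}, I.Basic h v w k → J.Basic (hor.arr h) (ver.arr v) (ver.arr w) (hor.arr k)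
  cube : ∀ {A B C D A' B' C' D' : Obj} {h : I.hor.Arr A B} {v : I.ver.Arr A C}
    {w : I.ver.Arr B D} {k : I.hor.Arr C D} {h' : I.hor.Arr A' B'} {v' : I.ver.Arr A' C'}
    {w' : I.ver.Arr B' D'} {k' : I.hor.Arr C' D'} {α : I.Basic h v w k} {β : I.Basic h' v' w' k'},
    I.Cube α β → J.Cube (basic α) (basic β)
  hunitLax : ∀ {A C : Obj} (v : I.ver.Arr A C),
    J.Cube (J.hunit (ver.arr v)) (basic (I.hunit v))
  hcmpLax : ∀ {A B C A' B' C' : Obj} {h : I.hor.Arr A B} {h' : I.hor.Arr B C}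
    {v : I.ver.Arr A A'} {w : I.ver.Arr B B'} {x : I.ver.Arr C C'} {k : I.hor.Arr A' B'}
    {k' : I.hor.Arr B' C'} (α : I.Basic h v w k) (β : I.Basic h' w x k'),
    J.Cube (J.hcmp (basic α) (basic β)) (basic (I.hcmp α β))
  vunitLax : ∀ {A B : Obj} (h : I.hor.Arr A B),
    J.Cube (J.vunit (hor.arr h)) (basic (I.vunit h))
  vcmpLax : ∀ {A B C A' B' C' : Obj} {v : I.ver.Arr A B} {v' : I.ver.Arr B C}
    {h : I.hor.Arr A A'} {k : I.hor.Arr B B'} {l : I.hor.Arr C C'} {w : I.ver.Arr A' B'}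
    {w' : I.ver.Arr B' C'} (α : I.Basic h v w k) (β : I.Basic k v' w' l),
    J.Cube (J.vcmp (basic α) (basic β)) (basic (I.vcmp α β))

namespace LaxLaxData

variable {Obj : Type u} [Category.{v} Obj] {Obj' : Type u'} [Category.{v} Obj']
  {I : IntercatData.{v, w₁, w₂, w₃} Obj} {J : IntercatData.{v, w₁', w₂', w₃'} Obj'}

/-- The action on basic cells and cubes, with the horizontal laxity. -/
def row (F : LaxLaxData I J) : LaxData I.row J.row F.ver.tot where
  arr α := ⟨F.hor.arr α.top, F.hor.arr α.bot, F.basic α.cell⟩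
  cell c := F.cube c
  unitLax v := F.hunitLax v.arr
  cmpLax α β := F.hcmpLax α.cell β.cell

/-- The action on basic cells and cubes, with the vertical laxity. -/
def col (F : LaxLaxData I J) : LaxData I.col J.col F.hor.tot where
  arr α := ⟨F.ver.arr α.left, F.ver.arr α.right, F.basic α.cell⟩
  cell c := F.cube c
  unitLax h := F.vunitLax h.arr
  cmpLax α β := F.vcmpLax α.cell β.cell

/-- The laws of a lax-lax morphism of intercategories: it is a lax double functor in each of the
four double categories, the faces of the laxity cubes are the laxity cells, and the two laxities are
compatible with the four interchangers. -/
structure IsLaxLax (F : LaxLaxData I J) : Prop where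
  hor : F.hor.IsLax
  ver : F.ver.IsLax
  row : F.row.IsLax
  col : F.col.IsLax
  top_hunitLax : ∀ {A C : Obj} (v : I.ver.Arr A C), J.top (F.hunitLax v) = F.hor.unitLax A
  bot_hunitLax : ∀ {A C : Obj} (v : I.ver.Arr A C), J.bot (F.hunitLax v) = F.hor.unitLax C
  top_hcmpLax : ∀ {A B C A' B' C' : Obj} {h : I.hor.Arr A B} {h' : I.hor.Arr B C}
    {v : I.ver.Arr A A'} {w : I.ver.Arr B B'} {x : I.ver.Arr C C'} {k : I.hor.Arr A' B'}
    {k' : I.hor.Arr B' C'} (α : I.Basic h v w k) (β : I.Basic h' w x k'),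
    J.top (F.hcmpLax α β) = F.hor.cmpLax h h'
  bot_hcmpLax : ∀ {A B C A' B' C' : Obj} {h : I.hor.Arr A B} {h' : I.hor.Arr B C}
    {v : I.ver.Arr A A'} {w : I.ver.Arr B B'} {x : I.ver.Arr C C'} {k : I.hor.Arr A' B'}
    {k' : I.hor.Arr B' C'} (α : I.Basic h v w k) (β : I.Basic h' w x k'),
    J.bot (F.hcmpLax α β) = F.hor.cmpLax k k'
  left_vunitLax : ∀ {A B : Obj} (h : I.hor.Arr A B), J.left (F.vunitLax h) = F.ver.unitLax A
  right_vunitLax : ∀ {A B : Obj} (h : I.hor.Arr A B), J.right (F.vunitLax h) = F.ver.unitLax B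
  left_vcmpLax : ∀ {A B C A' B' C' : Obj} {v : I.ver.Arr A B} {v' : I.ver.Arr B C}
    {h : I.hor.Arr A A'} {k : I.hor.Arr B B'} {l : I.hor.Arr C C'} {w : I.ver.Arr A' B'}
    {w' : I.ver.Arr B' C'} (α : I.Basic h v w k) (β : I.Basic k v' w' l),
    J.left (F.vcmpLax α β) = F.ver.cmpLax v v'
  right_vcmpLax : ∀ {A B C A' B' C' : Obj} {v : I.ver.Arr A B} {v' : I.ver.Arr B C}
    {h : I.hor.Arr A A'} {k : I.hor.Arr B B'} {l : I.hor.Arr C C'} {w : I.ver.Arr A' B'}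
    {w' : I.ver.Arr B' C'} (α : I.Basic h v w k) (β : I.Basic k v' w' l),
    J.right (F.vcmpLax α β) = F.ver.cmpLax w w'
  lax_tau : ∀ A : Obj,
    J.vunitCell (F.hor.unitLax A) ⬦ F.vunitLax (I.hor.unit A) ⬦ F.cube (I.tau A) =
      J.tau (F.base.obj A) ⬦ J.hunitCell (F.ver.unitLax A) ⬦ F.hunitLax (I.ver.unit A)
  lax_mu : ∀ {A B C : Obj} (v : I.ver.Arr A B) (v' : I.ver.Arr B C) (e : _),
    J.vcmpCell (F.hunitLax v) (F.hunitLax v') e ⬦ F.vcmpLax (I.hunit v) (I.hunit v') ⬦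
        F.cube (I.mu v v') =
      J.mu (F.ver.arr v) (F.ver.arr v') ⬦ J.hunitCell (F.ver.cmpLax v v') ⬦
        F.hunitLax (I.ver.cmp v v')
  lax_delta : ∀ {A B C : Obj} (h : I.hor.Arr A B) (h' : I.hor.Arr B C) (e : _),
    J.vunitCell (F.hor.cmpLax h h') ⬦ F.vunitLax (I.hor.cmp h h') ⬦ F.cube (I.delta h h') =
      J.delta (F.hor.arr h) (F.hor.arr h') ⬦ J.hcmpCell (F.vunitLax h) (F.vunitLax h') e ⬦
        F.hcmpLax (I.vunit h) (I.vunit h')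
  lax_chi : ∀ {A₀ A₁ A₂ B₀ B₁ B₂ C₀ C₁ C₂ : Obj}
    {h : I.hor.Arr A₀ A₁} {h' : I.hor.Arr A₁ A₂} {k : I.hor.Arr B₀ B₁} {k' : I.hor.Arr B₁ B₂}
    {l : I.hor.Arr C₀ C₁} {l' : I.hor.Arr C₁ C₂} {v₀ : I.ver.Arr A₀ B₀} {v₁ : I.ver.Arr A₁ B₁}
    {v₂ : I.ver.Arr A₂ B₂} {w₀ : I.ver.Arr B₀ C₀} {w₁ : I.ver.Arr B₁ C₁} {w₂ : I.ver.Arr B₂ C₂}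
    (α : I.Basic h v₀ v₁ k) (β : I.Basic h' v₁ v₂ k') (γ : I.Basic k w₀ w₁ l)
    (ε : I.Basic k' w₁ w₂ l') (e₁ e₂ : _),
    J.vcmpCell (F.hcmpLax α β) (F.hcmpLax γ ε) e₁ ⬦ F.vcmpLax (I.hcmp α β) (I.hcmp γ ε) ⬦
        F.cube (I.chi α β γ ε) =
      J.chi (F.basic α) (F.basic β) (F.basic γ) (F.basic ε) ⬦
        J.hcmpCell (F.vcmpLax α γ) (F.vcmpLax β ε) e₂ ⬦ F.hcmpLax (I.vcmp α γ) (I.vcmp β ε)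

end LaxLaxData

/-! ## The intercategory of sets: spans in the double category of spans of sets -/

/-- A span of sets. -/
structure SetSpan (A B : Type v) where
  apex : Type v
  fst : apex → A
  snd : apex → B

/-- A morphism of spans, with arbitrary functions at the two ends. -/
@[ext]
structure SetSpan.Hom {A B A' B' : Type v} (s : SetSpan A B) (t : SetSpan A' B') where
  src : A ⟶ A'
  tgt : B ⟶ B'
  mid : s.apex → t.apex
  fst_mid : ∀ x, t.fst (mid x) = src (s.fst x)
  snd_mid : ∀ x, t.snd (mid x) = tgt (s.snd x)

/-- The double category of sets, functions and spans; spans are composed by pullback. -/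
def spanSet : DoubleData.{v, v + 1} (Type v) where
  Arr A B := SetSpan A B
  Cell s t := SetSpan.Hom s t
  src φ := φ.src
  tgt φ := φ.tgt
  one s := ⟨𝟙 _, 𝟙 _, fun x => x, fun _ => rfl, fun _ => rfl⟩
  comp φ ψ := ⟨φ.src ≫ ψ.src, φ.tgt ≫ ψ.tgt, fun x => ψ.mid (φ.mid x),
    fun x => by simp [ψ.fst_mid, φ.fst_mid], fun x => by simp [ψ.snd_mid, φ.snd_mid]⟩
  unit A := ⟨A, fun a => a, fun a => a⟩
  unitCell f := ⟨f, f, fun a => f a, fun _ => rfl, fun _ => rfl⟩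
  cmp s t := ⟨{ p : s.apex × t.apex // s.snd p.1 = t.fst p.2 }, fun p => s.fst p.1.1,
    fun p => t.snd p.1.2⟩
  cmpCell φ ψ e := ⟨φ.src, ψ.tgt,
    fun p => ⟨(φ.mid p.1.1, ψ.mid p.1.2), by simp [φ.snd_mid, ψ.fst_mid, e, p.2]⟩,
    fun p => φ.fst_mid _, fun p => ψ.snd_mid _⟩
  lam s := ⟨𝟙 _, 𝟙 _, fun p => p.1.2, fun p => p.2.symm, fun _ => rfl⟩
  lamInv s := ⟨𝟙 _, 𝟙 _, fun x => ⟨(s.fst x, x), rfl⟩, fun _ => rfl, fun _ => rfl⟩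
  rho s := ⟨𝟙 _, 𝟙 _, fun p => p.1.1, fun _ => rfl, fun p => p.2⟩
  rhoInv s := ⟨𝟙 _, 𝟙 _, fun x => ⟨(x, s.snd x), rfl⟩, fun _ => rfl, fun _ => rfl⟩
  assoc s t r := ⟨𝟙 _, 𝟙 _, fun p => ⟨(p.1.1.1.1, ⟨(p.1.1.1.2, p.1.2), p.2⟩), p.1.1.2⟩,
    fun _ => rfl, fun _ => rfl⟩
  assocInv s t r := ⟨𝟙 _, 𝟙 _, fun p => ⟨(⟨(p.1.1, p.1.2.1.1), p.2⟩, p.1.2.1.2), p.1.2.2⟩,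
    fun _ => rfl, fun _ => rfl⟩

theorem spanSet_isWeak : spanSet.{v}.IsWeak := by
  constructor <;> intros <;> first
    | rfl
    | exact SetSpan.Hom.ext rfl rfl (funext fun x => Subtype.ext (Prod.ext x.2.symm rfl))
    | exact SetSpan.Hom.ext rfl rfl (funext fun x => Subtype.ext (Prod.ext rfl x.2))

/-- A span of spans of sets, with prescribed outer spans. -/
structure SetBasic {A B C D : Type v} (h : SetSpan A B) (v : SetSpan A C) (w : SetSpan B D)
    (k : SetSpan C D) where
  apex : Type v
  top : apex → h.apex
  left : apex → v.apex
  right : apex → w.apex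
  bot : apex → k.apex
  top_left : ∀ x, h.fst (top x) = v.fst (left x)
  top_right : ∀ x, h.snd (top x) = w.fst (right x)
  bot_left : ∀ x, k.fst (bot x) = v.snd (left x)
  bot_right : ∀ x, k.snd (bot x) = w.snd (right x)

/-- A morphism of spans of spans, with arbitrary compatible span morphisms on the four sides. -/
@[ext]
structure SetBasic.Hom {A B C D A' B' C' D' : Type v} {h : SetSpan A B} {v : SetSpan A C}
    {w : SetSpan B D} {k : SetSpan C D} {h' : SetSpan A' B'} {v' : SetSpan A' C'}
    {w' : SetSpan B' D'} {k' : SetSpan C' D'} (α : SetBasic h v w k) (β : SetBasic h' v' w' k')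
    where
  top : h.Hom h'
  left : v.Hom v'
  right : w.Hom w'
  bot : k.Hom k'
  mid : α.apex → β.apex
  src_top : top.src = left.src
  tgt_top : top.tgt = right.src
  src_bot : bot.src = left.tgt
  tgt_bot : bot.tgt = right.tgt
  top_mid : ∀ x, β.top (mid x) = top.mid (α.top x)
  left_mid : ∀ x, β.left (mid x) = left.mid (α.left x)
  right_mid : ∀ x, β.right (mid x) = right.mid (α.right x)
  bot_mid : ∀ x, β.bot (mid x) = bot.mid (α.bot x)

/-- The data of the intercategory of sets. Objects are sets, transversal arrows are functions,
horizontal and vertical arrows are spans, basic cells are spans of spans. -/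
def setData : IntercatData.{v, v + 1, v + 1, v + 1} (Type v) where
  hor := spanSet
  ver := spanSet
  Basic h v w k := SetBasic h v w k
  Cube α β := SetBasic.Hom α β
  top c := c.top
  left c := c.left
  right c := c.right
  bot c := c.bot
  cone α := ⟨spanSet.one _, spanSet.one _, spanSet.one _, spanSet.one _, fun x => x,
    rfl, rfl, rfl, rfl, fun _ => rfl, fun _ => rfl, fun _ => rfl, fun _ => rfl⟩
  ccomp c d := ⟨spanSet.comp c.top d.top, spanSet.comp c.left d.left,
    spanSet.comp c.right d.right, spanSet.comp c.bot d.bot, fun x => d.mid (c.mid x),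
    congrArg₂ (· ≫ ·) c.src_top d.src_top, congrArg₂ (· ≫ ·) c.tgt_top d.tgt_top,
    congrArg₂ (· ≫ ·) c.src_bot d.src_bot, congrArg₂ (· ≫ ·) c.tgt_bot d.tgt_bot,
    fun x => (d.top_mid _).trans (congrArg d.top.mid (c.top_mid x)),
    fun x => (d.left_mid _).trans (congrArg d.left.mid (c.left_mid x)),
    fun x => (d.right_mid _).trans (congrArg d.right.mid (c.right_mid x)),
    fun x => (d.bot_mid _).trans (congrArg d.bot.mid (c.bot_mid x))⟩
  hunit v := ⟨v.apex, v.fst, fun x => x, fun x => x, v.snd,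
    fun _ => rfl, fun _ => rfl, fun _ => rfl, fun _ => rfl⟩
  hunitCell ψ := ⟨spanSet.unitCell ψ.src, ψ, ψ, spanSet.unitCell ψ.tgt, ψ.mid,
    rfl, rfl, rfl, rfl, ψ.fst_mid, fun _ => rfl, fun _ => rfl, ψ.snd_mid⟩
  hcmp α β := ⟨{ p : α.apex × β.apex // α.right p.1 = β.left p.2 },
    fun p => ⟨(α.top p.1.1, β.top p.1.2),
      (α.top_right _).trans ((congrArg _ p.2).trans (β.top_left _).symm)⟩,
    fun p => α.left p.1.1, fun p => β.right p.1.2,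
    fun p => ⟨(α.bot p.1.1, β.bot p.1.2),
      (α.bot_right _).trans ((congrArg _ p.2).trans (β.bot_left _).symm)⟩,
    fun p => α.top_left _, fun p => β.top_right _, fun p => α.bot_left _, fun p => β.bot_right _⟩
  hcmpCell c d e := ⟨spanSet.cmpCell c.top d.top (c.tgt_top.trans (e ▸ d.src_top.symm)),
    c.left, d.right, spanSet.cmpCell c.bot d.bot (c.tgt_bot.trans (e ▸ d.src_bot.symm)),
    fun p => ⟨(c.mid p.1.1, d.mid p.1.2), by rw [c.right_mid, d.left_mid, e, p.2]⟩,
    c.src_top, d.tgt_top, c.src_bot, d.tgt_bot,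
    fun p => Subtype.ext (Prod.ext (c.top_mid _) (d.top_mid _)),
    fun p => c.left_mid _, fun p => d.right_mid _,
    fun p => Subtype.ext (Prod.ext (c.bot_mid _) (d.bot_mid _))⟩
  hlam α := ⟨spanSet.lam _, spanSet.one _, spanSet.one _, spanSet.lam _, fun p => p.1.2,
    rfl, rfl, rfl, rfl, fun _ => rfl, fun p => p.2.symm, fun _ => rfl, fun _ => rfl⟩
  hlamInv α := ⟨spanSet.lamInv _, spanSet.one _, spanSet.one _, spanSet.lamInv _,
    fun x => ⟨(α.left x, x), rfl⟩, rfl, rfl, rfl, rfl,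
    fun x => Subtype.ext (Prod.ext (α.top_left x).symm rfl), fun _ => rfl, fun _ => rfl,
    fun x => Subtype.ext (Prod.ext (α.bot_left x).symm rfl)⟩
  hrho α := ⟨spanSet.rho _, spanSet.one _, spanSet.one _, spanSet.rho _, fun p => p.1.1,
    rfl, rfl, rfl, rfl, fun _ => rfl, fun _ => rfl, fun p => p.2, fun _ => rfl⟩
  hrhoInv α := ⟨spanSet.rhoInv _, spanSet.one _, spanSet.one _, spanSet.rhoInv _,
    fun x => ⟨(x, α.right x), rfl⟩, rfl, rfl, rfl, rfl,
    fun x => Subtype.ext (Prod.ext rfl (α.top_right x).symm), fun _ => rfl, fun _ => rfl,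
    fun x => Subtype.ext (Prod.ext rfl (α.bot_right x).symm)⟩
  hassoc α β γ := ⟨spanSet.assoc _ _ _, spanSet.one _, spanSet.one _, spanSet.assoc _ _ _,
    fun p => ⟨(p.1.1.1.1, ⟨(p.1.1.1.2, p.1.2), p.2⟩), p.1.1.2⟩,
    rfl, rfl, rfl, rfl, fun _ => rfl, fun _ => rfl, fun _ => rfl, fun _ => rfl⟩
  hassocInv α β γ := ⟨spanSet.assocInv _ _ _, spanSet.one _, spanSet.one _,
    spanSet.assocInv _ _ _, fun p => ⟨(⟨(p.1.1, p.1.2.1.1), p.2⟩, p.1.2.1.2), p.1.2.2⟩,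
    rfl, rfl, rfl, rfl, fun _ => rfl, fun _ => rfl, fun _ => rfl, fun _ => rfl⟩
  vunit h := ⟨h.apex, fun x => x, h.fst, h.snd, fun x => x,
    fun _ => rfl, fun _ => rfl, fun _ => rfl, fun _ => rfl⟩
  vunitCell φ := ⟨φ, spanSet.unitCell φ.src, spanSet.unitCell φ.tgt, φ, φ.mid,
    rfl, rfl, rfl, rfl, fun _ => rfl, φ.fst_mid, φ.snd_mid, fun _ => rfl⟩
  vcmp α β := ⟨{ p : α.apex × β.apex // α.bot p.1 = β.top p.2 },
    fun p => α.top p.1.1,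
    fun p => ⟨(α.left p.1.1, β.left p.1.2),
      (α.bot_left _).symm.trans ((congrArg _ p.2).trans (β.top_left _))⟩,
    fun p => ⟨(α.right p.1.1, β.right p.1.2),
      (α.bot_right _).symm.trans ((congrArg _ p.2).trans (β.top_right _))⟩,
    fun p => β.bot p.1.2,
    fun p => α.top_left _, fun p => α.top_right _, fun p => β.bot_left _, fun p => β.bot_right _⟩
  vcmpCell c d e := ⟨c.top,
    spanSet.cmpCell c.left d.left (c.src_bot.symm.trans (e ▸ d.src_top)),
    spanSet.cmpCell c.right d.right (c.tgt_bot.symm.trans (e ▸ d.tgt_top)), d.bot,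
    fun p => ⟨(c.mid p.1.1, d.mid p.1.2), by rw [c.bot_mid, d.top_mid, e, p.2]⟩,
    c.src_top, c.tgt_top, d.src_bot, d.tgt_bot,
    fun p => c.top_mid _,
    fun p => Subtype.ext (Prod.ext (c.left_mid _) (d.left_mid _)),
    fun p => Subtype.ext (Prod.ext (c.right_mid _) (d.right_mid _)),
    fun p => d.bot_mid _⟩
  vlam α := ⟨spanSet.one _, spanSet.lam _, spanSet.lam _, spanSet.one _, fun p => p.1.2,
    rfl, rfl, rfl, rfl, fun p => p.2.symm, fun _ => rfl, fun _ => rfl, fun _ => rfl⟩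
  vlamInv α := ⟨spanSet.one _, spanSet.lamInv _, spanSet.lamInv _, spanSet.one _,
    fun x => ⟨(α.top x, x), rfl⟩, rfl, rfl, rfl, rfl, fun _ => rfl,
    fun x => Subtype.ext (Prod.ext (α.top_left x) rfl),
    fun x => Subtype.ext (Prod.ext (α.top_right x) rfl), fun _ => rfl⟩
  vrho α := ⟨spanSet.one _, spanSet.rho _, spanSet.rho _, spanSet.one _, fun p => p.1.1,
    rfl, rfl, rfl, rfl, fun _ => rfl, fun _ => rfl, fun _ => rfl, fun p => p.2⟩
  vrhoInv α := ⟨spanSet.one _, spanSet.rhoInv _, spanSet.rhoInv _, spanSet.one _,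
    fun x => ⟨(x, α.bot x), rfl⟩, rfl, rfl, rfl, rfl, fun _ => rfl,
    fun x => Subtype.ext (Prod.ext rfl (α.bot_left x)),
    fun x => Subtype.ext (Prod.ext rfl (α.bot_right x)), fun _ => rfl⟩
  vassoc α β γ := ⟨spanSet.one _, spanSet.assoc _ _ _, spanSet.assoc _ _ _, spanSet.one _,
    fun p => ⟨(p.1.1.1.1, ⟨(p.1.1.1.2, p.1.2), p.2⟩), p.1.1.2⟩,
    rfl, rfl, rfl, rfl, fun _ => rfl, fun _ => rfl, fun _ => rfl, fun _ => rfl⟩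
  vassocInv α β γ := ⟨spanSet.one _, spanSet.assocInv _ _ _, spanSet.assocInv _ _ _,
    spanSet.one _, fun p => ⟨(⟨(p.1.1, p.1.2.1.1), p.2⟩, p.1.2.1.2), p.1.2.2⟩,
    rfl, rfl, rfl, rfl, fun _ => rfl, fun _ => rfl, fun _ => rfl, fun _ => rfl⟩
  tau A := ⟨spanSet.one _, spanSet.one _, spanSet.one _, spanSet.one _, fun x => x,
    rfl, rfl, rfl, rfl, fun _ => rfl, fun _ => rfl, fun _ => rfl, fun _ => rfl⟩
  mu v v' := ⟨spanSet.one _, spanSet.one _, spanSet.one _, spanSet.one _, fun p => p,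
    rfl, rfl, rfl, rfl, fun _ => rfl, fun _ => rfl, fun _ => rfl, fun _ => rfl⟩
  delta h h' := ⟨spanSet.one _, spanSet.one _, spanSet.one _, spanSet.one _, fun p => p,
    rfl, rfl, rfl, rfl, fun _ => rfl, fun _ => rfl, fun _ => rfl, fun _ => rfl⟩
  chi α β γ ε := ⟨spanSet.one _, spanSet.one _, spanSet.one _, spanSet.one _,
    fun p => ⟨(⟨(p.1.1.1.1, p.1.2.1.1), congrArg (fun q => q.1.1) p.2⟩,
        ⟨(p.1.1.1.2, p.1.2.1.2), congrArg (fun q => q.1.2) p.2⟩),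
      Subtype.ext (Prod.ext p.1.1.2 p.1.2.2)⟩,
    rfl, rfl, rfl, rfl, fun _ => rfl, fun _ => rfl, fun _ => rfl, fun _ => rfl⟩

theorem setData_row_isWeak : setData.{v}.row.IsWeak := by
  constructor <;> intros
  case lam_nat φ e =>
    refine SetBasic.Hom.ext ?_ rfl rfl ?_ rfl
    · exact SetSpan.Hom.ext φ.src_top.symm rfl rfl
    · exact SetSpan.Hom.ext φ.src_bot.symm rfl rfl
  case rho_nat φ e =>
    refine SetBasic.Hom.ext ?_ rfl rfl ?_ rfl
    · exact SetSpan.Hom.ext rfl φ.tgt_top.symm rfl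
    · exact SetSpan.Hom.ext rfl φ.tgt_bot.symm rfl
  case lam_lamInv =>
    exact SetBasic.Hom.ext (spanSet_isWeak.lam_lamInv _) rfl rfl (spanSet_isWeak.lam_lamInv _)
      (funext fun x => Subtype.ext (Prod.ext x.2.symm rfl))
  case rho_rhoInv =>
    exact SetBasic.Hom.ext (spanSet_isWeak.rho_rhoInv _) rfl rfl (spanSet_isWeak.rho_rhoInv _)
      (funext fun x => Subtype.ext (Prod.ext rfl x.2))
  all_goals rfl

theorem setData_col_isWeak : setData.{v}.col.IsWeak := by
  constructor <;> intros
  case lam_nat φ e =>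
    refine SetBasic.Hom.ext rfl ?_ ?_ rfl rfl
    · exact SetSpan.Hom.ext φ.src_top rfl rfl
    · exact SetSpan.Hom.ext φ.tgt_top rfl rfl
  case rho_nat φ e =>
    refine SetBasic.Hom.ext rfl ?_ ?_ rfl rfl
    · exact SetSpan.Hom.ext rfl φ.src_bot rfl
    · exact SetSpan.Hom.ext rfl φ.tgt_bot rfl
  case lam_lamInv =>
    exact SetBasic.Hom.ext rfl (spanSet_isWeak.lam_lamInv _) (spanSet_isWeak.lam_lamInv _) rfl
      (funext fun x => Subtype.ext (Prod.ext x.2.symm rfl))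
  case rho_rhoInv =>
    exact SetBasic.Hom.ext rfl (spanSet_isWeak.rho_rhoInv _) (spanSet_isWeak.rho_rhoInv _) rfl
      (funext fun x => Subtype.ext (Prod.ext rfl x.2))
  all_goals rfl

/-- The intercategory of sets. -/
def setIntercat : Intercategory.{v, v + 1, v + 1, v + 1} (Type v) where
  toIntercatData := setData
  hor_isWeak := spanSet_isWeak
  ver_isWeak := spanSet_isWeak
  row_isWeak := setData_row_isWeak
  col_isWeak := setData_col_isWeak
  faces := by
    constructor <;> intros
    case src_top c => exact c.src_top
    case tgt_top c => exact c.tgt_top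
    case src_bot c => exact c.src_bot
    case tgt_bot c => exact c.tgt_bot
    all_goals rfl
  interchange := by
    constructor <;> intros <;> first
      | rfl
      | exact ⟨rfl, rfl, rfl, rfl⟩

/-! ## The hom functor of an intercategory at an object -/

namespace DoubleData

variable {O : Type u} [Category.{v} O] {D : DoubleData.{v, w} O}

theorem IsWeak.src_lamInv (hD : D.IsWeak) {A B : O} (h : D.Arr A B) :
    D.src (D.lamInv h) = 𝟙 A := by
  have := congrArg D.src (hD.lamInv_lam h)
  rwa [hD.src_comp, hD.src_lam, hD.src_one, Category.comp_id] at this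

theorem IsWeak.tgt_lamInv (hD : D.IsWeak) {A B : O} (h : D.Arr A B) :
    D.tgt (D.lamInv h) = 𝟙 B := by
  have := congrArg D.tgt (hD.lamInv_lam h)
  rwa [hD.tgt_comp, hD.tgt_lam, hD.tgt_one, Category.comp_id] at this

theorem IsWeak.src_homCmp (hD : D.IsWeak) {X A B C : O} {h : D.Arr A B} {k : D.Arr B C}
    (φ : D.Cell (D.unit X) h) (ψ : D.Cell (D.unit X) k) (e : D.tgt φ = D.src ψ) :
    D.src (D.lamInv (D.unit X) ⋄ D.cmpCell φ ψ e) = D.src φ := by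
  rw [hD.src_comp, hD.src_lamInv, Category.id_comp, hD.src_cmpCell]

theorem IsWeak.tgt_homCmp (hD : D.IsWeak) {X A B C : O} {h : D.Arr A B} {k : D.Arr B C}
    (φ : D.Cell (D.unit X) h) (ψ : D.Cell (D.unit X) k) (e : D.tgt φ = D.src ψ) :
    D.tgt (D.lamInv (D.unit X) ⋄ D.cmpCell φ ψ e) = D.tgt ψ := by
  rw [hD.tgt_comp, hD.tgt_lamInv, Category.id_comp, hD.tgt_cmpCell]

/-- The functor of strict arrows out of `X`. -/
def homBase (X : O) : O ⥤ Type v where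
  obj A := X ⟶ A
  map f := ↾(fun x : X ⟶ _ => x ≫ f)

/-- The hom functor of a weak double category at `X`. A weak arrow `h` goes to the span of all cells
`D.unit X → h`, and cells act by strict composition. The laxity sends `f` to `D.unitCell f` and a
matching pair of cells to their weak composite precomposed with the inverse unitor. -/
def homLax (hD : D.IsWeak) (X : O) : LaxData D spanSet (homBase X).toPrefunctor where
  arr h := ⟨D.Cell (D.unit X) h, fun φ => D.src φ, fun φ => D.tgt φ⟩
  cell θ := ⟨↾(fun x : X ⟶ _ => x ≫ D.src θ), ↾(fun x : X ⟶ _ => x ≫ D.tgt θ),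
    fun φ => φ ⋄ θ, fun φ => hD.src_comp φ θ, fun φ => hD.tgt_comp φ θ⟩
  unitLax A := ⟨𝟙 _, 𝟙 _, fun f => D.unitCell f, hD.src_unitCell, hD.tgt_unitCell⟩
  cmpLax h k := ⟨𝟙 _, 𝟙 _, fun p => D.lamInv (D.unit X) ⋄ D.cmpCell p.1.1 p.1.2 p.2,
    fun p => hD.src_homCmp p.1.1 p.1.2 p.2, fun p => hD.tgt_homCmp p.1.1 p.1.2 p.2⟩

end DoubleData

namespace Intercategory

variable {Obj : Type u} [Category.{v} Obj] (A : Intercategory.{v, w₁, w₂, w₃} Obj)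

section faces

variable {P Q R S : Obj} {h : A.hor.Arr P Q} {v : A.ver.Arr P R} {w : A.ver.Arr Q S}
  {k : A.hor.Arr R S} {P' Q' R' S' : Obj} {h' : A.hor.Arr P' Q'} {v' : A.ver.Arr P' R'}
  {w' : A.ver.Arr Q' S'} {k' : A.hor.Arr R' S'} {P'' Q'' R'' S'' : Obj} {h'' : A.hor.Arr P'' Q''}
  {v'' : A.ver.Arr P'' R''} {w'' : A.ver.Arr Q'' S''} {k'' : A.hor.Arr R'' S''}
  {α : A.Basic h v w k} {β : A.Basic h' v' w' k'} {γ : A.Basic h'' v'' w'' k''}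

theorem top_ccomp (c : A.Cube α β) (d : A.Cube β γ) : A.top (c ⬦ d) = A.top c ⋄ A.top d :=
  A.col_isWeak.src_comp (A := ⟨P, Q, h⟩) (B := ⟨R, S, k⟩) (A' := ⟨P', Q', h'⟩) (B' := ⟨R', S', k'⟩)
    (A'' := ⟨P'', Q'', h''⟩) (B'' := ⟨R'', S'', k''⟩) (h := ⟨v, w, α⟩) (k := ⟨v', w', β⟩)
    (l := ⟨v'', w'', γ⟩) c d

theorem bot_ccomp (c : A.Cube α β) (d : A.Cube β γ) : A.bot (c ⬦ d) = A.bot c ⋄ A.bot d :=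
  A.col_isWeak.tgt_comp (A := ⟨P, Q, h⟩) (B := ⟨R, S, k⟩) (A' := ⟨P', Q', h'⟩) (B' := ⟨R', S', k'⟩)
    (A'' := ⟨P'', Q'', h''⟩) (B'' := ⟨R'', S'', k''⟩) (h := ⟨v, w, α⟩) (k := ⟨v', w', β⟩)
    (l := ⟨v'', w'', γ⟩) c d

theorem left_ccomp (c : A.Cube α β) (d : A.Cube β γ) : A.left (c ⬦ d) = A.left c ⋄ A.left d :=
  A.row_isWeak.src_comp (A := ⟨P, R, v⟩) (B := ⟨Q, S, w⟩) (A' := ⟨P', R', v'⟩) (B' := ⟨Q', S', w'⟩)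
    (A'' := ⟨P'', R'', v''⟩) (B'' := ⟨Q'', S'', w''⟩) (h := ⟨h, k, α⟩) (k := ⟨h', k', β⟩)
    (l := ⟨h'', k'', γ⟩) c d

theorem right_ccomp (c : A.Cube α β) (d : A.Cube β γ) : A.right (c ⬦ d) = A.right c ⋄ A.right d :=
  A.row_isWeak.tgt_comp (A := ⟨P, R, v⟩) (B := ⟨Q, S, w⟩) (A' := ⟨P', R', v'⟩) (B' := ⟨Q', S', w'⟩)
    (A'' := ⟨P'', R'', v''⟩) (B'' := ⟨Q'', S'', w''⟩) (h := ⟨h, k, α⟩) (k := ⟨h', k', β⟩)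
    (l := ⟨h'', k'', γ⟩) c d

theorem vlamInv_vlam (α : A.Basic h v w k) : A.vlamInv α ⬦ A.vlam α = A.cone α :=
  A.col_isWeak.lamInv_lam (A := ⟨P, Q, h⟩) (B := ⟨R, S, k⟩) ⟨v, w, α⟩

theorem top_vlamInv (α : A.Basic h v w k) : A.top (A.vlamInv α) = A.hor.one h := by
  have e := congrArg A.top (A.vlamInv_vlam α)
  rw [top_ccomp, show A.top (A.vlam α) = A.hor.one h from
      A.col_isWeak.src_lam (A := ⟨P, Q, h⟩) (B := ⟨R, S, k⟩) ⟨v, w, α⟩,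
    show A.top (A.cone α) = A.hor.one h from A.col_isWeak.src_one (A := ⟨P, Q, h⟩)
      (B := ⟨R, S, k⟩) ⟨v, w, α⟩, A.hor_isWeak.comp_one] at e
  exact e

theorem bot_vlamInv (α : A.Basic h v w k) : A.bot (A.vlamInv α) = A.hor.one k := by
  have e := congrArg A.bot (A.vlamInv_vlam α)
  rw [bot_ccomp, show A.bot (A.vlam α) = A.hor.one k from
      A.col_isWeak.tgt_lam (A := ⟨P, Q, h⟩) (B := ⟨R, S, k⟩) ⟨v, w, α⟩,
    show A.bot (A.cone α) = A.hor.one k from A.col_isWeak.tgt_one (A := ⟨P, Q, h⟩)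
      (B := ⟨R, S, k⟩) ⟨v, w, α⟩, A.hor_isWeak.comp_one] at e
  exact e

theorem left_vlamInv (α : A.Basic h v w k) : A.left (A.vlamInv α) = A.ver.lamInv v := by
  have e := congrArg A.left (A.vlamInv_vlam α)
  rw [left_ccomp, A.faces.left_vlam, show A.left (A.cone α) = A.ver.one v from
    A.row_isWeak.src_one (A := ⟨P, R, v⟩) (B := ⟨Q, S, w⟩) ⟨h, k, α⟩] at e
  rw [← A.ver_isWeak.comp_one (A.left (A.vlamInv α)), ← A.ver_isWeak.lam_lamInv,
    ← A.ver_isWeak.comp_assoc, e, A.ver_isWeak.one_comp]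

theorem right_vlamInv (α : A.Basic h v w k) : A.right (A.vlamInv α) = A.ver.lamInv w := by
  have e := congrArg A.right (A.vlamInv_vlam α)
  rw [right_ccomp, A.faces.right_vlam, show A.right (A.cone α) = A.ver.one w from
    A.row_isWeak.tgt_one (A := ⟨P, R, v⟩) (B := ⟨Q, S, w⟩) ⟨h, k, α⟩] at e
  rw [← A.ver_isWeak.comp_one (A.right (A.vlamInv α)), ← A.ver_isWeak.lam_lamInv,
    ← A.ver_isWeak.comp_assoc, e, A.ver_isWeak.one_comp]

theorem top_vunitCell (φ : A.hor.Cell h h') : A.top (A.vunitCell φ) = φ :=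
  A.col_isWeak.src_unitCell (A := ⟨P, Q, h⟩) (A' := ⟨P', Q', h'⟩) φ

theorem bot_vunitCell (φ : A.hor.Cell h h') : A.bot (A.vunitCell φ) = φ :=
  A.col_isWeak.tgt_unitCell (A := ⟨P, Q, h⟩) (A' := ⟨P', Q', h'⟩) φ

theorem left_hunitCell (ψ : A.ver.Cell v v') : A.left (A.hunitCell ψ) = ψ :=
  A.row_isWeak.src_unitCell (A := ⟨P, R, v⟩) (A' := ⟨P', R', v'⟩) ψ

theorem right_hunitCell (ψ : A.ver.Cell v v') : A.right (A.hunitCell ψ) = ψ :=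
  A.row_isWeak.tgt_unitCell (A := ⟨P, R, v⟩) (A' := ⟨P', R', v'⟩) ψ

end faces

section cubes

variable {P Q R P' Q' R' X : Obj}

/-- The cube given by a vertical cell out of the identity of `X`, by way of `tau`. -/
def homHunit {v : A.ver.Arr P Q} (ψ : A.ver.Cell (A.ver.unit X) v) :
    A.Cube (A.vunit (A.hor.unit X)) (A.hunit v) :=
  A.tau X ⬦ A.hunitCell ψ

theorem top_homHunit {v : A.ver.Arr P Q} (ψ : A.ver.Cell (A.ver.unit X) v) :
    A.top (A.homHunit ψ) = A.hor.unitCell (A.ver.src ψ) := by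
  rw [homHunit, top_ccomp, (A.interchange.tau_special X).top, A.faces.top_hunitCell,
    A.hor_isWeak.one_comp]

theorem bot_homHunit {v : A.ver.Arr P Q} (ψ : A.ver.Cell (A.ver.unit X) v) :
    A.bot (A.homHunit ψ) = A.hor.unitCell (A.ver.tgt ψ) := by
  rw [homHunit, bot_ccomp, (A.interchange.tau_special X).bot, A.faces.bot_hunitCell,
    A.hor_isWeak.one_comp]

theorem left_homHunit {v : A.ver.Arr P Q} (ψ : A.ver.Cell (A.ver.unit X) v) :
    A.left (A.homHunit ψ) = ψ := by
  rw [homHunit, left_ccomp, (A.interchange.tau_special X).left, left_hunitCell,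
    A.ver_isWeak.one_comp]

theorem right_homHunit {v : A.ver.Arr P Q} (ψ : A.ver.Cell (A.ver.unit X) v) :
    A.right (A.homHunit ψ) = ψ := by
  rw [homHunit, right_ccomp, (A.interchange.tau_special X).right, right_hunitCell,
    A.ver_isWeak.one_comp]

section hor

variable {h : A.hor.Arr P Q} {h' : A.hor.Arr Q R} {v : A.ver.Arr P P'} {w : A.ver.Arr Q Q'}
  {x : A.ver.Arr R R'} {k : A.hor.Arr P' Q'} {k' : A.hor.Arr Q' R'} {α : A.Basic h v w k}
  {β : A.Basic h' w x k'} (c : A.Cube (A.vunit (A.hor.unit X)) α)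
  (d : A.Cube (A.vunit (A.hor.unit X)) β)

/-- The horizontal composite of two cubes out of the vertical identity of the horizontal identity
of `X`, by way of the inverse unitor and `delta`. -/
def homHcmp (e : A.right c = A.left d) : A.Cube (A.vunit (A.hor.unit X)) (A.hcmp α β) :=
  A.vunitCell (A.hor.lamInv (A.hor.unit X)) ⬦ A.delta (A.hor.unit X) (A.hor.unit X) ⬦
    A.hcmpCell c d e

theorem top_homHcmp (e : A.right c = A.left d) (e' : A.hor.tgt (A.top c) = A.hor.src (A.top d)) :
    A.top (A.homHcmp c d e) =
      A.hor.lamInv (A.hor.unit X) ⋄ A.hor.cmpCell (A.top c) (A.top d) e' := by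
  rw [homHcmp, top_ccomp, top_ccomp, top_vunitCell, (A.interchange.delta_special _ _).top,
    A.faces.top_hcmpCell c d e e', A.hor_isWeak.one_comp]

theorem bot_homHcmp (e : A.right c = A.left d) (e' : A.hor.tgt (A.bot c) = A.hor.src (A.bot d)) :
    A.bot (A.homHcmp c d e) =
      A.hor.lamInv (A.hor.unit X) ⋄ A.hor.cmpCell (A.bot c) (A.bot d) e' := by
  rw [homHcmp, bot_ccomp, bot_ccomp, bot_vunitCell, (A.interchange.delta_special _ _).bot,
    A.faces.bot_hcmpCell c d e e', A.hor_isWeak.one_comp]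

theorem left_homHcmp (e : A.right c = A.left d) : A.left (A.homHcmp c d e) = A.left c := by
  have e₁ : A.left (A.hcmpCell c d e) = A.left c :=
    A.row_isWeak.src_cmpCell (A := ⟨X, X, _⟩) (B := ⟨X, X, _⟩) (C := ⟨X, X, _⟩) (A' := ⟨P, P', v⟩)
      (B' := ⟨Q, Q', w⟩) (C' := ⟨R, R', x⟩) (h := ⟨_, _, A.vunit (A.hor.unit X)⟩)
      (h' := ⟨_, _, A.vunit (A.hor.unit X)⟩) (k := ⟨h, k, α⟩) (k' := ⟨h', k', β⟩) c d e
  rw [homHcmp, left_ccomp, left_ccomp, A.faces.left_vunitCell, A.hor_isWeak.src_lamInv,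
    A.ver_isWeak.unitCell_id, (A.interchange.delta_special _ _).left, e₁, A.ver_isWeak.one_comp,
    A.ver_isWeak.one_comp]

theorem right_homHcmp (e : A.right c = A.left d) : A.right (A.homHcmp c d e) = A.right d := by
  have e₁ : A.right (A.hcmpCell c d e) = A.right d :=
    A.row_isWeak.tgt_cmpCell (A := ⟨X, X, _⟩) (B := ⟨X, X, _⟩) (C := ⟨X, X, _⟩) (A' := ⟨P, P', v⟩)
      (B' := ⟨Q, Q', w⟩) (C' := ⟨R, R', x⟩) (h := ⟨_, _, A.vunit (A.hor.unit X)⟩)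
      (h' := ⟨_, _, A.vunit (A.hor.unit X)⟩) (k := ⟨h, k, α⟩) (k' := ⟨h', k', β⟩) c d e
  rw [homHcmp, right_ccomp, right_ccomp, A.faces.right_vunitCell, A.hor_isWeak.tgt_lamInv,
    A.ver_isWeak.unitCell_id, (A.interchange.delta_special _ _).right, e₁, A.ver_isWeak.one_comp,
    A.ver_isWeak.one_comp]

end hor

section ver

variable {v : A.ver.Arr P Q} {v' : A.ver.Arr Q R} {h : A.hor.Arr P P'} {k : A.hor.Arr Q Q'}
  {l : A.hor.Arr R R'} {w : A.ver.Arr P' Q'} {w' : A.ver.Arr Q' R'} {α : A.Basic h v w k}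
  {β : A.Basic k v' w' l} (c : A.Cube (A.vunit (A.hor.unit X)) α)
  (d : A.Cube (A.vunit (A.hor.unit X)) β)

/-- The vertical composite of two cubes out of the vertical identity of the horizontal identity
of `X`, by way of the inverse unitor. -/
def homVcmp (e : A.bot c = A.top d) : A.Cube (A.vunit (A.hor.unit X)) (A.vcmp α β) :=
  A.vlamInv (A.vunit (A.hor.unit X)) ⬦ A.vcmpCell c d e

theorem top_homVcmp (e : A.bot c = A.top d) : A.top (A.homVcmp c d e) = A.top c := by
  have e₁ : A.top (A.vcmpCell c d e) = A.top c :=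
    A.col_isWeak.src_cmpCell (A := ⟨X, X, _⟩) (B := ⟨X, X, _⟩) (C := ⟨X, X, _⟩) (A' := ⟨P, P', h⟩)
      (B' := ⟨Q, Q', k⟩) (C' := ⟨R, R', l⟩) (h := ⟨_, _, A.vunit (A.hor.unit X)⟩)
      (h' := ⟨_, _, A.vunit (A.hor.unit X)⟩) (k := ⟨v, w, α⟩) (k' := ⟨v', w', β⟩) c d e
  rw [homVcmp, top_ccomp, top_vlamInv, e₁, A.hor_isWeak.one_comp]

theorem bot_homVcmp (e : A.bot c = A.top d) : A.bot (A.homVcmp c d e) = A.bot d := by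
  have e₁ : A.bot (A.vcmpCell c d e) = A.bot d :=
    A.col_isWeak.tgt_cmpCell (A := ⟨X, X, _⟩) (B := ⟨X, X, _⟩) (C := ⟨X, X, _⟩) (A' := ⟨P, P', h⟩)
      (B' := ⟨Q, Q', k⟩) (C' := ⟨R, R', l⟩) (h := ⟨_, _, A.vunit (A.hor.unit X)⟩)
      (h' := ⟨_, _, A.vunit (A.hor.unit X)⟩) (k := ⟨v, w, α⟩) (k' := ⟨v', w', β⟩) c d e
  rw [homVcmp, bot_ccomp, bot_vlamInv, e₁, A.hor_isWeak.one_comp]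

theorem left_homVcmp (e : A.bot c = A.top d)
    (e' : A.ver.tgt (A.left c) = A.ver.src (A.left d)) :
    A.left (A.homVcmp c d e) =
      A.ver.lamInv (A.ver.unit X) ⋄ A.ver.cmpCell (A.left c) (A.left d) e' := by
  rw [homVcmp, left_ccomp, left_vlamInv, A.faces.left_vcmpCell c d e e']

theorem right_homVcmp (e : A.bot c = A.top d)
    (e' : A.ver.tgt (A.right c) = A.ver.src (A.right d)) :
    A.right (A.homVcmp c d e) =
      A.ver.lamInv (A.ver.unit X) ⋄ A.ver.cmpCell (A.right c) (A.right d) e' := by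
  rw [homVcmp, right_ccomp, right_vlamInv, A.faces.right_vcmpCell c d e e']

end ver

end cubes

/-- The data of the hom functor at `X` into the intercategory of sets. An object `P` goes to the set
of transversal arrows `X ⟶ P`, horizontal and vertical arrows go to spans of horizontal and
vertical cells out of the identities of `X`, and a basic cell `α` goes to the span of spans of all
cubes from the vertical identity of the horizontal identity of `X` to `α`. Transversal arrows, cells
and cubes act by transversal composition. -/
def homData (X : Obj) : LaxLaxData A.toIntercatData setIntercat.{v}.toIntercatData where
  base := DoubleData.homBase X
  hor := DoubleData.homLax A.hor_isWeak X
  ver := DoubleData.homLax A.ver_isWeak X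
  basic α := ⟨A.Cube (A.vunit (A.hor.unit X)) α, fun c => A.top c, fun c => A.left c,
    fun c => A.right c, fun c => A.bot c, fun c => A.faces.src_top c, fun c => A.faces.tgt_top c,
    fun c => A.faces.src_bot c, fun c => A.faces.tgt_bot c⟩
  cube d := ⟨(DoubleData.homLax A.hor_isWeak X).cell (A.top d),
    (DoubleData.homLax A.ver_isWeak X).cell (A.left d),
    (DoubleData.homLax A.ver_isWeak X).cell (A.right d),
    (DoubleData.homLax A.hor_isWeak X).cell (A.bot d), fun c => c ⬦ d,
    congrArg (DoubleData.homBase X).map (A.faces.src_top d),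
    congrArg (DoubleData.homBase X).map (A.faces.tgt_top d),
    congrArg (DoubleData.homBase X).map (A.faces.src_bot d),
    congrArg (DoubleData.homBase X).map (A.faces.tgt_bot d),
    fun c => A.top_ccomp c d, fun c => A.left_ccomp c d, fun c => A.right_ccomp c d,
    fun c => A.bot_ccomp c d⟩
  hunitLax v := ⟨(DoubleData.homLax A.hor_isWeak X).unitLax _, spanSet.one _, spanSet.one _,
    (DoubleData.homLax A.hor_isWeak X).unitLax _, fun ψ => A.homHunit ψ, rfl, rfl, rfl, rfl,
    fun ψ => A.top_homHunit ψ, fun ψ => A.left_homHunit ψ, fun ψ => A.right_homHunit ψ,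
    fun ψ => A.bot_homHunit ψ⟩
  hcmpLax α β := ⟨(DoubleData.homLax A.hor_isWeak X).cmpLax _ _, spanSet.one _, spanSet.one _,
    (DoubleData.homLax A.hor_isWeak X).cmpLax _ _, fun p => A.homHcmp p.1.1 p.1.2 p.2,
    rfl, rfl, rfl, rfl, fun p => A.top_homHcmp p.1.1 p.1.2 p.2 _,
    fun p => A.left_homHcmp p.1.1 p.1.2 p.2, fun p => A.right_homHcmp p.1.1 p.1.2 p.2,
    fun p => A.bot_homHcmp p.1.1 p.1.2 p.2 _⟩
  vunitLax h := ⟨spanSet.one _, (DoubleData.homLax A.ver_isWeak X).unitLax _,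
    (DoubleData.homLax A.ver_isWeak X).unitLax _, spanSet.one _, fun φ => A.vunitCell φ,
    rfl, rfl, rfl, rfl, fun φ => A.top_vunitCell φ, fun φ => A.faces.left_vunitCell φ,
    fun φ => A.faces.right_vunitCell φ, fun φ => A.bot_vunitCell φ⟩
  vcmpLax α β := ⟨spanSet.one _, (DoubleData.homLax A.ver_isWeak X).cmpLax _ _,
    (DoubleData.homLax A.ver_isWeak X).cmpLax _ _, spanSet.one _,
    fun p => A.homVcmp p.1.1 p.1.2 p.2,
    rfl, rfl, rfl, rfl, fun p => A.top_homVcmp p.1.1 p.1.2 p.2,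
    fun p => A.left_homVcmp p.1.1 p.1.2 p.2 _, fun p => A.right_homVcmp p.1.1 p.1.2 p.2 _,
    fun p => A.bot_homVcmp p.1.1 p.1.2 p.2⟩

end Intercategory

/-! The laxity of the hom functor is convolution. In a weak double category let `c` be a weak
endoarrow of `X` carrying special cells `ε : c → unit X` and `δ : c → c|c` that satisfy the comonoid
laws. Cells out of `c` then multiply by `(φ, φ') ↦ δ ; (φ|φ')`, with units `f ↦ ε ; unitCell f`.
Naturality of these operations is functoriality of weak composition. Each of the two unit laws and
the associativity law is the naturality of `λ`, `ρ` or `κ` followed by one comonoid law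
(`comul_comp_lam`, `comul_comp_rho`, `comul_comp_assoc`).

All the laxities of `H` are of this kind. For horizontal arrows, and for vertical arrows, `c` is the
weak unit at `X` with `ε = 1` and `δ = λ⁻¹` (`isComonoid_unit`); that this is a comonoid rests on
the triangle axiom and on the equality `λ = ρ` at a unit (`lam_unit`), which follows from the
pentagon and the triangle by Kelly's argument. For basic cells `c` is always `U = Id_{id_X}`.
Vertically `U` is itself a weak unit, that of `A.col` at the horizontal arrow `id_X`, so the same
comonoid serves. Horizontally `U` need not be a unit, but `τ` and `Id_{λ⁻¹} ; δ` make it a comonoid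
(`isComonoid_rowUnit`): its laws are the compatibilities of `δ` and `τ` with the horizontal `λ`, `ρ`
and `κ`, combined with the comonoid laws of `id_X`.

Of the four interchanger conditions, those for `τ` and `δ` are their naturality. Those for `μ` and
`χ` reduce by naturality to two identities about `U` alone, which say that its horizontal counit and
comultiplication respect its vertical comultiplication `λ⁻¹` (`vlamInv_ccomp_vcmpCell_tau_ccomp_mu`,
`vlamInv_ccomp_vcmpCell_comul_ccomp_chi`). They come from the left unit laws of the lax functors
`id` and `|`, after cancelling an invertible cube built from `λ`.

An equation between morphisms of spans of spans is tested on the apex and on the four lateral faces.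
The apex carries the arguments above; the faces repeat the laws already known for horizontal and
vertical arrows, or are identities because the cubes involved are special. -/

/-! ## Coherence in weak double categories -/

namespace DoubleData

/-- `DoubleData.IsWeak` as a class, so that the faces of composite cells can be simplified. -/
class Weak {O : Type u} [CategoryStruct.{v} O] (D : DoubleData.{v, w} O) : Prop where
  isWeak : D.IsWeak

/-- A weak composite carries a proof that the faces match, so rewriting one of its factors in place
is not type-correct in general. Replacing both factors at once is harmless by proof irrelevance. -/
theorem cmpCell_congr {O : Type u} [CategoryStruct.{v} O] {D : DoubleData.{v, w} O}
    {A B C A' B' C' : O} {h : D.Arr A B} {h' : D.Arr B C} {k : D.Arr A' B'}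
    {k' : D.Arr B' C'} {φ φ' : D.Cell h k} {ψ ψ' : D.Cell h' k'} (e₁ : φ = φ') (e₂ : ψ = ψ')
    (e : D.tgt φ = D.src ψ) (e' : D.tgt φ' = D.src ψ') :
    D.cmpCell φ ψ e = D.cmpCell φ' ψ' e' := by
  subst e₁ e₂; rfl

/-! ### Faces and interchange in a weak double category -/

section weak

variable {O : Type u} [Category.{v} O] {D : DoubleData.{v, w} O} [hD : D.Weak]
  {A B C E A' B' C' E' A'' B'' C'' : O}

@[simp] theorem one_comp {h : D.Arr A B} {k : D.Arr A' B'} (φ : D.Cell h k) :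
    D.one h ⋄ φ = φ := hD.isWeak.one_comp φ

@[simp] theorem comp_one {h : D.Arr A B} {k : D.Arr A' B'} (φ : D.Cell h k) :
    φ ⋄ D.one k = φ := hD.isWeak.comp_one φ

@[simp] theorem comp_assoc {h : D.Arr A B} {k : D.Arr A' B'} {l : D.Arr A'' B''} {m : D.Arr C E}
    (φ : D.Cell h k) (ψ : D.Cell k l) (θ : D.Cell l m) : (φ ⋄ ψ) ⋄ θ = φ ⋄ (ψ ⋄ θ) :=
  hD.isWeak.comp_assoc φ ψ θ

@[simp] theorem src_one (h : D.Arr A B) : D.src (D.one h) = 𝟙 A := hD.isWeak.src_one h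

@[simp] theorem tgt_one (h : D.Arr A B) : D.tgt (D.one h) = 𝟙 B := hD.isWeak.tgt_one h

@[simp] theorem src_comp {h : D.Arr A B} {k : D.Arr A' B'} {l : D.Arr A'' B''} (φ : D.Cell h k)
    (ψ : D.Cell k l) : D.src (φ ⋄ ψ) = D.src φ ≫ D.src ψ := hD.isWeak.src_comp φ ψ

@[simp] theorem tgt_comp {h : D.Arr A B} {k : D.Arr A' B'} {l : D.Arr A'' B''} (φ : D.Cell h k)
    (ψ : D.Cell k l) : D.tgt (φ ⋄ ψ) = D.tgt φ ≫ D.tgt ψ := hD.isWeak.tgt_comp φ ψ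

@[simp] theorem src_unitCell (f : A ⟶ A') : D.src (D.unitCell f) = f := hD.isWeak.src_unitCell f

@[simp] theorem tgt_unitCell (f : A ⟶ A') : D.tgt (D.unitCell f) = f := hD.isWeak.tgt_unitCell f

@[simp] theorem src_cmpCell {h : D.Arr A B} {h' : D.Arr B C} {k : D.Arr A' B'}
    {k' : D.Arr B' C'} (φ : D.Cell h k) (ψ : D.Cell h' k') (e : D.tgt φ = D.src ψ) :
    D.src (D.cmpCell φ ψ e) = D.src φ := hD.isWeak.src_cmpCell φ ψ e

@[simp] theorem tgt_cmpCell {h : D.Arr A B} {h' : D.Arr B C} {k : D.Arr A' B'}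
    {k' : D.Arr B' C'} (φ : D.Cell h k) (ψ : D.Cell h' k') (e : D.tgt φ = D.src ψ) :
    D.tgt (D.cmpCell φ ψ e) = D.tgt ψ := hD.isWeak.tgt_cmpCell φ ψ e

@[simp] theorem src_lam (h : D.Arr A B) : D.src (D.lam h) = 𝟙 A := hD.isWeak.src_lam h

@[simp] theorem tgt_lam (h : D.Arr A B) : D.tgt (D.lam h) = 𝟙 B := hD.isWeak.tgt_lam h

@[simp] theorem src_lamInv (h : D.Arr A B) : D.src (D.lamInv h) = 𝟙 A := hD.isWeak.src_lamInv h

@[simp] theorem tgt_lamInv (h : D.Arr A B) : D.tgt (D.lamInv h) = 𝟙 B := hD.isWeak.tgt_lamInv h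

@[simp] theorem src_rho (h : D.Arr A B) : D.src (D.rho h) = 𝟙 A := hD.isWeak.src_rho h

@[simp] theorem tgt_rho (h : D.Arr A B) : D.tgt (D.rho h) = 𝟙 B := hD.isWeak.tgt_rho h

@[simp] theorem src_assoc (h : D.Arr A B) (k : D.Arr B C) (l : D.Arr C E) :
    D.src (D.assoc h k l) = 𝟙 A := hD.isWeak.src_assoc h k l

@[simp] theorem tgt_assoc (h : D.Arr A B) (k : D.Arr B C) (l : D.Arr C E) :
    D.tgt (D.assoc h k l) = 𝟙 E := hD.isWeak.tgt_assoc h k l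

-- The axioms prescribe the faces of the associator only; those of its inverse follow since `tgt` is
-- functorial.
@[simp] theorem tgt_assocInv (h : D.Arr A B) (k : D.Arr B C) (l : D.Arr C E) :
    D.tgt (D.assocInv h k l) = 𝟙 E := by
  simpa using congrArg D.tgt (hD.isWeak.assoc_assocInv h k l)

theorem cmpCell_comp_cmpCell {h : D.Arr A B} {h' : D.Arr B C} {k : D.Arr A' B'} {k' : D.Arr B' C'}
    {l : D.Arr A'' B''} {l' : D.Arr B'' C''} (φ : D.Cell h k) (ψ : D.Cell k l)
    (φ' : D.Cell h' k') (ψ' : D.Cell k' l') (e₁ : D.tgt φ = D.src φ') (e₂ : D.tgt ψ = D.src ψ') :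
    D.cmpCell φ φ' e₁ ⋄ D.cmpCell ψ ψ' e₂ =
      D.cmpCell (φ ⋄ ψ) (φ' ⋄ ψ') (by simp [e₁, e₂]) :=
  (hD.isWeak.cmpCell_comp φ ψ φ' ψ' e₁ e₂ _).symm

theorem cmpCell_comp_cmpCell_assoc {h : D.Arr A B} {h' : D.Arr B C} {k : D.Arr A' B'}
    {k' : D.Arr B' C'} {l : D.Arr A'' B''} {l' : D.Arr B'' C''} {m : D.Arr E E'}
    (φ : D.Cell h k) (ψ : D.Cell k l) (φ' : D.Cell h' k') (ψ' : D.Cell k' l')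
    (e₁ : D.tgt φ = D.src φ') (e₂ : D.tgt ψ = D.src ψ') (θ : D.Cell (D.cmp l l') m) :
    D.cmpCell φ φ' e₁ ⋄ D.cmpCell ψ ψ' e₂ ⋄ θ =
      D.cmpCell (φ ⋄ ψ) (φ' ⋄ ψ') (by simp [e₁, e₂]) ⋄ θ := by
  rw [← comp_assoc, cmpCell_comp_cmpCell]

/-! ### Unitor coherence from the pentagon and the triangle -/

/-- Composing with the unit on the left is faithful on special cells. -/
theorem eq_of_unit_cmpCell_eq {h k : D.Arr A B} {φ ψ : D.Cell h k} (h₁ : D.src φ = 𝟙 A)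
    (h₂ : D.src ψ = 𝟙 A) (e₁ e₂ : _)
    (e : D.cmpCell (D.one (D.unit A)) φ e₁ = D.cmpCell (D.one (D.unit A)) ψ e₂) : φ = ψ := by
  -- Naturality of `λ` recovers `θ` as the conjugate of `1|θ` by `λ`. The identity source face is
  -- what turns `unitCell (src θ)` into `1`.
  have key (θ : D.Cell h k) (h₃ : D.src θ = 𝟙 A) (e₃ : _) :
      θ = D.lamInv h ⋄ D.cmpCell (D.one (D.unit A)) θ e₃ ⋄ D.lam k := by
    have := hD.isWeak.lam_nat θ (by simp)
    rw [cmpCell_congr (congrArg D.unitCell h₃ |>.trans (hD.isWeak.unitCell_id A)) rfl _ e₃] at this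
    rw [this, ← comp_assoc, hD.isWeak.lamInv_lam, one_comp]
  rw [key φ h₁ e₁, key ψ h₂ e₂, e]

/-- Composing with the unit on the right is faithful on special cells. -/
theorem eq_of_cmpCell_unit_eq {h k : D.Arr A B} {φ ψ : D.Cell h k} (h₁ : D.tgt φ = 𝟙 B)
    (h₂ : D.tgt ψ = 𝟙 B) (e₁ e₂ : _)
    (e : D.cmpCell φ (D.one (D.unit B)) e₁ = D.cmpCell ψ (D.one (D.unit B)) e₂) : φ = ψ := by
  have key (θ : D.Cell h k) (h₃ : D.tgt θ = 𝟙 B) (e₃ : _) :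
      θ = D.rhoInv h ⋄ D.cmpCell θ (D.one (D.unit B)) e₃ ⋄ D.rho k := by
    have := hD.isWeak.rho_nat θ (by simp)
    rw [cmpCell_congr rfl (congrArg D.unitCell h₃ |>.trans (hD.isWeak.unitCell_id B)) _ e₃] at this
    rw [this, ← comp_assoc, hD.isWeak.rhoInv_rho, one_comp]
  rw [key φ h₁ e₁, key ψ h₂ e₂, e]

theorem cancel_left {h : D.Arr A B} {k : D.Arr A' B'} {l : D.Arr A'' B''} {i : D.Cell h k}
    {j : D.Cell k h} (hj : j ⋄ i = D.one k) {φ ψ : D.Cell k l} (e : i ⋄ φ = i ⋄ ψ) : φ = ψ := by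
  rw [← one_comp φ, ← hj, comp_assoc, e, ← comp_assoc, hj, one_comp]

theorem cancel_right {h : D.Arr A B} {k : D.Arr A' B'} {l : D.Arr A'' B''} {i : D.Cell k l}
    {j : D.Cell l k} (hj : i ⋄ j = D.one k) {φ ψ : D.Cell h k} (e : φ ⋄ i = ψ ⋄ i) : φ = ψ := by
  rw [← comp_one φ, ← hj, ← comp_assoc, e, comp_assoc, hj, comp_one]

/-- The left unitor of a composite. -/
theorem assoc_comp_lam (h : D.Arr A B) (k : D.Arr B C) (e : _) :
    D.assoc (D.unit A) h k ⋄ D.lam (D.cmp h k) = D.cmpCell (D.lam h) (D.one k) e := by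
  -- Kelly's argument: after composing with one more unit on the left, the desired triangle becomes
  -- a face of a pentagon whose other faces are triangle axioms and naturality squares of `κ`.
  refine eq_of_unit_cmpCell_eq (by simp) (by simp) (by simp) (by simp) ?_
  have inv : D.cmpCell (D.assocInv (D.unit A) (D.unit A) h) (D.one k) (by simp) ⋄
      D.cmpCell (D.assoc (D.unit A) (D.unit A) h) (D.one k) (by simp) = D.one _ := by
    rw [cmpCell_comp_cmpCell, ← hD.isWeak.cmpCell_one _ _ (by simp)]
    exact cmpCell_congr (hD.isWeak.assocInv_assoc _ _ _) (one_comp _) _ _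
  -- Precomposition with the invertible cells `κ|1` and `κ` supplies the first two edges of the
  -- pentagon.
  refine cancel_left (hD.isWeak.assocInv_assoc _ _ _) (cancel_left inv ?_)
  have e₁ : D.cmpCell (D.one (D.unit A)) (D.assoc (D.unit A) h k ⋄ D.lam (D.cmp h k)) (by simp) =
      D.cmpCell (D.one (D.unit A)) (D.assoc (D.unit A) h k) (by simp) ⋄
        D.cmpCell (D.one (D.unit A)) (D.lam (D.cmp h k)) (by simp) := by
    rw [cmpCell_comp_cmpCell]
    exact cmpCell_congr (one_comp _).symm rfl _ _
  have e₂ := hD.isWeak.pentagon (D.unit A) (D.unit A) h k (by simp) (by simp)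
  have e₃ := hD.isWeak.assoc_nat (D.rho (D.unit A)) (D.one h) (D.one k) (by simp) (by simp)
    (by simp) (by simp)
  have e₄ := hD.isWeak.assoc_nat (D.one (D.unit A)) (D.lam h) (D.one k) (by simp) (by simp)
    (by simp) (by simp)
  rw [e₁, ← e₄]
  have e₅ := congrArg (fun t => t ⋄ D.cmpCell (D.one (D.unit A)) (D.lam (D.cmp h k)) (by simp)) e₂
  simp only [comp_assoc] at e₅
  -- The pentagon and the triangle at the pair `(unit, h|k)` turn the left side into `κ ; (ρ|1)`.
  -- Naturality of `κ` rewrites it as `((ρ|1)|1) ; κ`, and what is left is the triangle at `(unit,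
  -- h)`, composed with `k`.
  rw [e₅, hD.isWeak.triangle _ _ (by simp) (by simp), cmpCell_comp_cmpCell_assoc,
    cmpCell_congr rfl (hD.isWeak.cmpCell_one h k (by simp)).symm _ (by simp), ← e₃]
  congr 1
  refine cmpCell_congr ?_ (one_comp _).symm _ _
  exact (hD.isWeak.triangle _ _ _ _).symm

/-- The two unitors agree at a unit. -/
theorem lam_unit (X : O) : D.lam (D.unit X) = D.rho (D.unit X) := by
  refine eq_of_cmpCell_unit_eq (by simp) (by simp) (by simp) (by simp) ?_
  -- Both `λ|1` and `ρ|1` are now `κ` followed by a cell, so it remains to compare `λ` at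
  -- `unit|unit` with `1|λ`.
  rw [← assoc_comp_lam, ← hD.isWeak.triangle _ _ (by simp) (by simp)]
  congr 1
  -- These two agree after composition with `λ`, by the naturality of `λ` at the cell `λ` itself.
  refine cancel_right (hD.isWeak.lam_lamInv _) ?_
  rw [← hD.isWeak.lam_nat _ (by simp)]
  congr 1
  exact cmpCell_congr (by rw [src_lam, hD.isWeak.unitCell_id]) rfl _ _

/-! ### Comonoids and convolution -/

/-- A comonoid structure on a weak endoarrow of `X`, with special cells as structure. -/
structure IsComonoid {X : O} {c : D.Arr X X} (ε : D.Cell c (D.unit X))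
    (δ : D.Cell c (D.cmp c c)) : Prop where
  src_counit : D.src ε = 𝟙 X
  tgt_counit : D.tgt ε = 𝟙 X
  src_comul : D.src δ = 𝟙 X
  tgt_comul : D.tgt δ = 𝟙 X
  counit_left : ∀ e : _, δ ⋄ D.cmpCell ε (D.one c) e ⋄ D.lam c = D.one c
  counit_right : ∀ e : _, δ ⋄ D.cmpCell (D.one c) ε e ⋄ D.rho c = D.one c
  coassoc : ∀ e₁ e₂ : _, δ ⋄ D.cmpCell δ (D.one c) e₁ ⋄ D.assoc c c c =
    δ ⋄ D.cmpCell (D.one c) δ e₂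

/-- The right counit law would naturally hold for `ρ⁻¹`; it holds for `λ⁻¹` because the unitors
agree at a unit. -/
theorem isComonoid_unit (X : O) : IsComonoid (D.one (D.unit X)) (D.lamInv (D.unit X)) where
  src_counit := by simp
  tgt_counit := by simp
  src_comul := by simp
  tgt_comul := by simp
  counit_left e := by rw [hD.isWeak.cmpCell_one, one_comp, hD.isWeak.lamInv_lam]
  counit_right e := by rw [hD.isWeak.cmpCell_one, one_comp, ← lam_unit, hD.isWeak.lamInv_lam]
  coassoc e₁ e₂ := by
    congr 1
    have inv : D.cmpCell (D.one (D.unit X)) (D.lam (D.unit X)) (by simp) ⋄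
        D.cmpCell (D.one (D.unit X)) (D.lamInv (D.unit X)) (by simp) = D.one _ := by
      rw [cmpCell_comp_cmpCell, ← hD.isWeak.cmpCell_one _ _ (by simp)]
      exact cmpCell_congr (one_comp _) (hD.isWeak.lam_lamInv _) _ _
    -- After composition with `1|λ` the triangle replaces `κ ; (1|λ)` by `ρ|1`. Both sides are then
    -- identities, again by `λ = ρ` at the unit.
    refine cancel_right inv ?_
    rw [comp_assoc, hD.isWeak.triangle _ _ (by simp) (by simp), cmpCell_comp_cmpCell,
      cmpCell_comp_cmpCell]
    exact cmpCell_congr (by rw [← lam_unit, hD.isWeak.lamInv_lam, one_comp])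
      (by rw [hD.isWeak.lamInv_lam, one_comp]) _ _

namespace IsComonoid

variable {X : O} {c : D.Arr X X} {ε : D.Cell c (D.unit X)} {δ : D.Cell c (D.cmp c c)}

/-- The left unit law of convolution. Factoring the composite as `(ε|1) ; (unitCell f | φ)` lets `λ`
slide past the second factor by naturality, and the counit law disposes of the rest. -/
theorem comul_comp_lam (hc : IsComonoid ε δ) {h : D.Arr A B} (f : X ⟶ A) (φ : D.Cell c h)
    (e : _) : (δ ⋄ D.cmpCell (ε ⋄ D.unitCell f) φ e) ⋄ D.lam h = φ := by
  -- Since `ε` is special, the matching condition leaves no choice for `f`.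
  obtain rfl : f = D.src φ := by simpa [hc.tgt_counit] using e
  have e₁ : D.cmpCell (ε ⋄ D.unitCell (D.src φ)) φ e =
      D.cmpCell ε (D.one c) (by simp [hc.tgt_counit]) ⋄
        D.cmpCell (D.unitCell (D.src φ)) φ (by simp) := by
    rw [cmpCell_comp_cmpCell]
    exact cmpCell_congr rfl (one_comp _).symm _ _
  rw [e₁, comp_assoc, comp_assoc, hD.isWeak.lam_nat]
  simpa using congrArg (· ⋄ φ) (hc.counit_left (by simp [hc.tgt_counit]))

theorem comul_comp_rho (hc : IsComonoid ε δ) {h : D.Arr A B} (φ : D.Cell c h) (f : X ⟶ B)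
    (e : _) : (δ ⋄ D.cmpCell φ (ε ⋄ D.unitCell f) e) ⋄ D.rho h = φ := by
  obtain rfl : D.tgt φ = f := by simpa [hc.src_counit] using e
  have e₁ : D.cmpCell φ (ε ⋄ D.unitCell (D.tgt φ)) e =
      D.cmpCell (D.one c) ε (by simp [hc.src_counit]) ⋄
        D.cmpCell φ (D.unitCell (D.tgt φ)) (by simp) := by
    rw [cmpCell_comp_cmpCell]
    exact cmpCell_congr (one_comp _).symm rfl _ _
  rw [e₁, comp_assoc, comp_assoc, hD.isWeak.rho_nat]
  simpa using congrArg (· ⋄ φ) (hc.counit_right (by simp [hc.src_counit]))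

/-- Associativity of convolution: the inner `δ` is split off on each side as `δ|1` or `1|δ`, then
`κ` is moved across by naturality to meet coassociativity. -/
theorem comul_comp_assoc (hc : IsComonoid ε δ) {h : D.Arr A B} {k : D.Arr B C} {l : D.Arr C E}
    (φ : D.Cell c h) (ψ : D.Cell c k) (θ : D.Cell c l) (e₁ e₂ e₃ e₄ : _) :
    (δ ⋄ D.cmpCell (δ ⋄ D.cmpCell φ ψ e₁) θ e₂) ⋄ D.assoc h k l =
      δ ⋄ D.cmpCell φ (δ ⋄ D.cmpCell ψ θ e₃) e₄ := by
  have e₅ : D.cmpCell (δ ⋄ D.cmpCell φ ψ e₁) θ e₂ =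
      D.cmpCell δ (D.one c) (by simp [hc.tgt_comul]) ⋄
        D.cmpCell (D.cmpCell φ ψ e₁) θ (by simp [e₃]) := by
    rw [cmpCell_comp_cmpCell]
    exact cmpCell_congr rfl (one_comp _).symm _ _
  have e₆ : D.cmpCell φ (δ ⋄ D.cmpCell ψ θ e₃) e₄ =
      D.cmpCell (D.one c) δ (by simp [hc.src_comul]) ⋄
        D.cmpCell φ (D.cmpCell ψ θ e₃) (by simp [e₁]) := by
    rw [cmpCell_comp_cmpCell]
    exact cmpCell_congr (one_comp _).symm rfl _ _
  rw [e₅, e₆, comp_assoc, comp_assoc, hD.isWeak.assoc_nat φ ψ θ e₁ e₃ _ (by simp [e₁])]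
  simpa using congrArg (· ⋄ D.cmpCell φ (D.cmpCell ψ θ e₃) (by simp [e₁]))
    (hc.coassoc (by simp [hc.tgt_comul]) (by simp [hc.src_comul]))

end IsComonoid

/-- The unit laws for the comonoid on a weak unit, with the identity counit removed so that they
match the laxity of `homLax`. -/
theorem lamInv_comp_cmpCell_comp_lam {X : O} {h : D.Arr A B} (f : X ⟶ A)
    (φ : D.Cell (D.unit X) h) (e : _) :
    (D.lamInv (D.unit X) ⋄ D.cmpCell (D.unitCell f) φ e) ⋄ D.lam h = φ := by
  simpa only [one_comp] using (isComonoid_unit X).comul_comp_lam f φ (by simpa using e)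

theorem lamInv_comp_cmpCell_comp_rho {X : O} {h : D.Arr A B} (φ : D.Cell (D.unit X) h)
    (f : X ⟶ B) (e : _) :
    (D.lamInv (D.unit X) ⋄ D.cmpCell φ (D.unitCell f) e) ⋄ D.rho h = φ := by
  simpa only [one_comp] using (isComonoid_unit X).comul_comp_rho φ f (by simpa using e)

/-! ### The hom functor of a weak double category is lax -/

theorem homBase_map_eq_id (X : O) {f : A ⟶ A} (e : f = 𝟙 A) : (homBase X).map f = 𝟙 _ := by
  rw [e, (homBase X).map_id]

theorem homBase_map_eq_comp (X : O) {f : A ⟶ B} {g : B ⟶ C} {k : A ⟶ C} (e : k = f ≫ g) :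
    (homBase X).map k = (homBase X).map f ≫ (homBase X).map g := by
  rw [e, (homBase X).map_comp]

/-- The laxity is convolution for the comonoid on the weak unit, so the coherence laws hold
elementwise by the convolution laws. The two outer functions of each span morphism only involve
postcomposition with known faces. -/
theorem homLax_isLax (X : O) : (homLax hD.isWeak X).IsLax where
  src_cell _ := rfl
  tgt_cell _ := rfl
  cell_one h := SetSpan.Hom.ext (homBase_map_eq_id X (src_one h)) (homBase_map_eq_id X (tgt_one h))
    (funext fun φ => comp_one φ)
  cell_comp φ ψ := SetSpan.Hom.ext (homBase_map_eq_comp X (src_comp φ ψ))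
    (homBase_map_eq_comp X (tgt_comp φ ψ)) (funext fun θ => (comp_assoc θ φ ψ).symm)
  src_unitLax _ := rfl
  tgt_unitLax _ := rfl
  src_cmpLax _ _ := rfl
  tgt_cmpLax _ _ := rfl
  unitLax_nat f := SetSpan.Hom.ext (congrArg (homBase X).map (src_unitCell f).symm)
    (congrArg (homBase X).map (tgt_unitCell f).symm)
    (funext fun g => hD.isWeak.unitCell_comp g f)
  cmpLax_nat φ ψ e e' := SetSpan.Hom.ext (congrArg (homBase X).map (src_cmpCell φ ψ e).symm)
    (congrArg (homBase X).map (tgt_cmpCell φ ψ e).symm) (funext fun p => by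
      refine Eq.trans ?_ (comp_assoc _ _ _).symm
      exact congrArg _ (cmpCell_comp_cmpCell _ _ _ _ p.2 e).symm)
  lax_lam h e := SetSpan.Hom.ext (homBase_map_eq_id X (src_lam h))
    (homBase_map_eq_id X (tgt_lam h))
    (funext fun p => lamInv_comp_cmpCell_comp_lam p.1.1 p.1.2 _)
  lax_rho h e := SetSpan.Hom.ext (homBase_map_eq_id X (src_rho h))
    (homBase_map_eq_id X (tgt_rho h))
    (funext fun p => lamInv_comp_cmpCell_comp_rho p.1.1 p.1.2 _)
  lax_assoc h k l e₁ e₂ := SetSpan.Hom.ext (homBase_map_eq_id X (src_assoc h k l))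
    (homBase_map_eq_id X (tgt_assoc h k l))
    (funext fun p => (isComonoid_unit X).comul_comp_assoc p.1.1.1.1 p.1.1.1.2 p.1.2 _ _ _ _)

end weak

/-- Weak arrows and double cells form a category. -/
abbrev totCategory {O : Type u} [CategoryStruct.{v} O] {D : DoubleData.{v, w} O} (hD : D.IsWeak) :
    Category D.Tot where
  toCategoryStruct := D.totCat
  id_comp φ := hD.one_comp φ
  comp_id φ := hD.comp_one φ
  assoc φ ψ θ := hD.comp_assoc φ ψ θ

end DoubleData

/-! ### The weak double categories of an intercategory -/

namespace Intercategory

variable {Obj : Type u} [Category.{v} Obj] (A : Intercategory.{v, w₁, w₂, w₃} Obj)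

instance : A.hor.Weak := ⟨A.hor_isWeak⟩

instance : A.ver.Weak := ⟨A.ver_isWeak⟩

/-- The results above ask for a genuine category of strict arrows. With horizontal and vertical
cells in that role they apply to `A.col` and `A.row`. -/
instance : Category A.hor.Tot := DoubleData.totCategory A.hor_isWeak

instance : Category A.ver.Tot := DoubleData.totCategory A.ver_isWeak

instance : A.row.Weak := ⟨A.row_isWeak⟩

instance : A.col.Weak := ⟨A.col_isWeak⟩

/-! ### The algebra of cubes -/

section cube

variable {P₀ Q₀ R₀ S₀ P₁ Q₁ R₁ S₁ P₂ Q₂ R₂ S₂ P₃ Q₃ R₃ S₃ : Obj}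
  {h₀ : A.hor.Arr P₀ Q₀} {v₀ : A.ver.Arr P₀ R₀} {w₀ : A.ver.Arr Q₀ S₀} {k₀ : A.hor.Arr R₀ S₀}
  {h₁ : A.hor.Arr P₁ Q₁} {v₁ : A.ver.Arr P₁ R₁} {w₁ : A.ver.Arr Q₁ S₁} {k₁ : A.hor.Arr R₁ S₁}
  {h₂ : A.hor.Arr P₂ Q₂} {v₂ : A.ver.Arr P₂ R₂} {w₂ : A.ver.Arr Q₂ S₂} {k₂ : A.hor.Arr R₂ S₂}
  {h₃ : A.hor.Arr P₃ Q₃} {v₃ : A.ver.Arr P₃ R₃} {w₃ : A.ver.Arr Q₃ S₃} {k₃ : A.hor.Arr R₃ S₃}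
  {α : A.Basic h₀ v₀ w₀ k₀} {β : A.Basic h₁ v₁ w₁ k₁} {γ : A.Basic h₂ v₂ w₂ k₂}
  {ε : A.Basic h₃ v₃ w₃ k₃}

/-- Here and below, laws of `A.col` and `A.row` are restated for bare cubes. The bundled arrows are
given explicitly because they cannot be inferred from their components. -/
theorem ccomp_assoc (a : A.Cube α β) (b : A.Cube β γ) (c : A.Cube γ ε) :
    (a ⬦ b) ⬦ c = a ⬦ b ⬦ c :=
  A.col_isWeak.comp_assoc (A := ⟨P₀, Q₀, h₀⟩) (B := ⟨R₀, S₀, k₀⟩) (A' := ⟨P₁, Q₁, h₁⟩)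
    (B' := ⟨R₁, S₁, k₁⟩) (A'' := ⟨P₂, Q₂, h₂⟩) (B'' := ⟨R₂, S₂, k₂⟩) (A₃ := ⟨P₃, Q₃, h₃⟩)
    (B₃ := ⟨R₃, S₃, k₃⟩) (h := ⟨v₀, w₀, α⟩) (k := ⟨v₁, w₁, β⟩) (l := ⟨v₂, w₂, γ⟩)
    (m := ⟨v₃, w₃, ε⟩) a b c

theorem cone_ccomp (a : A.Cube α β) : A.cone α ⬦ a = a :=
  A.col_isWeak.one_comp (A := ⟨P₀, Q₀, h₀⟩) (B := ⟨R₀, S₀, k₀⟩) (A' := ⟨P₁, Q₁, h₁⟩)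
    (B' := ⟨R₁, S₁, k₁⟩) (h := ⟨v₀, w₀, α⟩) (k := ⟨v₁, w₁, β⟩) a

theorem ccomp_cone (a : A.Cube α β) : a ⬦ A.cone β = a :=
  A.col_isWeak.comp_one (A := ⟨P₀, Q₀, h₀⟩) (B := ⟨R₀, S₀, k₀⟩) (A' := ⟨P₁, Q₁, h₁⟩)
    (B' := ⟨R₁, S₁, k₁⟩) (h := ⟨v₀, w₀, α⟩) (k := ⟨v₁, w₁, β⟩) a

theorem ccomp_cancel_right {a b : A.Cube α β} {i : A.Cube β γ} {j : A.Cube γ β}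
    (hj : i ⬦ j = A.cone β) (e : a ⬦ i = b ⬦ i) : a = b := by
  rw [← ccomp_cone A a, ← hj, ← ccomp_assoc, e, ccomp_assoc, hj, ccomp_cone]

theorem top_cone (α : A.Basic h₀ v₀ w₀ k₀) : A.top (A.cone α) = A.hor.one h₀ :=
  A.col_isWeak.src_one (A := ⟨P₀, Q₀, h₀⟩) (B := ⟨R₀, S₀, k₀⟩) ⟨v₀, w₀, α⟩

theorem bot_cone (α : A.Basic h₀ v₀ w₀ k₀) : A.bot (A.cone α) = A.hor.one k₀ :=
  A.col_isWeak.tgt_one (A := ⟨P₀, Q₀, h₀⟩) (B := ⟨R₀, S₀, k₀⟩) ⟨v₀, w₀, α⟩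

theorem left_cone (α : A.Basic h₀ v₀ w₀ k₀) : A.left (A.cone α) = A.ver.one v₀ :=
  A.row_isWeak.src_one (A := ⟨P₀, R₀, v₀⟩) (B := ⟨Q₀, S₀, w₀⟩) ⟨h₀, k₀, α⟩

theorem right_cone (α : A.Basic h₀ v₀ w₀ k₀) : A.right (A.cone α) = A.ver.one w₀ :=
  A.row_isWeak.tgt_one (A := ⟨P₀, R₀, v₀⟩) (B := ⟨Q₀, S₀, w₀⟩) ⟨h₀, k₀, α⟩

theorem vlam_vlamInv (α : A.Basic h₀ v₀ w₀ k₀) : A.vlam α ⬦ A.vlamInv α = A.cone _ :=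
  A.col_isWeak.lam_lamInv (A := ⟨P₀, Q₀, h₀⟩) (B := ⟨R₀, S₀, k₀⟩) ⟨v₀, w₀, α⟩

theorem vlam_nat (a : A.Cube α β) (e : _) :
    A.vcmpCell (A.vunitCell (A.top a)) a e ⬦ A.vlam β = A.vlam α ⬦ a :=
  A.col_isWeak.lam_nat (A := ⟨P₀, Q₀, h₀⟩) (B := ⟨R₀, S₀, k₀⟩) (A' := ⟨P₁, Q₁, h₁⟩)
    (B' := ⟨R₁, S₁, k₁⟩) (h := ⟨v₀, w₀, α⟩) (k := ⟨v₁, w₁, β⟩) a e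

/-- Conjugation by the vertical `λ`, that is, its naturality. The top face is a variable `φ`, so
that the lemma can be used when this face has already been rewritten, as for `τ` and the
comultiplication of `U`. -/
theorem vlamInv_ccomp_vcmpCell_ccomp_vlam (a : A.Cube α β) {φ : A.hor.Cell h₀ h₁}
    (hφ : A.top a = φ) (e : _) :
    A.vlamInv α ⬦ A.vcmpCell (A.vunitCell φ) a e ⬦ A.vlam β = a := by
  subst hφ
  rw [vlam_nat, ← ccomp_assoc, vlamInv_vlam, cone_ccomp]

theorem vunitCell_one (h : A.hor.Arr P₀ Q₀) : A.vunitCell (A.hor.one h) = A.cone (A.vunit h) :=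
  A.col_isWeak.unitCell_id ⟨P₀, Q₀, h⟩

theorem vunitCell_comp (φ : A.hor.Cell h₀ h₁) (ψ : A.hor.Cell h₁ h₂) :
    A.vunitCell (φ ⋄ ψ) = A.vunitCell φ ⬦ A.vunitCell ψ :=
  A.col_isWeak.unitCell_comp (A := ⟨P₀, Q₀, h₀⟩) (A' := ⟨P₁, Q₁, h₁⟩) (A'' := ⟨P₂, Q₂, h₂⟩) φ ψ

theorem hunitCell_one (v : A.ver.Arr P₀ R₀) : A.hunitCell (A.ver.one v) = A.cone (A.hunit v) :=
  A.row_isWeak.unitCell_id ⟨P₀, R₀, v⟩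

theorem hunitCell_comp (φ : A.ver.Cell v₀ v₁) (ψ : A.ver.Cell v₁ v₂) :
    A.hunitCell (φ ⋄ ψ) = A.hunitCell φ ⬦ A.hunitCell ψ :=
  A.row_isWeak.unitCell_comp (A := ⟨P₀, R₀, v₀⟩) (A' := ⟨P₁, R₁, v₁⟩) (A'' := ⟨P₂, R₂, v₂⟩) φ ψ

end cube

/-! ### Functoriality of the horizontal and vertical composition of cubes -/

section composites

variable {P₀ P₁ P₂ Q₀ Q₁ Q₂ R₀ R₁ R₂ S₀ S₁ S₂ T₀ T₁ T₂ U₀ U₁ U₂ : Obj}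

theorem hcmpCell_ccomp {h₀ : A.hor.Arr P₀ Q₀} {h₀' : A.hor.Arr Q₀ R₀} {k₀ : A.hor.Arr S₀ T₀}
    {k₀' : A.hor.Arr T₀ U₀} {x₀ : A.ver.Arr P₀ S₀} {y₀ : A.ver.Arr Q₀ T₀} {z₀ : A.ver.Arr R₀ U₀}
    {h₁ : A.hor.Arr P₁ Q₁} {h₁' : A.hor.Arr Q₁ R₁} {k₁ : A.hor.Arr S₁ T₁}
    {k₁' : A.hor.Arr T₁ U₁} {x₁ : A.ver.Arr P₁ S₁} {y₁ : A.ver.Arr Q₁ T₁} {z₁ : A.ver.Arr R₁ U₁}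
    {h₂ : A.hor.Arr P₂ Q₂} {h₂' : A.hor.Arr Q₂ R₂} {k₂ : A.hor.Arr S₂ T₂}
    {k₂' : A.hor.Arr T₂ U₂} {x₂ : A.ver.Arr P₂ S₂} {y₂ : A.ver.Arr Q₂ T₂} {z₂ : A.ver.Arr R₂ U₂}
    {α₀ : A.Basic h₀ x₀ y₀ k₀} {β₀ : A.Basic h₀' y₀ z₀ k₀'} {α₁ : A.Basic h₁ x₁ y₁ k₁}
    {β₁ : A.Basic h₁' y₁ z₁ k₁'} {α₂ : A.Basic h₂ x₂ y₂ k₂} {β₂ : A.Basic h₂' y₂ z₂ k₂'}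
    (a : A.Cube α₀ α₁) (a' : A.Cube α₁ α₂) (b : A.Cube β₀ β₁) (b' : A.Cube β₁ β₂)
    (e₁ : A.right a = A.left b) (e₂ : A.right a' = A.left b') (e : _) :
    A.hcmpCell (a ⬦ a') (b ⬦ b') e = A.hcmpCell a b e₁ ⬦ A.hcmpCell a' b' e₂ :=
  A.row_isWeak.cmpCell_comp (A := ⟨_, _, x₀⟩) (B := ⟨_, _, y₀⟩) (C := ⟨_, _, z₀⟩)
    (A' := ⟨_, _, x₁⟩) (B' := ⟨_, _, y₁⟩) (C' := ⟨_, _, z₁⟩) (A'' := ⟨_, _, x₂⟩)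
    (B'' := ⟨_, _, y₂⟩) (C'' := ⟨_, _, z₂⟩) (h := ⟨_, _, α₀⟩) (h' := ⟨_, _, β₀⟩)
    (k := ⟨_, _, α₁⟩) (k' := ⟨_, _, β₁⟩) (l := ⟨_, _, α₂⟩) (l' := ⟨_, _, β₂⟩) a a' b b' e₁ e₂ e

theorem vcmpCell_ccomp {h₀ : A.hor.Arr P₀ S₀} {k₀ : A.hor.Arr Q₀ T₀} {l₀ : A.hor.Arr R₀ U₀}
    {v₀ : A.ver.Arr P₀ Q₀} {v₀' : A.ver.Arr Q₀ R₀} {w₀ : A.ver.Arr S₀ T₀} {w₀' : A.ver.Arr T₀ U₀}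
    {h₁ : A.hor.Arr P₁ S₁} {k₁ : A.hor.Arr Q₁ T₁} {l₁ : A.hor.Arr R₁ U₁}
    {v₁ : A.ver.Arr P₁ Q₁} {v₁' : A.ver.Arr Q₁ R₁} {w₁ : A.ver.Arr S₁ T₁} {w₁' : A.ver.Arr T₁ U₁}
    {h₂ : A.hor.Arr P₂ S₂} {k₂ : A.hor.Arr Q₂ T₂} {l₂ : A.hor.Arr R₂ U₂}
    {v₂ : A.ver.Arr P₂ Q₂} {v₂' : A.ver.Arr Q₂ R₂} {w₂ : A.ver.Arr S₂ T₂} {w₂' : A.ver.Arr T₂ U₂}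
    {α₀ : A.Basic h₀ v₀ w₀ k₀} {β₀ : A.Basic k₀ v₀' w₀' l₀} {α₁ : A.Basic h₁ v₁ w₁ k₁}
    {β₁ : A.Basic k₁ v₁' w₁' l₁} {α₂ : A.Basic h₂ v₂ w₂ k₂} {β₂ : A.Basic k₂ v₂' w₂' l₂}
    (a : A.Cube α₀ α₁) (a' : A.Cube α₁ α₂) (b : A.Cube β₀ β₁) (b' : A.Cube β₁ β₂)
    (e₁ : A.bot a = A.top b) (e₂ : A.bot a' = A.top b') (e : _) :
    A.vcmpCell (a ⬦ a') (b ⬦ b') e = A.vcmpCell a b e₁ ⬦ A.vcmpCell a' b' e₂ :=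
  A.col_isWeak.cmpCell_comp (A := ⟨_, _, h₀⟩) (B := ⟨_, _, k₀⟩) (C := ⟨_, _, l₀⟩)
    (A' := ⟨_, _, h₁⟩) (B' := ⟨_, _, k₁⟩) (C' := ⟨_, _, l₁⟩) (A'' := ⟨_, _, h₂⟩)
    (B'' := ⟨_, _, k₂⟩) (C'' := ⟨_, _, l₂⟩) (h := ⟨_, _, α₀⟩) (h' := ⟨_, _, β₀⟩)
    (k := ⟨_, _, α₁⟩) (k' := ⟨_, _, β₁⟩) (l := ⟨_, _, α₂⟩) (l' := ⟨_, _, β₂⟩) a a' b b' e₁ e₂ e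

theorem hcmpCell_congr {h₀ : A.hor.Arr P₀ Q₀} {h₀' : A.hor.Arr Q₀ R₀} {k₀ : A.hor.Arr S₀ T₀}
    {k₀' : A.hor.Arr T₀ U₀} {x₀ : A.ver.Arr P₀ S₀} {y₀ : A.ver.Arr Q₀ T₀} {z₀ : A.ver.Arr R₀ U₀}
    {h₁ : A.hor.Arr P₁ Q₁} {h₁' : A.hor.Arr Q₁ R₁} {k₁ : A.hor.Arr S₁ T₁}
    {k₁' : A.hor.Arr T₁ U₁} {x₁ : A.ver.Arr P₁ S₁} {y₁ : A.ver.Arr Q₁ T₁} {z₁ : A.ver.Arr R₁ U₁}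
    {α₀ : A.Basic h₀ x₀ y₀ k₀} {β₀ : A.Basic h₀' y₀ z₀ k₀'} {α₁ : A.Basic h₁ x₁ y₁ k₁}
    {β₁ : A.Basic h₁' y₁ z₁ k₁'} {a a' : A.Cube α₀ α₁} {b b' : A.Cube β₀ β₁} (ha : a = a')
    (hb : b = b') (e : A.right a = A.left b) (e' : A.right a' = A.left b') :
    A.hcmpCell a b e = A.hcmpCell a' b' e' := by
  subst ha hb; rfl

theorem vcmpCell_congr {h₀ : A.hor.Arr P₀ S₀} {k₀ : A.hor.Arr Q₀ T₀} {l₀ : A.hor.Arr R₀ U₀}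
    {v₀ : A.ver.Arr P₀ Q₀} {v₀' : A.ver.Arr Q₀ R₀} {w₀ : A.ver.Arr S₀ T₀} {w₀' : A.ver.Arr T₀ U₀}
    {h₁ : A.hor.Arr P₁ S₁} {k₁ : A.hor.Arr Q₁ T₁} {l₁ : A.hor.Arr R₁ U₁}
    {v₁ : A.ver.Arr P₁ Q₁} {v₁' : A.ver.Arr Q₁ R₁} {w₁ : A.ver.Arr S₁ T₁} {w₁' : A.ver.Arr T₁ U₁}
    {α₀ : A.Basic h₀ v₀ w₀ k₀} {β₀ : A.Basic k₀ v₀' w₀' l₀} {α₁ : A.Basic h₁ v₁ w₁ k₁}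
    {β₁ : A.Basic k₁ v₁' w₁' l₁} {a a' : A.Cube α₀ α₁} {b b' : A.Cube β₀ β₁} (ha : a = a')
    (hb : b = b') (e : A.bot a = A.top b) (e' : A.bot a' = A.top b') :
    A.vcmpCell a b e = A.vcmpCell a' b' e' := by
  subst ha hb; rfl

theorem hcmpCell_cone {h : A.hor.Arr P₀ Q₀} {h' : A.hor.Arr Q₀ R₀} {k : A.hor.Arr S₀ T₀}
    {k' : A.hor.Arr T₀ U₀} {x : A.ver.Arr P₀ S₀} {y : A.ver.Arr Q₀ T₀} {z : A.ver.Arr R₀ U₀}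
    (α : A.Basic h x y k) (β : A.Basic h' y z k') (e : _) :
    A.hcmpCell (A.cone α) (A.cone β) e = A.cone (A.hcmp α β) :=
  A.row_isWeak.cmpCell_one (A := ⟨_, _, x⟩) (B := ⟨_, _, y⟩) (C := ⟨_, _, z⟩) ⟨_, _, α⟩
    ⟨_, _, β⟩ e

end composites

/-! ### The canonical comonoid of cubes at an object -/

section comonoid

variable (X : Obj)

/-- The comultiplication of `A.vunit (A.hor.unit X)` for horizontal composition. -/
def comul : A.Cube (A.vunit (A.hor.unit X))
    (A.hcmp (A.vunit (A.hor.unit X)) (A.vunit (A.hor.unit X))) :=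
  A.vunitCell (A.hor.lamInv (A.hor.unit X)) ⬦ A.delta (A.hor.unit X) (A.hor.unit X)

/-- A change of bracketing that exhibits the horizontal laxity as convolution. -/
theorem homHcmp_eq {P Q R P' Q' R' X : Obj} {h : A.hor.Arr P Q} {h' : A.hor.Arr Q R}
    {v : A.ver.Arr P P'} {w : A.ver.Arr Q Q'} {x : A.ver.Arr R R'} {k : A.hor.Arr P' Q'}
    {k' : A.hor.Arr Q' R'} {α : A.Basic h v w k} {β : A.Basic h' w x k'}
    (c : A.Cube (A.vunit (A.hor.unit X)) α) (d : A.Cube (A.vunit (A.hor.unit X)) β)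
    (e : A.right c = A.left d) : A.homHcmp c d e = A.comul X ⬦ A.hcmpCell c d e :=
  (A.ccomp_assoc _ _ _).symm

theorem top_comul : A.top (A.comul X) = A.hor.lamInv (A.hor.unit X) := by
  rw [comul, top_ccomp, top_vunitCell, (A.interchange.delta_special _ _).top,
    A.hor_isWeak.comp_one]

theorem bot_comul : A.bot (A.comul X) = A.hor.lamInv (A.hor.unit X) := by
  rw [comul, bot_ccomp, bot_vunitCell, (A.interchange.delta_special _ _).bot,
    A.hor_isWeak.comp_one]

theorem left_comul : A.left (A.comul X) = A.ver.one (A.ver.unit X) := by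
  rw [comul, left_ccomp, A.faces.left_vunitCell, A.hor_isWeak.src_lamInv,
    (A.interchange.delta_special _ _).left, A.ver_isWeak.comp_one, A.ver_isWeak.unitCell_id]

theorem right_comul : A.right (A.comul X) = A.ver.one (A.ver.unit X) := by
  rw [comul, right_ccomp, A.faces.right_vunitCell, A.hor_isWeak.tgt_lamInv,
    (A.interchange.delta_special _ _).right, A.ver_isWeak.comp_one, A.ver_isWeak.unitCell_id]

/-- Naturality of `δ` pulls the inner `λ⁻¹` to the front. One side of coassociativity is thereby
separated into a purely horizontal part under `Id` and an iterated `δ`. -/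
theorem comul_ccomp_hcmpCell_comul_cone (e₁ : _) (e₂ : _) (e₃ : _) :
    A.comul X ⬦ A.hcmpCell (A.comul X) (A.cone (A.vunit (A.hor.unit X))) e₁ =
      A.vunitCell (A.hor.lamInv (A.hor.unit X) ⋄
          A.hor.cmpCell (A.hor.lamInv (A.hor.unit X)) (A.hor.one (A.hor.unit X)) e₂) ⬦
        A.delta _ _ ⬦ A.hcmpCell (A.delta _ _) (A.cone (A.vunit (A.hor.unit X))) e₃ := by
  have e₄ : A.right (A.vunitCell (A.hor.lamInv (A.hor.unit X))) =
      A.left (A.vunitCell (A.hor.one (A.hor.unit X))) := by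
    simp [A.faces.left_vunitCell, A.faces.right_vunitCell]
  -- Naturality of `δ` at the pair `(λ⁻¹, 1)`.
  rw [vunitCell_comp, ccomp_assoc, ← A.ccomp_assoc _ (A.delta _ _),
    A.interchange.delta_nat _ _ _ e₄, ccomp_assoc, ← A.hcmpCell_ccomp _ _ _ _ _ _
    (by simp [right_ccomp, left_ccomp, e₃, e₄])]
  refine (A.ccomp_assoc _ _ _).trans ?_
  congr 2
  exact A.hcmpCell_congr rfl (by rw [vunitCell_one, cone_ccomp]) _ _

/-- The mirror image, for the other side of coassociativity: naturality of `δ` at the pair `(1,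
λ⁻¹)`. -/
theorem comul_ccomp_hcmpCell_cone_comul (e₁ : _) (e₂ : _) (e₃ : _) :
    A.comul X ⬦ A.hcmpCell (A.cone (A.vunit (A.hor.unit X))) (A.comul X) e₁ =
      A.vunitCell (A.hor.lamInv (A.hor.unit X) ⋄
          A.hor.cmpCell (A.hor.one (A.hor.unit X)) (A.hor.lamInv (A.hor.unit X)) e₂) ⬦
        A.delta _ _ ⬦ A.hcmpCell (A.cone (A.vunit (A.hor.unit X))) (A.delta _ _) e₃ := by
  have e₄ : A.right (A.vunitCell (A.hor.one (A.hor.unit X))) =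
      A.left (A.vunitCell (A.hor.lamInv (A.hor.unit X))) := by
    simp [A.faces.left_vunitCell, A.faces.right_vunitCell]
  rw [vunitCell_comp, ccomp_assoc, ← A.ccomp_assoc _ (A.delta _ _),
    A.interchange.delta_nat _ _ _ e₄, ccomp_assoc, ← A.hcmpCell_ccomp _ _ _ _ _ _
    (by simp [right_ccomp, left_ccomp, e₃, e₄])]
  refine (A.ccomp_assoc _ _ _).trans ?_
  congr 2
  exact A.hcmpCell_congr (by rw [vunitCell_one, cone_ccomp]) rfl _ _

/-- The vertical identity of the horizontal identity of `X`, as a weak endoarrow of `A.row`. -/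
abbrev rowUnit : A.row.Arr (⟨X, X, A.ver.unit X⟩ : A.ver.Tot) ⟨X, X, A.ver.unit X⟩ :=
  ⟨A.hor.unit X, A.hor.unit X, A.vunit (A.hor.unit X)⟩

/-- Each law is a compatibility of `δ` and `τ` with a horizontal structural cell (`delta_hlam`,
`delta_hrho`, `delta_hassoc`). It reduces the law to `Id` applied to the corresponding comonoid law
of `id_X` in `A.hor`. -/
theorem isComonoid_rowUnit : DoubleData.IsComonoid (D := A.row) (c := A.rowUnit X) (A.tau X)
    (A.comul X) where
  src_counit := (A.interchange.tau_special X).left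
  tgt_counit := (A.interchange.tau_special X).right
  src_comul := A.left_comul X
  tgt_comul := A.right_comul X
  counit_left e := by
    refine (A.ccomp_assoc _ _ _).trans ((congrArg _ (A.interchange.delta_hlam _ e)).trans ?_)
    rw [← vunitCell_comp, A.hor_isWeak.lamInv_lam, vunitCell_one]
    rfl
  counit_right e := by
    refine (A.ccomp_assoc _ _ _).trans ((congrArg _ (A.interchange.delta_hrho _ e)).trans ?_)
    -- The compatibility produces `ρ` at `id_X`, whereas the comultiplication was built from `λ⁻¹`.
    rw [← vunitCell_comp, ← DoubleData.lam_unit, A.hor_isWeak.lamInv_lam, vunitCell_one]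
    rfl
  coassoc e₁ e₂ := by
    have e₃ : A.right (A.delta (A.hor.unit X) (A.hor.unit X)) =
        A.left (A.cone (A.vunit (A.hor.unit X))) := by
      rw [(A.interchange.delta_special _ _).right, left_cone]
    have e₄ : A.right (A.cone (A.vunit (A.hor.unit X))) =
        A.left (A.delta (A.hor.unit X) (A.hor.unit X)) := by
      rw [(A.interchange.delta_special _ _).left, right_cone]
    refine (A.ccomp_assoc _ _ _).symm.trans (Eq.trans ?_
      (A.comul_ccomp_hcmpCell_cone_comul X e₂ (by simp) e₄).symm)
    refine (congrArg (fun t => t ⬦ A.hassoc _ _ _)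
      (A.comul_ccomp_hcmpCell_comul_cone X e₁ (by simp) e₃)).trans ?_
    simp only [ccomp_assoc]
    rw [A.interchange.delta_hassoc _ _ _ e₃ e₄, ← ccomp_assoc, ← vunitCell_comp,
      A.hor_isWeak.comp_assoc, (DoubleData.isComonoid_unit X).coassoc _ (by simp)]

/-! ### Counit and comultiplication against the vertical comultiplication -/

/-- The case of the `μ` condition to which all others reduce: `τ` respects the vertical
comultiplications of `Id_{id_X}` and `id_{Id_X}`. After cancelling the invertible `id_λ` it is the
unit law `mu_lam` together with naturality of the vertical `λ` at `τ`. -/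
theorem vlamInv_ccomp_vcmpCell_tau_ccomp_mu (e : _) :
    A.vlamInv (A.vunit (A.hor.unit X)) ⬦ A.vcmpCell (A.tau X) (A.tau X) e ⬦
        A.mu (A.ver.unit X) (A.ver.unit X) =
      A.tau X ⬦ A.hunitCell (A.ver.lamInv (A.ver.unit X)) := by
  have inv : A.hunitCell (A.ver.lam (A.ver.unit X)) ⬦
      A.hunitCell (A.ver.lamInv (A.ver.unit X)) = A.cone _ := by
    rw [← hunitCell_comp, A.ver_isWeak.lam_lamInv, hunitCell_one]
  refine A.ccomp_cancel_right inv ?_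
  have top := (A.interchange.tau_special X).top
  have bot := (A.interchange.tau_special X).bot
  rw [ccomp_assoc _ (A.tau X), ← hunitCell_comp, A.ver_isWeak.lamInv_lam, hunitCell_one,
    ccomp_cone, ccomp_assoc, ccomp_assoc,
    -- The vertical composite of `τ` with `τ` is split as `1` over `τ`, then `τ` over `1`; the
    -- second piece is the one that occurs in `mu_lam`.
    A.vcmpCell_congr (A.cone_ccomp _).symm (A.ccomp_cone _).symm _
      (by simp [bot_ccomp, top_ccomp, top_cone, bot_cone, top, bot]),
    A.vcmpCell_ccomp _ _ _ _ (by rw [bot_cone, top]) (by rw [bot, top_cone]), ccomp_assoc,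
    A.interchange.mu_lam, A.vcmpCell_congr (A.vunitCell_one _).symm rfl _
      (by rw [bot_vunitCell, top]), vlamInv_ccomp_vcmpCell_ccomp_vlam _ _ top]

/-- The corresponding universal case for `χ`. After cancelling `λ⁻¹|λ⁻¹`, the unit law `chi_vlam`
turns `δ` over `1`, followed by `χ` and `λ|λ`, into a single vertical `λ`; its naturality at the
comultiplication finishes. -/
theorem vlamInv_ccomp_vcmpCell_comul_ccomp_chi (e e' : _) :
    A.vlamInv (A.vunit (A.hor.unit X)) ⬦ A.vcmpCell (A.comul X) (A.comul X) e ⬦ A.chi _ _ _ _ =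
      A.comul X ⬦ A.hcmpCell (A.vlamInv (A.vunit (A.hor.unit X)))
        (A.vlamInv (A.vunit (A.hor.unit X))) e' := by
  have e₁ : A.right (A.vlam (A.vunit (A.hor.unit X))) =
      A.left (A.vlam (A.vunit (A.hor.unit X))) := by
    rw [A.faces.left_vlam, A.faces.right_vlam]
  have inv : A.hcmpCell (A.vlam (A.vunit (A.hor.unit X))) (A.vlam (A.vunit (A.hor.unit X))) e₁ ⬦
      A.hcmpCell (A.vlamInv (A.vunit (A.hor.unit X))) (A.vlamInv (A.vunit (A.hor.unit X))) e' =
      A.cone _ := by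
    rw [← A.hcmpCell_ccomp _ _ _ _ _ _ (by rw [vlam_vlamInv, left_cone, right_cone]),
      A.hcmpCell_congr (A.vlam_vlamInv _) (A.vlam_vlamInv _) _ (by rw [left_cone, right_cone]),
      hcmpCell_cone]
  refine A.ccomp_cancel_right inv ?_
  rw [ccomp_assoc _ (A.comul X), ← A.hcmpCell_ccomp _ _ _ _ _ _
      (by rw [vlamInv_vlam, left_cone, right_cone]),
    A.hcmpCell_congr (A.vlamInv_vlam _) (A.vlamInv_vlam _) _ (by rw [left_cone, right_cone]),
    hcmpCell_cone, ccomp_cone, ccomp_assoc, ccomp_assoc,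
    A.vcmpCell_congr rfl (A.ccomp_cone _).symm _ (by rw [ccomp_cone, e])]
  have e₂ : A.bot (A.vunitCell (A.hor.lamInv (A.hor.unit X))) = A.top (A.comul X) := by
    rw [bot_vunitCell, top_comul]
  have e₃ : A.bot (A.delta (A.hor.unit X) (A.hor.unit X)) = A.top (A.cone
      (A.hcmp (A.vunit (A.hor.unit X)) (A.vunit (A.hor.unit X)))) := by
    rw [(A.interchange.delta_special _ _).bot, top_cone]
  -- Only the upper comultiplication is split, as `Id_{λ⁻¹}` followed by `δ`. The lower one stays
  -- whole, and its top face `λ⁻¹` matches the `Id_{λ⁻¹}` above it.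
  refine Eq.trans (congrArg (fun t => A.vlamInv _ ⬦ t ⬦ _)
    (A.vcmpCell_ccomp (A.vunitCell _) (A.delta _ _) _ _ e₂ e₃ _)) ?_
  rw [ccomp_assoc, A.interchange.chi_vlam, vlamInv_ccomp_vcmpCell_ccomp_vlam _ _ (A.top_comul X)]

/-- Associativity of convolution for the comonoid `U` in `A.row`. The work is in unfolding the inner
composites inside `hcmpCell`, where the matching proofs have to be transported. -/
theorem homHcmp_ccomp_hassoc {P Q R S P' Q' R' S' X : Obj} {h : A.hor.Arr P Q}
    {h' : A.hor.Arr Q R} {h'' : A.hor.Arr R S} {v : A.ver.Arr P P'} {w : A.ver.Arr Q Q'}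
    {x : A.ver.Arr R R'} {y : A.ver.Arr S S'} {k : A.hor.Arr P' Q'} {k' : A.hor.Arr Q' R'}
    {k'' : A.hor.Arr R' S'} {α : A.Basic h v w k} {β : A.Basic h' w x k'}
    {γ : A.Basic h'' x y k''} (a : A.Cube (A.vunit (A.hor.unit X)) α)
    (b : A.Cube (A.vunit (A.hor.unit X)) β) (c : A.Cube (A.vunit (A.hor.unit X)) γ)
    (e₁ e₂ e₃ e₄ : _) :
    A.homHcmp (A.homHcmp a b e₁) c e₂ ⬦ A.hassoc α β γ = A.homHcmp a (A.homHcmp b c e₃) e₄ := by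
  have e₅ := A.homHcmp_eq a b e₁
  have e₆ := A.homHcmp_eq b c e₃
  refine (congrArg (fun t => t ⬦ A.hassoc α β γ) ((A.homHcmp_eq _ c e₂).trans
    (congrArg _ (A.hcmpCell_congr e₅ rfl _ (e₅ ▸ e₂))))).trans (Eq.trans ?_
    ((A.homHcmp_eq a _ e₄).trans (congrArg _ (A.hcmpCell_congr rfl e₆ _ (e₆ ▸ e₄)))).symm)
  exact (A.isComonoid_rowUnit X).comul_comp_assoc
    (h := (⟨h, k, α⟩ : A.RowArr ⟨P, P', v⟩ ⟨Q, Q', w⟩))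
    (k := (⟨h', k', β⟩ : A.RowArr ⟨Q, Q', w⟩ ⟨R, R', x⟩))
    (l := (⟨h'', k'', γ⟩ : A.RowArr ⟨R, R', x⟩ ⟨S, S', y⟩)) a b c e₁ _ e₃ _

end comonoid

end Intercategory

/-! ### The hom functor is lax-lax -/

/-- Used for the faces of special and structural cubes, which equal the identity cell only
propositionally. -/
theorem DoubleData.homLax_cell_eq_one {O : Type u} [Category.{v} O] {D : DoubleData.{v, w} O}
    [hD : D.Weak] (X : O) {A B : O} {h : D.Arr A B} {φ : D.Cell h h} (e : φ = D.one h) :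
    (homLax hD.isWeak X).cell φ = spanSet.one _ := by
  rw [e]; exact (homLax_isLax X).cell_one h

namespace Intercategory

variable {Obj : Type u} [Category.{v} Obj] (A : Intercategory.{v, w₁, w₂, w₃} Obj) (X : Obj)

theorem homData_hor_isLax : (A.homData X).hor.IsLax := DoubleData.homLax_isLax X

theorem homData_ver_isLax : (A.homData X).ver.IsLax := DoubleData.homLax_isLax X

/-! ### The lax functor laws on basic cells -/

/-- On apexes the coherence laws are the convolution laws of `U` in `A.row`. On top and bottom faces
they are the laws for horizontal arrows, since the structural cubes have structural cells as faces;
the left and right faces are identities there. -/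
theorem homData_row_isLax : (A.homData X).row.IsLax where
  src_cell _ := rfl
  tgt_cell _ := rfl
  cell_one α := SetBasic.Hom.ext
    (DoubleData.homLax_cell_eq_one X (A.top_cone α.cell))
    (DoubleData.homLax_cell_eq_one X (A.left_cone α.cell))
    (DoubleData.homLax_cell_eq_one X (A.right_cone α.cell))
    (DoubleData.homLax_cell_eq_one X (A.bot_cone α.cell))
    (funext fun c => A.ccomp_cone c)
  cell_comp c d := SetBasic.Hom.ext
    ((congrArg (A.homData X).hor.cell (A.top_ccomp c d)).trans
      ((A.homData_hor_isLax X).cell_comp _ _))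
    ((congrArg (A.homData X).ver.cell (A.left_ccomp c d)).trans
      ((A.homData_ver_isLax X).cell_comp _ _))
    ((congrArg (A.homData X).ver.cell (A.right_ccomp c d)).trans
      ((A.homData_ver_isLax X).cell_comp _ _))
    ((congrArg (A.homData X).hor.cell (A.bot_ccomp c d)).trans
      ((A.homData_hor_isLax X).cell_comp _ _))
    (funext fun b => (A.ccomp_assoc b c d).symm)
  src_unitLax _ := rfl
  tgt_unitLax _ := rfl
  src_cmpLax _ _ := rfl
  tgt_cmpLax _ _ := rfl
  unitLax_nat ψ := SetBasic.Hom.ext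
    (((A.homData_hor_isLax X).unitLax_nat (A.ver.src ψ)).trans
      (congrArg (fun t => spanSet.comp ((A.homData X).hor.unitLax _) ((A.homData X).hor.cell t))
        (A.faces.top_hunitCell ψ).symm))
    (congrArg (A.homData X).ver.cell (A.left_hunitCell ψ).symm)
    (congrArg (A.homData X).ver.cell (A.right_hunitCell ψ).symm)
    (((A.homData_hor_isLax X).unitLax_nat (A.ver.tgt ψ)).trans
      (congrArg (fun t => spanSet.comp ((A.homData X).hor.unitLax _) ((A.homData X).hor.cell t))
        (A.faces.bot_hunitCell ψ).symm))
    (funext fun θ => (congrArg _ (A.hunitCell_comp θ ψ)).trans (A.ccomp_assoc _ _ _).symm)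
  cmpLax_nat {_ _ _ _ _ _ h h' k k'} c d e e' := by
    -- The matching of the top and of the bottom faces is induced by that of the vertical cells
    -- shared by `c` and `d`.
    have ht : A.hor.tgt (A.top c) = A.hor.src (A.top d) :=
      (A.faces.tgt_top c).trans ((congrArg A.ver.src e).trans (A.faces.src_top d).symm)
    have hb : A.hor.tgt (A.bot c) = A.hor.src (A.bot d) :=
      (A.faces.tgt_bot c).trans ((congrArg A.ver.tgt e).trans (A.faces.src_bot d).symm)
    refine SetBasic.Hom.ext
      (((A.homData_hor_isLax X).cmpLax_nat (A.top c) (A.top d) ht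
        (congrArg (DoubleData.homBase X).map ht)).trans
        (congrArg (fun t => spanSet.comp ((A.homData X).hor.cmpLax _ _)
          ((A.homData X).hor.cell t)) (A.faces.top_hcmpCell c d e ht).symm))
      (congrArg (A.homData X).ver.cell (A.row_isWeak.src_cmpCell c d e).symm)
      (congrArg (A.homData X).ver.cell (A.row_isWeak.tgt_cmpCell c d e).symm)
      (((A.homData_hor_isLax X).cmpLax_nat (A.bot c) (A.bot d) hb
        (congrArg (DoubleData.homBase X).map hb)).trans
        (congrArg (fun t => spanSet.comp ((A.homData X).hor.cmpLax _ _)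
          ((A.homData X).hor.cell t)) (A.faces.bot_hcmpCell c d e hb).symm))
      (funext fun p => ?_)
    refine (A.homHcmp_eq _ _ _).trans ?_
    refine Eq.trans ?_ (congrArg (fun t => t ⬦ A.hcmpCell c d e)
      (A.homHcmp_eq p.1.1 p.1.2 p.2)).symm
    exact (congrArg _ (A.hcmpCell_ccomp p.1.1 c p.1.2 d p.2 e _)).trans
      (A.ccomp_assoc _ _ _).symm
  lax_lam α e := SetBasic.Hom.ext
    (((congrArg (fun t => spanSet.comp _ (spanSet.comp ((A.homData X).hor.cmpLax _ _)
      ((A.homData X).hor.cell t))) (A.faces.top_hlam α.cell))).trans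
      ((A.homData_hor_isLax X).lax_lam α.top rfl))
    (DoubleData.homLax_cell_eq_one X (A.row_isWeak.src_lam α))
    (DoubleData.homLax_cell_eq_one X (A.row_isWeak.tgt_lam α))
    (((congrArg (fun t => spanSet.comp _ (spanSet.comp ((A.homData X).hor.cmpLax _ _)
      ((A.homData X).hor.cell t))) (A.faces.bot_hlam α.cell))).trans
      ((A.homData_hor_isLax X).lax_lam α.bot rfl))
    (funext fun p => (congrArg (fun t => t ⬦ A.hlam α.cell) (A.homHcmp_eq _ _ _)).trans
      ((A.isComonoid_rowUnit X).comul_comp_lam (h := α) p.1.1 p.1.2 _))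
  lax_rho α e := SetBasic.Hom.ext
    (((congrArg (fun t => spanSet.comp _ (spanSet.comp ((A.homData X).hor.cmpLax _ _)
      ((A.homData X).hor.cell t))) (A.faces.top_hrho α.cell))).trans
      ((A.homData_hor_isLax X).lax_rho α.top rfl))
    (DoubleData.homLax_cell_eq_one X (A.row_isWeak.src_rho α))
    (DoubleData.homLax_cell_eq_one X (A.row_isWeak.tgt_rho α))
    (((congrArg (fun t => spanSet.comp _ (spanSet.comp ((A.homData X).hor.cmpLax _ _)
      ((A.homData X).hor.cell t))) (A.faces.bot_hrho α.cell))).trans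
      ((A.homData_hor_isLax X).lax_rho α.bot rfl))
    (funext fun p => (congrArg (fun t => t ⬦ A.hrho α.cell) (A.homHcmp_eq _ _ _)).trans
      ((A.isComonoid_rowUnit X).comul_comp_rho (h := α) p.1.1 p.1.2 _))
  lax_assoc α β γ e₁ e₂ := SetBasic.Hom.ext
    (((congrArg (fun t => spanSet.comp _ (spanSet.comp ((A.homData X).hor.cmpLax _ _)
      ((A.homData X).hor.cell t))) (A.faces.top_hassoc α.cell β.cell γ.cell))).trans
      ((A.homData_hor_isLax X).lax_assoc α.top β.top γ.top rfl rfl))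
    (DoubleData.homLax_cell_eq_one X (A.row_isWeak.src_assoc α β γ))
    (DoubleData.homLax_cell_eq_one X (A.row_isWeak.tgt_assoc α β γ))
    (((congrArg (fun t => spanSet.comp _ (spanSet.comp ((A.homData X).hor.cmpLax _ _)
      ((A.homData X).hor.cell t))) (A.faces.bot_hassoc α.cell β.cell γ.cell))).trans
      ((A.homData_hor_isLax X).lax_assoc α.bot β.bot γ.bot rfl rfl))
    (funext fun p => A.homHcmp_ccomp_hassoc p.1.1.1.1 p.1.1.1.2 p.1.2 p.1.1.2
      ((A.right_homHcmp _ _ _).trans p.2) p.2 (p.1.1.2.trans (A.left_homHcmp _ _ _).symm))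

/-- Here `U` is the weak unit of `A.col` at `id_X`, so the convolution laws for units apply on
apexes directly. -/
theorem homData_col_isLax : (A.homData X).col.IsLax where
  src_cell _ := rfl
  tgt_cell _ := rfl
  cell_one α := SetBasic.Hom.ext
    (DoubleData.homLax_cell_eq_one X (A.top_cone α.cell))
    (DoubleData.homLax_cell_eq_one X (A.left_cone α.cell))
    (DoubleData.homLax_cell_eq_one X (A.right_cone α.cell))
    (DoubleData.homLax_cell_eq_one X (A.bot_cone α.cell))
    (funext fun c => A.ccomp_cone c)
  -- Transversal composition is shared by `row` and `col`; only the bundling of the boundary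
  -- differs.
  cell_comp c d := (A.homData_row_isLax X).cell_comp (A := ⟨_, _, _⟩) (B := ⟨_, _, _⟩)
    (A' := ⟨_, _, _⟩) (B' := ⟨_, _, _⟩) (A'' := ⟨_, _, _⟩) (B'' := ⟨_, _, _⟩)
    (h := ⟨_, _, _⟩) (k := ⟨_, _, _⟩) (l := ⟨_, _, _⟩) c d
  src_unitLax _ := rfl
  tgt_unitLax _ := rfl
  src_cmpLax _ _ := rfl
  tgt_cmpLax _ _ := rfl
  unitLax_nat φ := SetBasic.Hom.ext
    (congrArg (A.homData X).hor.cell (A.top_vunitCell φ).symm)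
    (((A.homData_ver_isLax X).unitLax_nat (A.hor.src φ)).trans
      (congrArg (fun t => spanSet.comp ((A.homData X).ver.unitLax _) ((A.homData X).ver.cell t))
        (A.faces.left_vunitCell φ).symm))
    (((A.homData_ver_isLax X).unitLax_nat (A.hor.tgt φ)).trans
      (congrArg (fun t => spanSet.comp ((A.homData X).ver.unitLax _) ((A.homData X).ver.cell t))
        (A.faces.right_vunitCell φ).symm))
    (congrArg (A.homData X).hor.cell (A.bot_vunitCell φ).symm)
    (funext fun θ => A.vunitCell_comp θ φ)
  cmpLax_nat c d e e' := by
    have hl : A.ver.tgt (A.left c) = A.ver.src (A.left d) :=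
      (A.faces.src_bot c).symm.trans ((congrArg A.hor.src e).trans (A.faces.src_top d))
    have hr : A.ver.tgt (A.right c) = A.ver.src (A.right d) :=
      (A.faces.tgt_bot c).symm.trans ((congrArg A.hor.tgt e).trans (A.faces.tgt_top d))
    refine SetBasic.Hom.ext
      (congrArg (A.homData X).hor.cell (A.col_isWeak.src_cmpCell c d e).symm)
      (((A.homData_ver_isLax X).cmpLax_nat (A.left c) (A.left d) hl
        (congrArg (DoubleData.homBase X).map hl)).trans
        (congrArg (fun t => spanSet.comp ((A.homData X).ver.cmpLax _ _)
          ((A.homData X).ver.cell t)) (A.faces.left_vcmpCell c d e hl).symm))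
      (((A.homData_ver_isLax X).cmpLax_nat (A.right c) (A.right d) hr
        (congrArg (DoubleData.homBase X).map hr)).trans
        (congrArg (fun t => spanSet.comp ((A.homData X).ver.cmpLax _ _)
          ((A.homData X).ver.cell t)) (A.faces.right_vcmpCell c d e hr).symm))
      (congrArg (A.homData X).hor.cell (A.col_isWeak.tgt_cmpCell c d e).symm)
      (funext fun p => ?_)
    exact (congrArg _ (A.vcmpCell_ccomp p.1.1 c p.1.2 d p.2 e _)).trans
      (A.ccomp_assoc _ _ _).symm
  lax_lam α e := SetBasic.Hom.ext
    (DoubleData.homLax_cell_eq_one X (A.col_isWeak.src_lam α))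
    (((congrArg (fun t => spanSet.comp _ (spanSet.comp ((A.homData X).ver.cmpLax _ _)
      ((A.homData X).ver.cell t))) (A.faces.left_vlam α.cell))).trans
      ((A.homData_ver_isLax X).lax_lam α.left rfl))
    (((congrArg (fun t => spanSet.comp _ (spanSet.comp ((A.homData X).ver.cmpLax _ _)
      ((A.homData X).ver.cell t))) (A.faces.right_vlam α.cell))).trans
      ((A.homData_ver_isLax X).lax_lam α.right rfl))
    (DoubleData.homLax_cell_eq_one X (A.col_isWeak.tgt_lam α))
    (funext fun p => DoubleData.lamInv_comp_cmpCell_comp_lam (D := A.col)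
      (X := ⟨X, X, A.hor.unit X⟩) (h := α) p.1.1 p.1.2 _)
  lax_rho α e := SetBasic.Hom.ext
    (DoubleData.homLax_cell_eq_one X (A.col_isWeak.src_rho α))
    (((congrArg (fun t => spanSet.comp _ (spanSet.comp ((A.homData X).ver.cmpLax _ _)
      ((A.homData X).ver.cell t))) (A.faces.left_vrho α.cell))).trans
      ((A.homData_ver_isLax X).lax_rho α.left rfl))
    (((congrArg (fun t => spanSet.comp _ (spanSet.comp ((A.homData X).ver.cmpLax _ _)
      ((A.homData X).ver.cell t))) (A.faces.right_vrho α.cell))).trans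
      ((A.homData_ver_isLax X).lax_rho α.right rfl))
    (DoubleData.homLax_cell_eq_one X (A.col_isWeak.tgt_rho α))
    (funext fun p => DoubleData.lamInv_comp_cmpCell_comp_rho (D := A.col)
      (X := ⟨X, X, A.hor.unit X⟩) (h := α) p.1.1 p.1.2 _)
  lax_assoc α β γ e₁ e₂ := SetBasic.Hom.ext
    (DoubleData.homLax_cell_eq_one X (A.col_isWeak.src_assoc α β γ))
    (((congrArg (fun t => spanSet.comp _ (spanSet.comp ((A.homData X).ver.cmpLax _ _)
      ((A.homData X).ver.cell t))) (A.faces.left_vassoc α.cell β.cell γ.cell))).trans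
      ((A.homData_ver_isLax X).lax_assoc α.left β.left γ.left rfl rfl))
    (((congrArg (fun t => spanSet.comp _ (spanSet.comp ((A.homData X).ver.cmpLax _ _)
      ((A.homData X).ver.cell t))) (A.faces.right_vassoc α.cell β.cell γ.cell))).trans
      ((A.homData_ver_isLax X).lax_assoc α.right β.right γ.right rfl rfl))
    (DoubleData.homLax_cell_eq_one X (A.col_isWeak.tgt_assoc α β γ))
    (funext fun p => (DoubleData.isComonoid_unit (D := A.col)
      ⟨X, X, A.hor.unit X⟩).comul_comp_assoc (h := α) (k := β) (l := γ) p.1.1.1.1 p.1.1.1.2 p.1.2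
      p.1.1.2 ((A.bot_homVcmp _ _ _).trans p.2) p.2 (p.1.1.2.trans (A.top_homVcmp _ _ _).symm))

/-! ### Compatibility with the interchangers, elementwise -/

/-- Naturality of `μ` moves `ψ` and `θ` behind it, leaving the identity about `τ` and `μ` at the
vertical unit. -/
theorem homData_lax_mu {P Q R : Obj} {v : A.ver.Arr P Q} {v' : A.ver.Arr Q R}
    (ψ : A.ver.Cell (A.ver.unit X) v) (θ : A.ver.Cell (A.ver.unit X) v') (e e' : _) :
    A.homVcmp (A.homHunit ψ) (A.homHunit θ) e ⬦ A.mu v v' =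
      A.homHunit (A.ver.lamInv (A.ver.unit X) ⋄ A.ver.cmpCell ψ θ e') := by
  have e₁ : A.bot (A.tau X) = A.top (A.tau X) := by
    rw [(A.interchange.tau_special X).bot, (A.interchange.tau_special X).top]
  have e₂ : A.bot (A.hunitCell ψ) = A.top (A.hunitCell θ) := by
    rw [A.faces.bot_hunitCell, A.faces.top_hunitCell, e']
  unfold homVcmp
  refine (congrArg (fun t => (_ ⬦ t) ⬦ _) (A.vcmpCell_ccomp _ _ _ _ e₁ e₂ _)).trans ?_
  simp only [ccomp_assoc]
  rw [A.interchange.mu_nat _ _ e']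
  have key := A.vlamInv_ccomp_vcmpCell_tau_ccomp_mu X e₁
  have := congrArg (fun t => t ⬦ A.hunitCell (A.ver.cmpCell ψ θ e')) key
  simp only [ccomp_assoc] at this
  rw [this, homHunit, hunitCell_comp]

theorem homData_lax_delta {P Q R : Obj} {h : A.hor.Arr P Q} {h' : A.hor.Arr Q R}
    (φ : A.hor.Cell (A.hor.unit X) h) (θ : A.hor.Cell (A.hor.unit X) h') (e e' : _) :
    A.vunitCell (A.hor.lamInv (A.hor.unit X) ⋄ A.hor.cmpCell φ θ e) ⬦ A.delta h h' =
      A.homHcmp (A.vunitCell φ) (A.vunitCell θ) e' := by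
  rw [vunitCell_comp, ccomp_assoc, A.interchange.delta_nat _ _ _ e', homHcmp]

/-- Naturality of `χ` moves the four given cubes behind it, leaving the identity about `χ` and the
comultiplication of `U`. -/
theorem homData_lax_chi {P₀ P₁ P₂ Q₀ Q₁ Q₂ R₀ R₁ R₂ : Obj}
    {h : A.hor.Arr P₀ P₁} {h' : A.hor.Arr P₁ P₂} {k : A.hor.Arr Q₀ Q₁} {k' : A.hor.Arr Q₁ Q₂}
    {l : A.hor.Arr R₀ R₁} {l' : A.hor.Arr R₁ R₂} {v₀ : A.ver.Arr P₀ Q₀} {v₁ : A.ver.Arr P₁ Q₁}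
    {v₂ : A.ver.Arr P₂ Q₂} {w₀ : A.ver.Arr Q₀ R₀} {w₁ : A.ver.Arr Q₁ R₁} {w₂ : A.ver.Arr Q₂ R₂}
    {α : A.Basic h v₀ v₁ k} {β : A.Basic h' v₁ v₂ k'} {γ : A.Basic k w₀ w₁ l}
    {ε : A.Basic k' w₁ w₂ l'} (a : A.Cube (A.vunit (A.hor.unit X)) α)
    (b : A.Cube (A.vunit (A.hor.unit X)) β) (c : A.Cube (A.vunit (A.hor.unit X)) γ)
    (d : A.Cube (A.vunit (A.hor.unit X)) ε) (e₁ e₂ e₃ e₄ e₅ e₆ : _) :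
    A.homVcmp (A.homHcmp a b e₁) (A.homHcmp c d e₂) e₃ ⬦ A.chi α β γ ε =
      A.homHcmp (A.homVcmp a c e₄) (A.homVcmp b d e₅) e₆ := by
  have e₇ : A.bot (A.comul X) = A.top (A.comul X) := by rw [bot_comul, top_comul]
  have hab : A.hor.tgt (A.bot a) = A.hor.src (A.bot b) := by
    rw [A.faces.tgt_bot, A.faces.src_bot, e₁]
  have hcd : A.hor.tgt (A.top c) = A.hor.src (A.top d) := by
    rw [A.faces.tgt_top, A.faces.src_top, e₂]
  -- The two rows match as they stand, without their comultiplications, because the matching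
  -- conditions hold for each column separately.
  have e₈ : A.bot (A.hcmpCell a b e₁) = A.top (A.hcmpCell c d e₂) := by
    rw [A.faces.bot_hcmpCell _ _ _ hab, A.faces.top_hcmpCell _ _ _ hcd]
    exact DoubleData.cmpCell_congr e₄ e₅ _ _
  have hac : A.ver.tgt (A.right a) = A.ver.src (A.right c) := by
    rw [← A.faces.tgt_bot, ← A.faces.tgt_top, e₄]
  have hbd : A.ver.tgt (A.left b) = A.ver.src (A.left d) := by
    rw [← A.faces.src_bot, ← A.faces.src_top, e₅]
  have e₉ : A.right (A.vcmpCell a c e₄) = A.left (A.vcmpCell b d e₅) := by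
    rw [A.faces.right_vcmpCell _ _ _ hac, A.faces.left_vcmpCell _ _ _ hbd]
    exact DoubleData.cmpCell_congr e₁ e₂ _ _
  have e₀ : A.right (A.vlamInv (A.vunit (A.hor.unit X))) =
      A.left (A.vlamInv (A.vunit (A.hor.unit X))) := by
    rw [left_vlamInv, right_vlamInv]
  have hl : A.homVcmp (A.homHcmp a b e₁) (A.homHcmp c d e₂) e₃ =
      A.vlamInv _ ⬦ A.vcmpCell _ _ e₇ ⬦ A.vcmpCell _ _ e₈ :=
    congrArg _ ((A.vcmpCell_congr (A.homHcmp_eq a b e₁) (A.homHcmp_eq c d e₂) _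
      (by simp [bot_ccomp, top_ccomp, e₇, e₈])).trans (A.vcmpCell_ccomp _ _ _ _ e₇ e₈ _))
  have hr : A.homHcmp (A.homVcmp a c e₄) (A.homVcmp b d e₅) e₆ =
      A.comul X ⬦ A.hcmpCell _ _ e₀ ⬦ A.hcmpCell _ _ e₉ :=
    (A.homHcmp_eq _ _ _).trans (congrArg _ (A.hcmpCell_ccomp _ _ _ _ e₀ e₉ _))
  rw [hl, hr]
  simp only [ccomp_assoc]
  rw [A.interchange.chi_nat a b c d e₁ e₂ e₄ e₅ _ e₉]
  have := congrArg (fun t => t ⬦ A.hcmpCell (A.vcmpCell a c e₄) (A.vcmpCell b d e₅) e₉)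
    (A.vlamInv_ccomp_vcmpCell_comul_ccomp_chi X e₇ e₀)
  simpa only [ccomp_assoc] using this

end Intercategory

theorem mainTheorem1 {Obj : Type u} [Category.{v} Obj] (A : Intercategory.{v, w₁, w₂, w₃} Obj)
    (X : Obj) : (A.homData X).IsLaxLax where
  hor := A.homData_hor_isLax X
  ver := A.homData_ver_isLax X
  row := A.homData_row_isLax X
  col := A.homData_col_isLax X
  top_hunitLax _ := rfl
  bot_hunitLax _ := rfl
  top_hcmpLax _ _ := rfl
  bot_hcmpLax _ _ := rfl
  left_vunitLax _ := rfl
  right_vunitLax _ := rfl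
  left_vcmpLax _ _ := rfl
  right_vcmpLax _ _ := rfl
  lax_tau B := by
    have h := A.interchange.tau_special B
    -- At an element `f : X ⟶ B` the condition is the naturality square of `τ` at `f`. In all four
    -- conditions the interchanger of `A` is special, so its image has identity faces.
    refine SetBasic.Hom.ext ?_ ?_ ?_ ?_ (funext fun f => A.interchange.tau_nat f)
    · exact congrArg (spanSet.comp ((A.homData X).hor.unitLax B))
        (DoubleData.homLax_cell_eq_one X h.top)
    · exact congrArg (spanSet.comp ((A.homData X).ver.unitLax B))
        (DoubleData.homLax_cell_eq_one X h.left)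
    · exact congrArg (spanSet.comp ((A.homData X).ver.unitLax B))
        (DoubleData.homLax_cell_eq_one X h.right)
    · exact congrArg (spanSet.comp ((A.homData X).hor.unitLax B))
        (DoubleData.homLax_cell_eq_one X h.bot)
  lax_mu v v' e := by
    have h := A.interchange.mu_special v v'
    refine SetBasic.Hom.ext ?_ ?_ ?_ ?_ (funext fun p => A.homData_lax_mu X p.1.1 p.1.2 _ p.2)
    · exact congrArg (spanSet.comp ((A.homData X).hor.unitLax _))
        (DoubleData.homLax_cell_eq_one X h.top)
    · exact congrArg (spanSet.comp ((A.homData X).ver.cmpLax _ _))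
        (DoubleData.homLax_cell_eq_one X h.left)
    · exact congrArg (spanSet.comp ((A.homData X).ver.cmpLax _ _))
        (DoubleData.homLax_cell_eq_one X h.right)
    · exact congrArg (spanSet.comp ((A.homData X).hor.unitLax _))
        (DoubleData.homLax_cell_eq_one X h.bot)
  lax_delta k k' e := by
    have h := A.interchange.delta_special k k'
    refine SetBasic.Hom.ext ?_ ?_ ?_ ?_ (funext fun p => A.homData_lax_delta X p.1.1 p.1.2 p.2 _)
    · exact congrArg (spanSet.comp ((A.homData X).hor.cmpLax _ _))
        (DoubleData.homLax_cell_eq_one X h.top)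
    · exact congrArg (spanSet.comp ((A.homData X).ver.unitLax _))
        (DoubleData.homLax_cell_eq_one X h.left)
    · exact congrArg (spanSet.comp ((A.homData X).ver.unitLax _))
        (DoubleData.homLax_cell_eq_one X h.right)
    · exact congrArg (spanSet.comp ((A.homData X).hor.cmpLax _ _))
        (DoubleData.homLax_cell_eq_one X h.bot)
  lax_chi α β γ ε e₁ e₂ := by
    have h := A.interchange.chi_special α β γ ε
    -- An element `p` is a two-by-two block of cubes: a matching pair for each row, and in `p.2` an
    -- equality of pairs of horizontal cells whose components match the two columns.
    refine SetBasic.Hom.ext ?_ ?_ ?_ ?_ (funext fun p => A.homData_lax_chi X p.1.1.1.1 p.1.1.1.2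
      p.1.2.1.1 p.1.2.1.2 p.1.1.2 p.1.2.2 _ (congrArg (fun q => q.1.1) p.2)
      (congrArg (fun q => q.1.2) p.2) _)
    · exact congrArg (spanSet.comp ((A.homData X).hor.cmpLax _ _))
        (DoubleData.homLax_cell_eq_one X h.top)
    · exact congrArg (spanSet.comp ((A.homData X).ver.cmpLax _ _))
        (DoubleData.homLax_cell_eq_one X h.left)
    · exact congrArg (spanSet.comp ((A.homData X).ver.cmpLax _ _))
        (DoubleData.homLax_cell_eq_one X h.right)
    · exact congrArg (spanSet.comp ((A.homData X).hor.cmpLax _ _))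
        (DoubleData.homLax_cell_eq_one X h.bot)
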